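/- Let $\Omega\subset\mathbb R^2$ be a bounded convex polygonal domain and let $\mathcal T$ be a conforming triangulation of $\Omega$ into finitely many open triangles which is shape-regular with constant $\kappa$, i.e. $\operatorname{diam}(T)^2\le\kappa|T|$ for all $T\in\mathcal T$. *Spaces.* Write $(\cdot,\cdot)_\omega$ for the $L^2(\omega)$ inner product (with the Frobenius product $M:Q$ for matrix fields), $(\cdot,\cdot)=(\cdot,\cdot)_\Omega$, and $L^2_{\rm sym}(\omega)$ for the symmetric $2\times2$ matrix fields with entries in $L^2(\omega)$. Let $H({\rm div\,Div};T)$ be the completion of the symmetric matrix fields that are smooth on $\overline T$ in the norm $(\|Q\|_T^2+\|{\rm div\,Div}\,Q\|_T^2)^{1/2}$, and let $Q:=H({\rm div\,Div};\mathcal T):=\prod_{T\in\mathcal T}H({\rm div\,Div};T)$ with the product Hilbert norm. For $u\in H^2(T)$ define $\operatorname{tr}^2_Tu\in H({\rm div\,Div};T)'$ by $\langle \operatorname{tr}^2_T u,Q\rangle_{\partial T}:=({\rm div\,Div}\,Q,u)_T-(Q,D^2u)_T$, and for $u\in H^2(\Omega)$ define $\operatorname{tr}^2_{\mathcal T}u\in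 H({\rm div\,Div};\mathcal T)'$ by $\langle\operatorname{tr}^2_{\mathcal T}u,Q\rangle_{\mathcal S}:=\sum_T\langle \operatorname{tr}^2_T u,Q\rangle_{\partial T}$. Let $\widehat U:=\operatorname{tr}^2_{\mathcal T}(H^2(\Omega)\cap H^1_0(\Omega))$, $$U:=L^2(\Omega)\times L^2_{\rm sym}(\Omega)\times\widehat U,\qquad V:=L^2(\Omega)\times H({\rm div\,Div};\mathcal T),\qquad \|(v,Q)\|_V^2:=\|v\|^2+\|Q\|_{H({\rm div\,Div};\mathcal T)}^2 .$$ For a coefficient matrix $A$ and $\boldsymbol u=(u,M,\widehat u)\in U$, $\boldsymbol v=(v,Q)\in V$ let $$b(\boldsymbol u,\boldsymbol v):=-\sum_{T\in\mathcal T}(u,{\rm div\,Div}\,Q)_T+(M,Av+Q)+\langle\widehat u,Q\rangle_{\mathcal S}.$$ *Discrete spaces.* Let $\mathcal P^p(\mathcal T)$ be the space of functions on $\Omega$ that are on each $T\in\mathcal T$ a polynomial of degree at most $p$, and $\Pi^p:L^2(\Omega)\to\mathcal P^p(\mathcal T)$ the $L^2(\Omega)$-orthogonal projection. Let $U_T$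 be the space of all $v\in H^2(T)$ with $\Delta^2v+v=0$ such that on each edge of $T$ the trace $v$ is a polynomial of degree at most $3$ and $n_T\cdot\nabla v$ is a polynomial of degree at most $1$; put $\widehat U_T:=\operatorname{tr}^2_T(U_T)$ (the traces of reduced Hsieh–Clough–Tocher functions), $\widehat U_h:=\{\widehat v\in\widehat U:\widehat v|_{\partial T}\in\widehat U_T\ \forall T\in\mathcal T\}$, where $\widehat v|_{\partial T}$ is the restriction of the functional $\widehat v$ to the factor $H({\rm div\,Div};T)$, and $$U_h:=\mathcal P^0(\mathcal T)\times\big(\mathcal P^0(\mathcal T)^{2\times2}\cap L^2_{\rm sym}(\Omega)\big)\times\widehat U_h,\quad Q_h:=\mathcal P^4(\mathcal T)^{2\times2}\cap L^2_{\rm sym}(\Omega),\quad V_{hp}:=\mathcal P^p(\mathcal T)\times Q_h .$$ *Claim.* There is a constant $C_F>0$ depending only on $\Omega$ and $\kappa$ such that for every such $\mathcal T$ there is a linear operator $\Pi^{\rm dDiv}:Q\to Q_h$ with, for all $Q\in H({\rm div\,Div};\mathcal T)$, $$\langle\widehat u,\Pi^{\rm dDiv}Q\rangle_{\mathcal S}=\langle\widehat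 u,Q\rangle_{\mathcal S}\ \ \forall\,\widehat u\in\widehat U_h,\qquad (M,\Pi^{\rm dDiv}Q)=(M,Q)\ \ \forall M\in\mathcal P^0(\mathcal T)^{2\times2}\cap L^2_{\rm sym}(\Omega),$$ $$\sum_T(u,{\rm div\,Div}\,\Pi^{\rm dDiv}Q)_T=\sum_T(u,{\rm div\,Div}\,Q)_T\ \ \forall u\in\mathcal P^2(\mathcal T),\qquad \|\Pi^{\rm dDiv}Q\|_{H({\rm div\,Div};\mathcal T)}\le C_F\|Q\|_{H({\rm div\,Div};\mathcal T)},$$ and such that for every $p\in\mathbb N_0$ and every $A\in\mathcal P^p(\mathcal T)^{2\times2}\cap L^2_{\rm sym}(\Omega)$ the operator $\Pi_F:=(\Pi^p,\Pi^{\rm dDiv}):V\to V_{hp}$ is a Fortin operator, i.e. $V_{hp}$ is a finite-dimensional subspace of $V$ and $$\|\Pi_F\boldsymbol v\|_V\le C_F\|\boldsymbol v\|_V,\qquad b(\boldsymbol u_h,\Pi_F\boldsymbol v)=b(\boldsymbol u_h,\boldsymbol v)\qquad\forall\,\boldsymbol u_h\in U_h,\ \boldsymbol v\in V .$$ -/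

import Mathlib

open MeasureTheory Filter Topology
open scoped ContDiff RealInnerProductSpace ENNReal

noncomputable section

namespace DPG

/-! ### The plane, `L²` spaces, classical derivatives -/

/-- The Euclidean plane. -/
abbrev Pt : Type := EuclideanSpace ℝ (Fin 2)

/-- Real `2 × 2` matrices with the Frobenius inner product. -/
abbrev Mat : Type := EuclideanSpace ℝ (Fin 2 × Fin 2)

/-- `L²(G)`. -/
abbrev L2 (G : Set Pt) : Type := Lp ℝ 2 (volume.restrict G)

/-- `L²(G)^{2×2}`; its inner product is `∫_G M : Q`. -/
abbrev L2Mat (G : Set Pt) : Type := Lp Mat 2 (volume.restrict G)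

/-- Classical partial derivative `∂ᵢ f`. -/
def pd (i : Fin 2) (f : Pt → ℝ) : Pt → ℝ :=
  fun x => fderiv ℝ f x (EuclideanSpace.single i 1)

/-- Classical Laplacian. -/
def lap (f : Pt → ℝ) : Pt → ℝ := fun x => ∑ i, pd i (pd i f) x

/-- Classical `div Div q = ∑ᵢⱼ ∂ᵢ ∂ⱼ qᵢⱼ`. -/
def divDiv (q : Pt → Mat) : Pt → ℝ :=
  fun x => ∑ i, ∑ j, pd i (pd j (fun y => q y (i, j))) x

/-- Classical Hessian. -/
def hess (f : Pt → ℝ) : Pt → Mat :=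
  fun x => WithLp.toLp 2 (fun ij : Fin 2 × Fin 2 => pd ij.2 (pd ij.1 f) x)

/-- Test functions `C_c^∞(G)`. -/
def IsTest (G : Set Pt) (φ : Pt → ℝ) : Prop :=
  ContDiff ℝ ∞ φ ∧ HasCompactSupport φ ∧ tsupport φ ⊆ G

theorem contDiff_pd {f : Pt → ℝ} (hf : ContDiff ℝ ∞ f) (i : Fin 2) : ContDiff ℝ ∞ (pd i f) := by
  unfold pd
  exact (hf.fderiv_right (m := ∞) (by simp)).clm_apply contDiff_const

theorem pd_add {f g : Pt → ℝ} (hf : ContDiff ℝ ∞ f) (hg : ContDiff ℝ ∞ g) (i : Fin 2) :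
    pd i (f + g) = pd i f + pd i g := by
  funext x
  simp only [pd, Pi.add_apply]
  rw [fderiv_add (hf.differentiable (by simp) x) (hg.differentiable (by simp) x)]
  rfl

theorem pd_smul {f : Pt → ℝ} (c : ℝ) (i : Fin 2) : pd i (c • f) = c • pd i f := by
  funext x
  simp only [pd, Pi.smul_apply]
  rw [fderiv_const_smul_field]
  rfl

theorem pd_zero (i : Fin 2) : pd i (0 : Pt → ℝ) = 0 := by
  funext x
  simp [pd]

theorem hess_add {f g : Pt → ℝ} (hf : ContDiff ℝ ∞ f) (hg : ContDiff ℝ ∞ g) :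
    hess (f + g) = hess f + hess g := by
  funext x
  ext ij
  simp [hess, pd_add hf hg, pd_add (contDiff_pd hf _) (contDiff_pd hg _)]

theorem hess_smul {f : Pt → ℝ} (c : ℝ) : hess (c • f) = c • hess f := by
  funext x
  ext ij
  simp [hess, pd_smul]

theorem hess_zero : hess (0 : Pt → ℝ) = 0 := by
  funext x
  ext ij
  simp [hess, pd_zero]

theorem contDiff_entry {q : Pt → Mat} (hq : ContDiff ℝ ∞ q) (ij : Fin 2 × Fin 2) :
    ContDiff ℝ ∞ (fun x => q x ij) := by
  fun_prop

theorem divDiv_add {q r : Pt → Mat} (hq : ContDiff ℝ ∞ q) (hr : ContDiff ℝ ∞ r) :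
    divDiv (q + r) = divDiv q + divDiv r := by
  funext x
  have key : ∀ i j : Fin 2, pd i (pd j (fun y => (q + r) y (i, j))) x
      = pd i (pd j (fun y => q y (i, j))) x + pd i (pd j (fun y => r y (i, j))) x := by
    intro i j
    have h : (fun y => (q + r) y (i, j)) = (fun y => q y (i, j)) + (fun y => r y (i, j)) := rfl
    rw [h, pd_add (contDiff_entry hq _) (contDiff_entry hr _),
      pd_add (contDiff_pd (contDiff_entry hq _) _) (contDiff_pd (contDiff_entry hr _) _)]
    rfl
  simp only [Pi.add_apply (divDiv q), divDiv]
  simp only [key, Finset.sum_add_distrib]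

theorem divDiv_smul {q : Pt → Mat} (c : ℝ) : divDiv (c • q) = c • divDiv q := by
  funext x
  have key : ∀ i j : Fin 2, pd i (pd j (fun y => (c • q) y (i, j))) x
      = c * pd i (pd j (fun y => q y (i, j))) x := by
    intro i j
    have h : (fun y => (c • q) y (i, j)) = c • (fun y => q y (i, j)) := rfl
    rw [h, pd_smul, pd_smul]
    rfl
  simp only [Pi.smul_apply c (divDiv q), divDiv]
  simp only [key, smul_eq_mul, Finset.mul_sum]

theorem IsTest.pd {G : Set Pt} {φ : Pt → ℝ} (h : IsTest G φ) (i : Fin 2) :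
    IsTest G (pd i φ) := by
  refine ⟨contDiff_pd h.1 i, ?_, ?_⟩
  · exact h.2.1.fderiv_apply (𝕜 := ℝ) _
  · exact (tsupport_fderiv_apply_subset ℝ _).trans h.2.2

theorem IsTest.add {G : Set Pt} {φ ψ : Pt → ℝ} (h : IsTest G φ) (h' : IsTest G ψ) :
    IsTest G (φ + ψ) :=
  ⟨h.1.add h'.1, h.2.1.add h'.2.1,
    (tsupport_add φ ψ).trans (Set.union_subset h.2.2 h'.2.2)⟩

theorem IsTest.smul {G : Set Pt} {φ : Pt → ℝ} (c : ℝ) (h : IsTest G φ) : IsTest G (c • φ) :=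
  ⟨h.1.const_smul c, h.2.1.smul_left (f := fun _ => c),
    (tsupport_smul_subset_right (fun _ => c) φ).trans h.2.2⟩

theorem isTest_zero (G : Set Pt) : IsTest G 0 :=
  ⟨contDiff_const, HasCompactSupport.zero, by simp⟩

theorem IsTest.lap {G : Set Pt} {φ : Pt → ℝ} (h : IsTest G φ) : IsTest G (lap φ) := by
  have e : DPG.lap φ = DPG.pd 0 (DPG.pd 0 φ) + DPG.pd 1 (DPG.pd 1 φ) := by
    funext x
    simp [DPG.lap, Fin.sum_univ_two]
  rw [e]
  exact ((h.pd 0).pd 0).add ((h.pd 1).pd 1)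

/-- The entry `Qᵢⱼ ∈ L²(G)` of a matrix field. -/
def entry {G : Set Pt} (ij : Fin 2 × Fin 2) : L2Mat G →L[ℝ] L2 G :=
  (EuclideanSpace.proj ij : Mat →L[ℝ] ℝ).compLpL 2 (volume.restrict G)

theorem integrable_mul_test {G : Set Pt} (u : L2 G) {φ : Pt → ℝ} (hφ : IsTest G φ) :
    Integrable (fun x => u x * φ x) (volume.restrict G) :=
  MemLp.integrable_mul (p := 2) (q := 2) (Lp.memLp u)
    (hφ.1.continuous.memLp_of_hasCompactSupport hφ.2.1)

theorem integral_add_mul {G : Set Pt} (u v : L2 G) {φ : Pt → ℝ} (hφ : IsTest G φ) :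
    ∫ x in G, (u + v : L2 G) x * φ x = (∫ x in G, u x * φ x) + ∫ x in G, v x * φ x := by
  rw [← integral_add (integrable_mul_test u hφ) (integrable_mul_test v hφ)]
  refine integral_congr_ae ?_
  filter_upwards [Lp.coeFn_add u v] with x hx
  rw [hx, Pi.add_apply, add_mul]

theorem integral_smul_mul {G : Set Pt} (c : ℝ) (u : L2 G) (φ : Pt → ℝ) :
    ∫ x in G, (c • u : L2 G) x * φ x = c * ∫ x in G, u x * φ x := by
  rw [← integral_const_mul]
  refine integral_congr_ae ?_
  filter_upwards [Lp.coeFn_smul c u] with x hx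
  rw [hx, Pi.smul_apply, smul_eq_mul, mul_assoc]

theorem integral_zero_mul {G : Set Pt} (φ : Pt → ℝ) :
    ∫ x in G, (0 : L2 G) x * φ x = 0 := by
  have h := integral_smul_mul (G := G) 0 0 φ
  simpa using h

/-- `L²_sym(G)`: square-integrable symmetric matrix fields. -/
def L2sym (G : Set Pt) : Submodule ℝ (L2Mat G) where
  carrier := {Q | ∀ i j, entry (i, j) Q = entry (j, i) Q}
  add_mem' := by
    intro a b ha hb i j
    rw [map_add, map_add, ha i j, hb i j]
  zero_mem' := by
    intro i j
    rw [map_zero, map_zero]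
  smul_mem' := by
    intro c a ha i j
    rw [map_smul, map_smul, ha i j]

/-! ### Sobolev spaces -/

/-- `g ∈ L²(G)` is the weak partial derivative `∂ᵢ u` of `u ∈ L²(G)`. -/
def HasWeakPartial {G : Set Pt} (i : Fin 2) (u g : L2 G) : Prop :=
  ∀ φ : Pt → ℝ, IsTest G φ → ∫ x in G, u x * pd i φ x = -∫ x in G, g x * φ x

theorem HasWeakPartial.add {G : Set Pt} {i : Fin 2} {u g u' g' : L2 G}
    (h : HasWeakPartial i u g) (h' : HasWeakPartial i u' g') :
    HasWeakPartial i (u + u') (g + g') := by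
  intro φ hφ
  rw [integral_add_mul _ _ (hφ.pd i), integral_add_mul _ _ hφ, h φ hφ, h' φ hφ]
  ring

theorem HasWeakPartial.smul {G : Set Pt} {i : Fin 2} {u g : L2 G} (c : ℝ)
    (h : HasWeakPartial i u g) : HasWeakPartial i (c • u) (c • g) := by
  intro φ hφ
  rw [integral_smul_mul, integral_smul_mul, h φ hφ]
  ring

theorem HasWeakPartial.zero {G : Set Pt} {i : Fin 2} : HasWeakPartial i (0 : L2 G) 0 := by
  intro φ _
  rw [integral_zero_mul, integral_zero_mul, neg_zero]

/-- Triples (function, gradient, Hessian) of `L²` objects. -/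
abbrev Jet (G : Set Pt) : Type := L2 G × (Fin 2 → L2 G) × L2Mat G

/-- `H²(G)`: a function in `L²(G)` together with its (uniquely determined) weak gradient and weak
Hessian, all of them in `L²(G)`. -/
def H2 (G : Set Pt) : Submodule ℝ (Jet G) where
  carrier := {z | (∀ i, HasWeakPartial i z.1 (z.2.1 i)) ∧
    ∀ i j, HasWeakPartial j (z.2.1 i) (entry (i, j) z.2.2)}
  add_mem' := by
    intro a b ha hb
    refine ⟨fun i => (ha.1 i).add (hb.1 i), fun i j => ?_⟩
    have h := (ha.2 i j).add (hb.2 i j)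
    rw [← map_add] at h
    exact h
  zero_mem' := by
    refine ⟨fun i => HasWeakPartial.zero, fun i j => ?_⟩
    have h := HasWeakPartial.zero (G := G) (i := j)
    rw [← map_zero (entry (G := G) (i, j))] at h
    simpa using h
  smul_mem' := by
    intro c a ha
    refine ⟨fun i => (ha.1 i).smul c, fun i j => ?_⟩
    have h := (ha.2 i j).smul c
    rw [← map_smul] at h
    exact h

/-- Pairs `(φ, ∇φ)` with `φ ∈ C_c^∞(G)`. -/
def testGraph (G : Set Pt) : Submodule ℝ (L2 G × (Fin 2 → L2 G)) where
  carrier := {z | ∃ φ : Pt → ℝ, IsTest G φ ∧ z.1 =ᵐ[volume.restrict G] φ ∧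
    ∀ i, z.2 i =ᵐ[volume.restrict G] pd i φ}
  add_mem' := by
    rintro a b ⟨φ, hφ, h1, h2⟩ ⟨ψ, hψ, k1, k2⟩
    refine ⟨φ + ψ, hφ.add hψ, (Lp.coeFn_add _ _).trans (h1.add k1), fun i => ?_⟩
    rw [pd_add hφ.1 hψ.1]
    exact (Lp.coeFn_add _ _).trans ((h2 i).add (k2 i))
  zero_mem' := by
    refine ⟨0, isTest_zero G, Lp.coeFn_zero _ _ _, fun i => ?_⟩
    rw [pd_zero]
    exact Lp.coeFn_zero _ _ _
  smul_mem' := by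
    rintro c a ⟨φ, hφ, h1, h2⟩
    refine ⟨c • φ, hφ.smul c, (Lp.coeFn_smul _ _).trans (h1.const_smul c), fun i => ?_⟩
    rw [pd_smul]
    exact (Lp.coeFn_smul _ _).trans ((h2 i).const_smul c)

/-- `H¹₀(G)`, the closure of `C_c^∞(G)` in the `H¹` norm, as pairs (function, weak gradient). -/
def H10 (G : Set Pt) : Submodule ℝ (L2 G × (Fin 2 → L2 G)) := (testGraph G).topologicalClosure

/-- `X = H²(G) ∩ H¹₀(G)`. -/
def X (G : Set Pt) : Submodule ℝ (H2 G) where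
  carrier := {z | (z.1.1, z.1.2.1) ∈ H10 G}
  add_mem' := fun ha hb => (H10 G).add_mem ha hb
  zero_mem' := (H10 G).zero_mem
  smul_mem' := fun c _ ha => (H10 G).smul_mem c ha

/-! ### The space `H(div Div; G)` -/

/-- Pairs `(q, div Div q)` with `q` a symmetric matrix field that is smooth up to the boundary. -/
def smoothGraph (G : Set Pt) : Submodule ℝ (WithLp 2 (L2Mat G × L2 G)) where
  carrier := {z | ∃ q : Pt → Mat, ContDiff ℝ ∞ q ∧ (∀ x i j, q x (i, j) = q x (j, i)) ∧
    z.fst =ᵐ[volume.restrict G] q ∧ z.snd =ᵐ[volume.restrict G] divDiv q}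
  add_mem' := by
    rintro a b ⟨q, hq, sq, h1, h2⟩ ⟨r, hr, sr, k1, k2⟩
    refine ⟨q + r, hq.add hr, fun x i j => ?_, (Lp.coeFn_add _ _).trans (h1.add k1), ?_⟩
    · simp [sq x i j, sr x i j]
    · rw [divDiv_add hq hr]
      exact (Lp.coeFn_add _ _).trans (h2.add k2)
  zero_mem' := by
    refine ⟨0, contDiff_const, fun _ _ _ => rfl, Lp.coeFn_zero _ _ _, ?_⟩
    have h : divDiv 0 = 0 := by
      have := divDiv_smul (q := 0) 0
      simpa using this
    rw [h]
    exact Lp.coeFn_zero _ _ _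
  smul_mem' := by
    rintro c a ⟨q, hq, sq, h1, h2⟩
    refine ⟨c • q, hq.const_smul c, fun x i j => ?_,
      (Lp.coeFn_smul _ _).trans (h1.const_smul c), ?_⟩
    · simp [sq x i j]
    · rw [divDiv_smul]
      exact (Lp.coeFn_smul _ _).trans (h2.const_smul c)

/-- `H(div Div; G)`, the completion of the smooth symmetric matrix fields in the graph norm
`(‖Q‖² + ‖div Div Q‖²)^{1/2}`, realized as the closure of the graph of `div Div`. The component
`.fst` is `Q`, the component `.snd` is `div Div Q`, and the norm is the graph norm. -/
def HdDiv (G : Set Pt) : Submodule ℝ (WithLp 2 (L2Mat G × L2 G)) :=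
  (smoothGraph G).topologicalClosure

/-- The field `Q` of an element of `H(div Div; G)`. -/
def field {G : Set Pt} : HdDiv G →L[ℝ] L2Mat G :=
  (WithLp.fstL 2 ℝ (L2Mat G) (L2 G)).comp (HdDiv G).subtypeL

/-- `div Div Q` for an element `Q` of `H(div Div; G)`. -/
def dDiv {G : Set Pt} : HdDiv G →L[ℝ] L2 G :=
  (WithLp.sndL 2 ℝ (L2Mat G) (L2 G)).comp (HdDiv G).subtypeL

/-- The trace of `u ∈ H²(G)`, a functional on `H(div Div; G)`:
`⟨tr² u, Q⟩ = (div Div Q, u)_G - (Q, D²u)_G`. -/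
def jetTrace (G : Set Pt) : Jet G →ₗ[ℝ] StrongDual ℝ (HdDiv G) where
  toFun z := (innerSL ℝ z.1).comp dDiv - (innerSL ℝ z.2.2).comp field
  map_add' := by
    intro a b
    ext Q
    simp
    ring
  map_smul' := by
    intro c a
    ext Q
    simp
    ring

/-- The trace operator `tr²_G : H²(G) → H(div Div; G)'`. -/
def tr2 (G : Set Pt) : H2 G →ₗ[ℝ] StrongDual ℝ (HdDiv G) := (jetTrace G).comp (H2 G).subtype

/-! ### Domains, triangles, triangulations -/

/-- Bounded convex polygonal domains in the plane. -/
def IsConvexPolygon (Ω : Set Pt) : Prop :=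
  Ω.Nonempty ∧ ∃ S : Finset Pt, Ω = interior (convexHull ℝ (S : Set Pt))

/-- The closed triangle with the given vertices. -/
def closedTri (P : Fin 3 → Pt) : Set Pt := convexHull ℝ (Set.range P)

/-- The open triangle with the given vertices. -/
def tri (P : Fin 3 → Pt) : Set Pt := interior (closedTri P)

/-- A (conforming) triangulation of `Ω` into finitely many nondegenerate triangles. -/
structure Triangulation (Ω : Set Pt) where
  /-- the number of triangles -/
  n : ℕ
  /-- the vertices of the triangles -/
  vert : Fin n → Fin 3 → Pt
  nondeg : ∀ k, AffineIndependent ℝ (vert k)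
  subset : ∀ k, tri (vert k) ⊆ Ω
  disjoint : ∀ k l, k ≠ l → Disjoint (tri (vert k)) (tri (vert l))
  cover : ⋃ k, closedTri (vert k) = closure Ω
  conforming : ∀ k l, closedTri (vert k) ∩ closedTri (vert l) =
    convexHull ℝ (Set.range (vert k) ∩ Set.range (vert l))

/-- The open triangle number `k` of a triangulation. -/
abbrev Triangulation.cell {Ω : Set Pt} (𝒯 : Triangulation Ω) (k : Fin 𝒯.n) : Set Pt :=
  tri (𝒯.vert k)

/-- Shape-regularity with constant `κ`: `diam(T)² ≤ κ |T|` for all triangles. -/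
def Triangulation.ShapeRegular {Ω : Set Pt} (𝒯 : Triangulation Ω) (κ : ℝ) : Prop :=
  ∀ k, Metric.diam (𝒯.cell k) ^ 2 ≤ κ * volume.real (𝒯.cell k)

/-- Restriction of square-integrable functions to a subset. -/
def restr {F : Type} [NormedAddCommGroup F] [NormedSpace ℝ F] {G Ω : Set Pt} (h : G ⊆ Ω) :
    Lp F 2 (volume.restrict Ω) →ₗ[ℝ] Lp F 2 (volume.restrict G) where
  toFun u := ((Lp.memLp u).mono_measure (Measure.restrict_mono h le_rfl)).toLp u
  map_add' := by
    intro u v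
    apply Lp.ext
    refine (MemLp.coeFn_toLp _).trans ?_
    refine EventuallyEq.trans (Measure.restrict_mono h le_rfl |>.absolutelyContinuous.ae_le
      (Lp.coeFn_add u v)) ?_
    refine EventuallyEq.trans ?_ (Lp.coeFn_add _ _).symm
    exact ((MemLp.coeFn_toLp _).add (MemLp.coeFn_toLp _)).symm
  map_smul' := by
    intro c u
    apply Lp.ext
    refine (MemLp.coeFn_toLp _).trans ?_
    refine EventuallyEq.trans (Measure.restrict_mono h le_rfl |>.absolutelyContinuous.ae_le
      (Lp.coeFn_smul c u)) ?_
    refine EventuallyEq.trans ?_ (Lp.coeFn_smul _ _).symm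
    exact ((MemLp.coeFn_toLp _).const_smul c).symm

theorem coeFn_restr {F : Type} [NormedAddCommGroup F] [NormedSpace ℝ F] {G Ω : Set Pt}
    (h : G ⊆ Ω) (u : Lp F 2 (volume.restrict Ω)) : restr h u =ᵐ[volume.restrict G] u :=
  MemLp.coeFn_toLp ((Lp.memLp u).mono_measure (Measure.restrict_mono h le_rfl))

/-- Restriction of a jet to a subset. -/
def restrJet {G Ω : Set Pt} (h : G ⊆ Ω) : Jet Ω →ₗ[ℝ] Jet G where
  toFun z := (restr h z.1, fun i => restr h (z.2.1 i), restr h z.2.2)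
  map_add' := by
    intro a b
    simp only [Prod.fst_add, Prod.snd_add, Pi.add_apply, map_add]
    rfl
  map_smul' := by
    intro c a
    simp only [Prod.smul_fst, Prod.smul_snd, Pi.smul_apply, map_smul]
    rfl

/-! ### The spaces of the ultraweak formulation -/

section Mesh

variable {Ω : Set Pt} (𝒯 : Triangulation Ω)

/-- `Q = H(div Div; 𝒯) = ∏_T H(div Div; T)` with its product Hilbert norm. -/
abbrev QSpace : Type := PiLp 2 (fun k : Fin 𝒯.n => HdDiv (𝒯.cell k))

/-- The collective trace `tr²_𝒯 : H²(Ω) → H(div Div; 𝒯)'`,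
`⟨tr²_𝒯 u, Q⟩_𝒮 = ∑_T ⟨tr²_T u, Q⟩_{∂T}`. -/
def trMesh : H2 Ω →ₗ[ℝ] StrongDual ℝ (QSpace 𝒯) where
  toFun u := ∑ k, (jetTrace (𝒯.cell k) (restrJet (𝒯.subset k) u.1)).comp
    (PiLp.proj 2 (fun k : Fin 𝒯.n => HdDiv (𝒯.cell k)) k)
  map_add' := by
    intro a b
    simp [ContinuousLinearMap.add_comp, Finset.sum_add_distrib]
  map_smul' := by
    intro c a
    simp [ContinuousLinearMap.smul_comp, Finset.smul_sum]

/-- The skeleton space `Û = tr²_𝒯(X)`. -/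
def UHat : Submodule ℝ (StrongDual ℝ (QSpace 𝒯)) := (X Ω).map (trMesh 𝒯)

/-- The trial space `U = L²(Ω) × L²_sym(Ω) × Û`. -/
abbrev USpace : Type := L2 Ω × L2sym Ω × UHat 𝒯

/-- The test space `V = L²(Ω) × H(div Div; 𝒯)` with its product Hilbert norm. -/
abbrev VSpace : Type := WithLp 2 (L2 Ω × QSpace 𝒯)

/-- `(u, div Div Q)_𝒯 = ∑_T (u, div Div Q)_T`. -/
def pairDDiv (u : L2 Ω) (Q : QSpace 𝒯) : ℝ :=
  ∑ k, ⟪restr (𝒯.subset k) u, dDiv (Q k)⟫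

/-- `(M, Q) = ∑_T (M, Q)_T`. -/
def pairField (M : L2Mat Ω) (Q : QSpace 𝒯) : ℝ :=
  ∑ k, ⟪restr (𝒯.subset k) M, field (Q k)⟫

/-- The bilinear form `b(u, v) = (u, -div Div Q)_𝒯 + (M, A v + Q) + ⟨û, Q⟩_𝒮` for the trial
function `(u, M, û)` and the test function `(v, Q)`. -/
def bForm (A : L2sym Ω) (u : USpace 𝒯) (v : VSpace 𝒯) : ℝ :=
  -pairDDiv 𝒯 u.1 v.snd
    + ((∫ x in Ω, (∑ i, ∑ j, (u.2.1 : L2Mat Ω) x (i, j) * (A : L2Mat Ω) x (i, j)) * v.fst x)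
      + pairField 𝒯 u.2.1 v.snd)
    + (u.2.2 : StrongDual ℝ (QSpace 𝒯)) v.snd

end Mesh

/-! ### Piecewise polynomials -/

/-- `𝒫^p(G)`: polynomials of total degree at most `p`, as a subspace of `L²(G)`. -/
def Poly (p : ℕ) (G : Set Pt) : Submodule ℝ (L2 G) where
  carrier := {u | ∃ P : MvPolynomial (Fin 2) ℝ, P.totalDegree ≤ p ∧
    u =ᵐ[volume.restrict G] fun x => MvPolynomial.eval (fun i => x i) P}
  add_mem' := by
    rintro a b ⟨P, hP, h⟩ ⟨R, hR, k⟩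
    refine ⟨P + R, (MvPolynomial.totalDegree_add P R).trans (max_le hP hR), ?_⟩
    refine (Lp.coeFn_add _ _).trans ((h.add k).trans (ae_of_all _ fun x => ?_))
    simp
  zero_mem' := by
    refine ⟨0, by simp, (Lp.coeFn_zero _ _ _).trans (ae_of_all _ fun x => ?_)⟩
    simp
  smul_mem' := by
    rintro c a ⟨P, hP, h⟩
    refine ⟨c • P, (MvPolynomial.totalDegree_smul_le c P).trans hP, ?_⟩
    refine (Lp.coeFn_smul _ _).trans ((h.const_smul c).trans (ae_of_all _ fun x => ?_))
    simp

instance finiteDimensional_Poly (p : ℕ) (G : Set Pt) : FiniteDimensional ℝ (Poly p G) := by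
  have hm : ∀ P : MvPolynomial (Fin 2) ℝ, AEStronglyMeasurable
      (fun x : Pt => MvPolynomial.eval (fun i => x i) P) (volume.restrict G) := by
    intro P
    have hc : Continuous (fun x : Pt => MvPolynomial.eval (fun i => x i) P) :=
      (MvPolynomial.continuous_eval P).comp (by fun_prop)
    exact hc.aestronglyMeasurable
  let ev : MvPolynomial.restrictTotalDegree (Fin 2) ℝ p →ₗ[ℝ] (Pt →ₘ[volume.restrict G] ℝ) :=
    { toFun := fun P => AEEqFun.mk _ (hm P.1)
      map_add' := by
        intro P R
        rw [AEEqFun.mk_add_mk]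
        congr 1
        funext x
        simp
      map_smul' := by
        intro c P
        rw [RingHom.id_apply]
        refine Eq.trans ?_ (AEEqFun.smul_mk c _ (hm P.1))
        congr 1
        funext x
        simp }
  have hmem : ∀ u : Poly p G, ((u : L2 G) : Pt →ₘ[volume.restrict G] ℝ) ∈ LinearMap.range ev := by
    rintro ⟨u, P, hP, h⟩
    refine ⟨⟨P, (MvPolynomial.mem_restrictTotalDegree _ _ _).2 hP⟩, ?_⟩
    exact AEEqFun.ext ((AEEqFun.coeFn_mk _ _).trans h.symm)
  let j : Poly p G →ₗ[ℝ] LinearMap.range ev :=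
    { toFun := fun u => ⟨_, hmem u⟩
      map_add' := fun u v => rfl
      map_smul' := fun c u => rfl }
  refine Module.Finite.of_injective j ?_
  intro u v huv
  have h : ((u : L2 G) : Pt →ₘ[volume.restrict G] ℝ) = ((v : L2 G) : Pt →ₘ[volume.restrict G] ℝ) :=
    congrArg (fun w : LinearMap.range ev => (w : Pt →ₘ[volume.restrict G] ℝ)) huv
  exact Subtype.ext (Subtype.ext h)

/-! ### Boundary values of `H²` functions on a triangle -/

/-- `L²(0,1)`, used for functions on an edge in its affine parametrization. -/
abbrev L2I : Type := Lp ℝ 2 (volume.restrict (Set.Icc (0 : ℝ) 1))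

/-- The affine parametrization of the edge number `e` (from vertex `e` to vertex `e + 1`). -/
def edgePt (P : Fin 3 → Pt) (e : Fin 3) (t : ℝ) : Pt := P e + t • (P (e + 1) - P e)

/-- A unit normal to the edge number `e`; its orientation is irrelevant below. -/
def edgeNormal (P : Fin 3 → Pt) (e : Fin 3) : Pt :=
  ‖P (e + 1) - P e‖⁻¹ • !₂[(P (e + 1) - P e) 1, -(P (e + 1) - P e) 0]

/-- Normal derivative of a smooth function along the edge number `e`. -/
def normalDeriv (P : Fin 3 → Pt) (e : Fin 3) (φ : Pt → ℝ) (t : ℝ) : ℝ :=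
  ∑ i, edgeNormal P e i * pd i φ (edgePt P e t)

theorem normalDeriv_add (P : Fin 3 → Pt) (e : Fin 3) {φ ψ : Pt → ℝ} (hφ : ContDiff ℝ ∞ φ)
    (hψ : ContDiff ℝ ∞ ψ) : normalDeriv P e (φ + ψ) = normalDeriv P e φ + normalDeriv P e ψ := by
  funext t
  simp [normalDeriv, pd_add hφ hψ, mul_add, Finset.sum_add_distrib]

theorem normalDeriv_smul (P : Fin 3 → Pt) (e : Fin 3) (c : ℝ) (φ : Pt → ℝ) :
    normalDeriv P e (c • φ) = c • normalDeriv P e φ := by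
  funext t
  simp [normalDeriv, pd_smul, Fin.sum_univ_two]
  ring

/-- For functions `φ` smooth up to the boundary of the triangle, the triples consisting of the jet
`(φ, ∇φ, D²φ)`, the boundary values of `φ` and the boundary values of `n · ∇φ`. -/
def smoothTraceGraph (P : Fin 3 → Pt) :
    Submodule ℝ (Jet (tri P) × (Fin 3 → L2I) × (Fin 3 → L2I)) where
  carrier := {z | ∃ φ : Pt → ℝ, ContDiff ℝ ∞ φ ∧
    z.1.1 =ᵐ[volume.restrict (tri P)] φ ∧
    (∀ i, z.1.2.1 i =ᵐ[volume.restrict (tri P)] pd i φ) ∧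
    z.1.2.2 =ᵐ[volume.restrict (tri P)] hess φ ∧
    (∀ e, z.2.1 e =ᵐ[volume.restrict (Set.Icc (0 : ℝ) 1)] fun t => φ (edgePt P e t)) ∧
    ∀ e, z.2.2 e =ᵐ[volume.restrict (Set.Icc (0 : ℝ) 1)] normalDeriv P e φ}
  add_mem' := by
    rintro a b ⟨φ, hφ, h1, h2, h3, h4, h5⟩ ⟨ψ, hψ, k1, k2, k3, k4, k5⟩
    refine ⟨φ + ψ, hφ.add hψ, (Lp.coeFn_add _ _).trans (h1.add k1), fun i => ?_, ?_, fun e => ?_,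
      fun e => ?_⟩
    · rw [pd_add hφ hψ]
      exact (Lp.coeFn_add _ _).trans ((h2 i).add (k2 i))
    · rw [hess_add hφ hψ]
      exact (Lp.coeFn_add _ _).trans (h3.add k3)
    · exact (Lp.coeFn_add _ _).trans ((h4 e).add (k4 e))
    · rw [normalDeriv_add P e hφ hψ]
      exact (Lp.coeFn_add _ _).trans ((h5 e).add (k5 e))
  zero_mem' := by
    refine ⟨0, contDiff_const, Lp.coeFn_zero _ _ _, fun i => ?_, ?_, fun e => Lp.coeFn_zero _ _ _,
      fun e => ?_⟩
    · rw [pd_zero]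
      exact Lp.coeFn_zero _ _ _
    · rw [hess_zero]
      exact Lp.coeFn_zero _ _ _
    · have h : normalDeriv P e 0 = 0 := by
        funext t
        simp [normalDeriv, pd_zero]
      rw [h]
      exact Lp.coeFn_zero _ _ _
  smul_mem' := by
    rintro c a ⟨φ, hφ, h1, h2, h3, h4, h5⟩
    refine ⟨c • φ, hφ.const_smul c, (Lp.coeFn_smul _ _).trans (h1.const_smul c), fun i => ?_, ?_,
      fun e => ?_, fun e => ?_⟩
    · rw [pd_smul]
      exact (Lp.coeFn_smul _ _).trans ((h2 i).const_smul c)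
    · rw [hess_smul]
      exact (Lp.coeFn_smul _ _).trans (h3.const_smul c)
    · exact (Lp.coeFn_smul _ _).trans ((h4 e).const_smul c)
    · rw [normalDeriv_smul]
      exact (Lp.coeFn_smul _ _).trans ((h5 e).const_smul c)

/-- The graph of the trace operator `v ↦ (v|_{∂T}, n · ∇v|_{∂T})` on `H²(T)`, which is the
continuous extension of the classical one from functions smooth up to the boundary. -/
def traceGraph (P : Fin 3 → Pt) : Submodule ℝ (Jet (tri P) × (Fin 3 → L2I) × (Fin 3 → L2I)) :=
  (smoothTraceGraph P).topologicalClosure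

/-- Polynomials of degree at most `r` on an edge. -/
def EdgePoly (r : ℕ) : Submodule ℝ L2I where
  carrier := {g | ∃ p : Polynomial ℝ, p.natDegree ≤ r ∧
    g =ᵐ[volume.restrict (Set.Icc (0 : ℝ) 1)] fun t => p.eval t}
  add_mem' := by
    rintro a b ⟨p, hp, h⟩ ⟨q, hq, k⟩
    refine ⟨p + q, (Polynomial.natDegree_add_le p q).trans (max_le hp hq), ?_⟩
    refine (Lp.coeFn_add _ _).trans ((h.add k).trans (ae_of_all _ fun x => ?_))
    simp
  zero_mem' := by
    refine ⟨0, by simp, (Lp.coeFn_zero _ _ _).trans (ae_of_all _ fun x => ?_)⟩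
    simp
  smul_mem' := by
    rintro c a ⟨p, hp, h⟩
    refine ⟨c • p, (Polynomial.natDegree_smul_le c p).trans hp, ?_⟩
    refine (Lp.coeFn_smul _ _).trans ((h.const_smul c).trans (ae_of_all _ fun x => ?_))
    simp

/-- The local space `U_T`: functions `v ∈ H²(T)` with `Δ²v + v = 0` in the sense of distributions,
`v|_{∂T}` edgewise cubic, and `n · ∇v|_{∂T}` edgewise affine. -/
def ULoc (P : Fin 3 → Pt) : Submodule ℝ (H2 (tri P)) where
  carrier := {v |
    (∀ φ : Pt → ℝ, IsTest (tri P) φ →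
      (∫ x in tri P, v.1.1 x * lap (lap φ) x) + ∫ x in tri P, v.1.1 x * φ x = 0) ∧
    ∃ g₀ g₁ : Fin 3 → L2I, (v.1, g₀, g₁) ∈ traceGraph P ∧
      ∀ e, g₀ e ∈ EdgePoly 3 ∧ g₁ e ∈ EdgePoly 1}
  add_mem' := by
    rintro a b ⟨ha, g, g', hg, hp⟩ ⟨hb, k, k', hk, hq⟩
    refine ⟨fun φ hφ => ?_, g + k, g' + k', (traceGraph P).add_mem hg hk, fun e =>
      ⟨(EdgePoly 3).add_mem (hp e).1 (hq e).1, (EdgePoly 1).add_mem (hp e).2 (hq e).2⟩⟩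
    have e1 := integral_add_mul a.1.1 b.1.1 hφ.lap.lap
    have e2 := integral_add_mul a.1.1 b.1.1 hφ
    have e3 := ha φ hφ
    have e4 := hb φ hφ
    change (∫ x in tri P, (a.1.1 + b.1.1 : L2 (tri P)) x * lap (lap φ) x)
      + ∫ x in tri P, (a.1.1 + b.1.1 : L2 (tri P)) x * φ x = 0
    rw [e1, e2]
    linarith
  zero_mem' := by
    refine ⟨fun φ hφ => ?_, 0, 0, (traceGraph P).zero_mem, fun e =>
      ⟨(EdgePoly 3).zero_mem, (EdgePoly 1).zero_mem⟩⟩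
    change (∫ x in tri P, (0 : L2 (tri P)) x * lap (lap φ) x)
      + ∫ x in tri P, (0 : L2 (tri P)) x * φ x = 0
    rw [integral_zero_mul, integral_zero_mul, add_zero]
  smul_mem' := by
    rintro c a ⟨ha, g, g', hg, hp⟩
    refine ⟨fun φ hφ => ?_, c • g, c • g', (traceGraph P).smul_mem c hg, fun e =>
      ⟨(EdgePoly 3).smul_mem c (hp e).1, (EdgePoly 1).smul_mem c (hp e).2⟩⟩
    change (∫ x in tri P, (c • a.1.1 : L2 (tri P)) x * lap (lap φ) x)
      + ∫ x in tri P, (c • a.1.1 : L2 (tri P)) x * φ x = 0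
    rw [integral_smul_mul, integral_smul_mul, ← mul_add, ha φ hφ, mul_zero]

/-- The local trace space `Û_T = tr²_T(U_T)`. -/
def UHatLoc (P : Fin 3 → Pt) : Submodule ℝ (StrongDual ℝ (HdDiv (tri P))) :=
  (ULoc P).map (tr2 (tri P))

/-! ### The discrete spaces -/

section Discrete

variable {Ω : Set Pt} (𝒯 : Triangulation Ω)

/-- `𝒫^p(𝒯)`. -/
def PolyMesh (p : ℕ) : Submodule ℝ (L2 Ω) :=
  ⨅ k, (Poly p (𝒯.cell k)).comap (restr (𝒯.subset k))

/-- `𝒫^p(𝒯)^{2×2} ∩ L²_sym(Ω)`. -/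
def PolyMeshSym (p : ℕ) : Submodule ℝ (L2sym Ω) :=
  ⨅ ij, (PolyMesh 𝒯 p).comap ((entry ij).toLinearMap.comp (L2sym Ω).subtype)

theorem restr_injective {v : L2 Ω} (h : ∀ k, restr (𝒯.subset k) v = 0) : v = 0 := by
  apply Lp.ext
  refine EventuallyEq.trans ?_ (Lp.coeFn_zero _ _ _).symm
  have hcell : ∀ k, ∀ᵐ x ∂(volume.restrict (𝒯.cell k)), v x = 0 := by
    intro k
    have h1 := coeFn_restr (𝒯.subset k) v
    rw [h k] at h1
    filter_upwards [h1, Lp.coeFn_zero ℝ 2 (volume.restrict (𝒯.cell k))] with x hx hx'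
    rw [← hx, hx']
    rfl
  have hclosed : ∀ k, ∀ᵐ x ∂(volume.restrict (closedTri (𝒯.vert k))), v x = 0 := by
    intro k
    have he : (𝒯.cell k : Set Pt) =ᵐ[volume] closedTri (𝒯.vert k) :=
      interior_ae_eq_of_null_frontier
        ((convex_convexHull ℝ (Set.range (𝒯.vert k))).addHaar_frontier volume)
    rw [← Measure.restrict_congr_set he]
    exact hcell k
  have hall : ∀ᵐ x ∂(volume.restrict (⋃ k, closedTri (𝒯.vert k))), v x = 0 :=
    (ae_restrict_iUnion_iff _ _).2 hclosed
  rw [𝒯.cover] at hall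
  exact ae_mono (Measure.restrict_mono subset_closure le_rfl) hall

theorem mem_PolyMesh {p : ℕ} {v : L2 Ω} :
    v ∈ PolyMesh 𝒯 p ↔ ∀ k, restr (𝒯.subset k) v ∈ Poly p (𝒯.cell k) := by
  simp only [PolyMesh, Submodule.mem_iInf, Submodule.mem_comap]

/-- Restriction of piecewise polynomials to a triangle. -/
def restrPoly (p : ℕ) (k : Fin 𝒯.n) : PolyMesh 𝒯 p →ₗ[ℝ] Poly p (𝒯.cell k) :=
  LinearMap.codRestrict (Poly p (𝒯.cell k)) ((restr (𝒯.subset k)).comp (PolyMesh 𝒯 p).subtype)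
    fun v => (mem_PolyMesh 𝒯).1 v.2 k

theorem coe_restrPoly (p : ℕ) (k : Fin 𝒯.n) (v : PolyMesh 𝒯 p) :
    ((restrPoly 𝒯 p k v : Poly p (𝒯.cell k)) : L2 (𝒯.cell k)) = restr (𝒯.subset k) (v : L2 Ω) :=
  LinearMap.codRestrict_apply _ _ _

theorem restrPoly_injective (p : ℕ) (v : PolyMesh 𝒯 p) (h : ∀ k, restrPoly 𝒯 p k v = 0) :
    v = 0 := by
  have h0 : (v : L2 Ω) = 0 := by
    refine restr_injective 𝒯 fun k => ?_
    rw [← coe_restrPoly, h k, Submodule.coe_zero]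
  exact (Submodule.coe_eq_zero).1 h0

instance finiteDimensional_PolyMesh (p : ℕ) : FiniteDimensional ℝ (PolyMesh 𝒯 p) := by
  have hinj : Function.Injective (LinearMap.pi fun k => restrPoly 𝒯 p k) := by
    refine (injective_iff_map_eq_zero _).2 fun v hv => restrPoly_injective 𝒯 p v fun k => ?_
    have h := congrFun hv k
    rw [LinearMap.pi_apply] at h
    exact h
  have hfin : Module.Finite ℝ (∀ k : Fin 𝒯.n, Poly p (𝒯.cell k)) := Module.Finite.pi
  exact Module.Finite.of_injective _ hinj

/-- The `L²(Ω)`-orthogonal projection `Π^p : L²(Ω) → 𝒫^p(𝒯)`. -/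
def projPoly (p : ℕ) : L2 Ω →ₗ[ℝ] L2 Ω := (PolyMesh 𝒯 p).starProjection.toLinearMap

/-- Extension by zero `H(div Div; T) → H(div Div; 𝒯)` for the triangle number `k`. -/
def extend (k : Fin 𝒯.n) : HdDiv (𝒯.cell k) →L[ℝ] QSpace 𝒯 :=
  ((PiLp.continuousLinearEquiv 2 ℝ (fun k : Fin 𝒯.n => HdDiv (𝒯.cell k))).symm :
    (∀ k : Fin 𝒯.n, HdDiv (𝒯.cell k)) →L[ℝ] QSpace 𝒯).comp
    (ContinuousLinearMap.single ℝ (fun k : Fin 𝒯.n => HdDiv (𝒯.cell k)) k)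

/-- `Û_h`: the elements of `Û` whose restriction to each `∂T` belongs to `Û_T`. -/
def UHatDisc : Submodule ℝ (UHat 𝒯) where
  carrier := {û | ∀ k, (û : StrongDual ℝ (QSpace 𝒯)).comp (extend 𝒯 k) ∈ UHatLoc (𝒯.vert k)}
  add_mem' := fun ha hb k => (UHatLoc (𝒯.vert k)).add_mem (ha k) (hb k)
  zero_mem' := fun k => (UHatLoc (𝒯.vert k)).zero_mem
  smul_mem' := fun c _ ha k => (UHatLoc (𝒯.vert k)).smul_mem c (ha k)

/-- The trial space `U_h = 𝒫⁰(𝒯) × (𝒫⁰(𝒯)^{2×2} ∩ L²_sym(Ω)) × Û_h`. -/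
def UDisc : Submodule ℝ (USpace 𝒯) :=
  (PolyMesh 𝒯 0).prod ((PolyMeshSym 𝒯 0).prod (UHatDisc 𝒯))

/-- `Q_h`: the elements of `H(div Div; 𝒯)` that are piecewise polynomial of degree at most `4`
(symmetry is part of the definition of `H(div Div; 𝒯)`). -/
def QDisc : Submodule ℝ (QSpace 𝒯) where
  carrier := {Q | ∀ k ij, entry ij (field (Q k)) ∈ Poly 4 (𝒯.cell k)}
  add_mem' := by
    intro a b ha hb k ij
    rw [PiLp.add_apply, map_add, map_add]
    exact (Poly 4 _).add_mem (ha k ij) (hb k ij)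
  zero_mem' := by
    intro k ij
    rw [PiLp.zero_apply, map_zero, map_zero]
    exact (Poly 4 _).zero_mem
  smul_mem' := by
    intro c a ha k ij
    rw [PiLp.smul_apply, map_smul, map_smul]
    exact (Poly 4 _).smul_mem c (ha k ij)

/-- The discrete test space `V_{hp} = 𝒫^p(𝒯) × Q_h`. -/
def VDisc (p : ℕ) : Submodule ℝ (VSpace 𝒯) :=
  ((PolyMesh 𝒯 p).prod (QDisc 𝒯)).comap (WithLp.linearEquiv 2 ℝ (L2 Ω × QSpace 𝒯)).toLinearMap

/-- The operator `(v, Q) ↦ (Π^p v, Π^{dDiv} Q)`. -/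
def pairOp (p : ℕ) (πd : QSpace 𝒯 →ₗ[ℝ] QSpace 𝒯) : VSpace 𝒯 →ₗ[ℝ] VSpace 𝒯 :=
  (WithLp.linearEquiv 2 ℝ (L2 Ω × QSpace 𝒯)).symm.toLinearMap ∘ₗ
    ((projPoly 𝒯 p).prodMap πd) ∘ₗ (WithLp.linearEquiv 2 ℝ (L2 Ω × QSpace 𝒯)).toLinearMap

/-- The defining properties of the operator `Π^{dDiv} : Q → Q_h`, with bound `C`. -/
structure IsDDivOperator (C : ℝ) (πd : QSpace 𝒯 →ₗ[ℝ] QSpace 𝒯) : Prop where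
  mem : ∀ Q, πd Q ∈ QDisc 𝒯
  trace : ∀ û ∈ UHatDisc 𝒯, ∀ Q, (û : StrongDual ℝ (QSpace 𝒯)) (πd Q) = (û : StrongDual ℝ _) Q
  moment : ∀ M ∈ PolyMeshSym 𝒯 0, ∀ Q, pairField 𝒯 M (πd Q) = pairField 𝒯 M Q
  dDiv : ∀ u ∈ PolyMesh 𝒯 2, ∀ Q, pairDDiv 𝒯 u (πd Q) = pairDDiv 𝒯 u Q
  bound : ∀ Q, ‖πd Q‖ ≤ C * ‖Q‖

/-- `F` is a Fortin operator with constant `C` from `V` to the finite-dimensional subspace `Vh`,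
for the bilinear form `b` with coefficient `A` and the discrete trial space `Uh`. -/
structure IsFortin (A : L2sym Ω) (Uh : Submodule ℝ (USpace 𝒯)) (Vh : Submodule ℝ (VSpace 𝒯))
    (C : ℝ) (F : VSpace 𝒯 →ₗ[ℝ] VSpace 𝒯) : Prop where
  finite : FiniteDimensional ℝ Vh
  mem : ∀ v, F v ∈ Vh
  bound : ∀ v, ‖F v‖ ≤ C * ‖v‖
  fortin : ∀ u ∈ Uh, ∀ v, bForm 𝒯 A u (F v) = bForm 𝒯 A u v

end Discrete

end DPG

end

noncomputable section

namespace DPG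

/-! ### Polynomial functions on the plane -/

/-! All the identities required of `Π^{dDiv}` split into sums over triangles; for the trace
condition this is because `Û_h` is defined through restrictions to the factors `H(div Div; T)`. It
therefore suffices to construct on each triangle `T` a bounded operator into symmetric quartic
fields that preserves three families of functionals: the traces `tr² v` with `v ∈ U_T`, the moments
`(u, div Div ·)` with `u ∈ 𝒫²`, and the moments `(M, ·)` with constant `M`. Its norm may depend only
on `κ` and the diameter of `Ω`.

Green's formula gives the three families a common form. After transport to the reference triangle,
each functional acts on smooth symmetric fields as `∑ₑ ∫ₑ (aₑ n · Div q - cₑ · (n · q)) + ∫ M : q`,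
with `aₑ` cubic, the vector `cₑ` quadratic and `M` constant. This is the space `RefDual`, which is
the same for all triangles. The full gradient is used as boundary datum because an affine map does
not preserve normals: the tangential derivative of an edgewise cubic trace is quadratic and the
normal derivative is affine, so the whole gradient is edgewise quadratic, and that property is
affine invariant. A trace inequality ensures that gradient traces survive the passage from smooth
functions to the closure (`exists_refTrace`).

The heart of the proof is unisolvence (`boundaryData_eq_zero`, `boundaryForm_eq_zero`): a functional
in `RefDual` that vanishes on quartic fields is zero. It is tested with `λₖᵐ λₖ₊₁ⁿ tₖ tₖᵀ`, where
`tₖ` is the vector of edge `k`. These fields are invisible on edge `k`, and the exponents decide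
what is seen on the two other edges. The bubble `m = n = 2` isolates `tₖ · M tₖ`; if one exponent is
`1` and the other is `2` or `3`, a single `aₑ` remains; if one exponent is `0`, a single component
of a `cₑ` remains. By duality in finite dimensions (`exists_fortin_operator`), unisolvence gives an
operator on the reference triangle that preserves `RefDual`.

The norm bound comes from scaling. The transport `Q ↦ S⁻¹ (Q ∘ F) S⁻ᵀ` commutes with `div Div`,
where `S` is the linear part of the affine map `F`. Hence the field on `T` is bounded by `|S|²|S⁻¹|²
‖Q‖ + |S|² ‖div Div Q‖`, up to the norm of the reference operator; the first factor is controlled by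
shape regularity, the second by the diameter. No scaling is needed for `div Div`: since quartic
fields have `div Div` in `𝒫²`, preservation of the `𝒫²` moments makes `div Div Π Q` the `L²`
projection of `div Div Q`.

The Fortin property of `(Π^p, Π^{dDiv})` needs one further remark: `M : A` is piecewise of degree
`p` when `M` is piecewise constant, so it is orthogonal to `v - Π^p v`. -/

/-- `f` is a polynomial function of total degree at most `d`. -/
def IsPoly (d : ℕ) (f : Pt → ℝ) : Prop :=
  ∃ P : MvPolynomial (Fin 2) ℝ, P.totalDegree ≤ d ∧
    ∀ x, f x = MvPolynomial.eval (fun i => x i) P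

theorem IsPoly.mono {d e : ℕ} {f : Pt → ℝ} (h : IsPoly d f) (hde : d ≤ e) : IsPoly e f := by
  obtain ⟨P, hP, h⟩ := h
  exact ⟨P, hP.trans hde, h⟩

theorem isPoly_const (d : ℕ) (c : ℝ) : IsPoly d fun _ => c :=
  ⟨MvPolynomial.C c, by simp, fun x => by simp⟩

theorem isPoly_coord (i : Fin 2) : IsPoly 1 fun x => x i :=
  ⟨MvPolynomial.X i, by simp, fun x => by simp⟩

theorem IsPoly.add {d : ℕ} {f g : Pt → ℝ} (hf : IsPoly d f) (hg : IsPoly d g) :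
    IsPoly d fun x => f x + g x := by
  obtain ⟨P, hP, h⟩ := hf
  obtain ⟨R, hR, k⟩ := hg
  exact ⟨P + R, (MvPolynomial.totalDegree_add P R).trans (max_le hP hR), fun x => by simp [h, k]⟩

theorem IsPoly.mul {d e : ℕ} {f g : Pt → ℝ} (hf : IsPoly d f) (hg : IsPoly e g) :
    IsPoly (d + e) fun x => f x * g x := by
  obtain ⟨P, hP, h⟩ := hf
  obtain ⟨R, hR, k⟩ := hg
  exact ⟨P * R, (MvPolynomial.totalDegree_mul P R).trans (add_le_add hP hR),
    fun x => by simp [h, k]⟩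

theorem IsPoly.const_mul {d : ℕ} {f : Pt → ℝ} (c : ℝ) (hf : IsPoly d f) :
    IsPoly d fun x => c * f x := by
  simpa using (isPoly_const 0 c).mul hf

theorem IsPoly.pow {d : ℕ} {f : Pt → ℝ} (hf : IsPoly d f) (n : ℕ) :
    IsPoly (d * n) fun x => f x ^ n := by
  induction n with
  | zero => simpa using isPoly_const 0 1
  | succ n ih => simpa only [pow_succ, Nat.mul_succ] using ih.mul hf

theorem IsPoly.sum {ι : Type*} {d : ℕ} (s : Finset ι) {f : ι → Pt → ℝ}
    (hf : ∀ i ∈ s, IsPoly d (f i)) : IsPoly d fun x => ∑ i ∈ s, f i x := by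
  classical
  induction s using Finset.induction_on with
  | empty => simpa using isPoly_const d 0
  | insert a s ha ih =>
    simp only [Finset.sum_insert ha]
    exact (hf a (by simp)).add (ih fun i hi => hf i (by simp [hi]))

/-- On this explicit expansion the degree can be followed through differentiation, affine
substitution and restriction to an edge. -/
theorem IsPoly.exists_eq_sum {d : ℕ} {f : Pt → ℝ} (hf : IsPoly d f) :
    ∃ (s : Finset (Fin 2 →₀ ℕ)) (c : (Fin 2 →₀ ℕ) → ℝ), (∀ m ∈ s, m 0 + m 1 ≤ d) ∧
      ∀ x, f x = ∑ m ∈ s, c m * (x 0 ^ m 0 * x 1 ^ m 1) := by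
  obtain ⟨P, hP, h⟩ := hf
  refine ⟨P.support, fun m => P.coeff m, fun m hm => ?_, fun x => ?_⟩
  · have := (MvPolynomial.le_totalDegree hm).trans hP
    rwa [Finsupp.sum_fintype _ _ (fun _ => rfl), Fin.sum_univ_two] at this
  · rw [h, MvPolynomial.eval_eq']
    simp [Fin.prod_univ_two]

theorem IsPoly.contDiff {d : ℕ} {f : Pt → ℝ} (hf : IsPoly d f) : ContDiff ℝ ∞ f := by
  obtain ⟨s, c, -, h⟩ := hf.exists_eq_sum
  rw [funext h]
  fun_prop

theorem pd_eq_of_hasFDerivAt {i : Fin 2} {f : Pt → ℝ} {x : Pt} {L : Pt →L[ℝ] ℝ}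
    (h : HasFDerivAt f L x) : pd i f x = L (EuclideanSpace.single i 1) := by
  rw [pd, h.fderiv]

theorem pd_mul {f g : Pt → ℝ} (hf : ContDiff ℝ ∞ f) (hg : ContDiff ℝ ∞ g) (i : Fin 2) (x : Pt) :
    pd i (fun y => f y * g y) x = pd i f x * g x + f x * pd i g x := by
  have h := ((hf.differentiable (by simp) x).hasFDerivAt).mul
    ((hg.differentiable (by simp) x).hasFDerivAt)
  refine (pd_eq_of_hasFDerivAt h).trans ?_
  simp [pd]
  ring

theorem pd_const (c : ℝ) (i : Fin 2) (x : Pt) : pd i (fun _ => c) x = 0 := by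
  simp [pd]

theorem pd_const_mul {f : Pt → ℝ} (c : ℝ) (i : Fin 2) (x : Pt) :
    pd i (fun y => c * f y) x = c * pd i f x :=
  congrFun (pd_smul (f := f) c i) x

theorem pd_fun_add {f g : Pt → ℝ} (hf : ContDiff ℝ ∞ f) (hg : ContDiff ℝ ∞ g) (i : Fin 2) (x : Pt) :
    pd i (fun y => f y + g y) x = pd i f x + pd i g x :=
  congrFun (pd_add hf hg i) x

theorem pd_coord (i j : Fin 2) (x : Pt) : pd i (fun y => y j) x = if j = i then 1 else 0 := by
  have h : HasFDerivAt (fun y : Pt => y j) (EuclideanSpace.proj j : Pt →L[ℝ] ℝ) x :=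
    (EuclideanSpace.proj j : Pt →L[ℝ] ℝ).hasFDerivAt
  rw [pd_eq_of_hasFDerivAt h]
  simp

theorem pd_pow {f : Pt → ℝ} (hf : ContDiff ℝ ∞ f) (i : Fin 2) (n : ℕ) (x : Pt) :
    pd i (fun y => f y ^ n) x = n * f x ^ (n - 1) * pd i f x := by
  have h := ((hf.differentiable (by simp) x).hasFDerivAt).pow n
  rw [pd_eq_of_hasFDerivAt h]
  simp [pd]

theorem pd_sum {ι : Type*} (s : Finset ι) {f : ι → Pt → ℝ} (hf : ∀ k, ContDiff ℝ ∞ (f k))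
    (i : Fin 2) (x : Pt) : pd i (fun y => ∑ k ∈ s, f k y) x = ∑ k ∈ s, pd i (f k) x := by
  have h := HasFDerivAt.fun_sum (u := s)
    fun k _ => ((hf k).differentiable (by simp) x).hasFDerivAt
  rw [pd_eq_of_hasFDerivAt h]
  simp [pd]

theorem IsPoly.pd {d : ℕ} {f : Pt → ℝ} (hf : IsPoly (d + 1) f) (i : Fin 2) :
    IsPoly d (pd i f) := by
  obtain ⟨s, c, hs, h⟩ := hf.exists_eq_sum
  have key : DPG.pd i f = fun x => ∑ m ∈ s, c m *
      ((m 0 * x 0 ^ (m 0 - 1) * (if 0 = i then 1 else 0)) * x 1 ^ m 1 +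
        x 0 ^ m 0 * (m 1 * x 1 ^ (m 1 - 1) * (if 1 = i then 1 else 0))) := by
    rw [funext h]
    funext x
    rw [pd_sum _ (fun k => by fun_prop)]
    refine Finset.sum_congr rfl fun m _ => ?_
    rw [pd_const_mul, pd_mul (by fun_prop) (by fun_prop), pd_pow (by fun_prop),
      pd_pow (by fun_prop), pd_coord, pd_coord]
  rw [key]
  refine IsPoly.sum s fun m hm => IsPoly.const_mul _ ?_
  have hm := hs m hm
  have hp : ∀ (j : Fin 2) (n : ℕ), IsPoly n fun x => x j ^ n := fun j n => by
    simpa using (isPoly_coord j).pow n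
  fin_cases i
  · simp only [Fin.zero_eta, Fin.isValue, if_true, mul_one, one_ne_zero, if_false, mul_zero,
      add_zero]
    -- For exponent zero the truncated `m 0 - 1` would spoil the degree count, but then the
    -- coefficient `m 0` kills the term.
    rcases Nat.eq_zero_or_pos (m 0) with h0 | h0
    · simpa [h0] using isPoly_const d 0
    · exact (((hp 0 _).const_mul _).mul (hp 1 _)).mono (by omega)
  · simp only [Fin.mk_one, Fin.isValue, if_true, mul_one, zero_ne_one, if_false, mul_zero,
      zero_mul, zero_add]
    rcases Nat.eq_zero_or_pos (m 1) with h0 | h0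
    · simpa [h0] using isPoly_const d 0
    · exact ((hp 0 _).mul ((hp 1 _).const_mul _)).mono (by omega)

/-! ### Affine changes of variables -/

/-- The affine map `x ↦ b + S x`. -/
def aff (S : Matrix (Fin 2) (Fin 2) ℝ) (b x : Pt) : Pt := b + S.toEuclideanLin x

theorem aff_apply (S : Matrix (Fin 2) (Fin 2) ℝ) (b x : Pt) (i : Fin 2) :
    aff S b x i = b i + ∑ j, S i j * x j := by
  fin_cases i <;> simp [aff, Matrix.toLpLin_apply]

theorem contDiff_aff (S : Matrix (Fin 2) (Fin 2) ℝ) (b : Pt) : ContDiff ℝ ∞ (aff S b) := by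
  rw [contDiff_euclidean]
  intro i
  simp only [aff_apply]
  fun_prop

theorem IsPoly.comp_aff {d : ℕ} {f : Pt → ℝ} (hf : IsPoly d f) (S : Matrix (Fin 2) (Fin 2) ℝ)
    (b : Pt) : IsPoly d fun x => f (aff S b x) := by
  obtain ⟨s, c, hs, h⟩ := hf.exists_eq_sum
  simp only [h]
  refine IsPoly.sum s fun m hm => IsPoly.const_mul _ ?_
  have hp : ∀ (j : Fin 2) (n : ℕ), IsPoly n fun x => aff S b x j ^ n := fun j n => by
    have h1 : IsPoly 1 fun x => aff S b x j := by
      simp only [aff_apply]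
      exact (isPoly_const 1 _).add (IsPoly.sum _ fun k _ => (isPoly_coord k).const_mul _)
    simpa using h1.pow n
  exact ((hp 0 _).mul (hp 1 _)).mono (hs m hm)

theorem pd_comp_aff {f : Pt → ℝ} (hf : ContDiff ℝ ∞ f) (S : Matrix (Fin 2) (Fin 2) ℝ) (b : Pt)
    (i : Fin 2) (x : Pt) :
    pd i (fun y => f (aff S b y)) x = ∑ j, S j i * pd j f (aff S b x) := by
  have h1 : HasFDerivAt (aff S b) (LinearMap.toContinuousLinearMap S.toEuclideanLin) x :=
    ((LinearMap.toContinuousLinearMap S.toEuclideanLin).hasFDerivAt (x := x)).const_add b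
  have h := ((hf.differentiable (by simp) (aff S b x)).hasFDerivAt).comp x h1
  have e : S.toEuclideanLin (EuclideanSpace.single i 1)
      = ∑ j, S j i • EuclideanSpace.single j (1 : ℝ) := by
    ext k
    fin_cases k <;> simp [Matrix.toLpLin_apply, Fin.sum_univ_two]
  have h2 := pd_eq_of_hasFDerivAt (i := i) h
  rw [ContinuousLinearMap.comp_apply, LinearMap.coe_toContinuousLinearMap', e, map_sum] at h2
  simpa [pd, Function.comp_def] using h2

/-- An invertible affine map that carries the set `G` onto the set `G'`. -/
structure AffEquiv (G G' : Set Pt) where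
  S : Matrix (Fin 2) (Fin 2) ℝ
  S' : Matrix (Fin 2) (Fin 2) ℝ
  b : Pt
  mul_inv : S * S' = 1
  meas : MeasurableSet G
  meas' : MeasurableSet G'
  mem_iff : ∀ x, aff S b x ∈ G' ↔ x ∈ G

namespace AffEquiv

variable {G G' : Set Pt} (a : AffEquiv G G')

theorem inv_mul : a.S' * a.S = 1 := mul_eq_one_comm.1 a.mul_inv

/-- The underlying map. -/
def map : Pt → Pt := aff a.S a.b

theorem contDiff_map : ContDiff ℝ ∞ a.map := contDiff_aff _ _

/-- The inverse. -/
def symm : AffEquiv G' G where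
  S := a.S'
  S' := a.S
  b := -a.S'.toEuclideanLin a.b
  mul_inv := a.inv_mul
  meas := a.meas'
  meas' := a.meas
  mem_iff x := by
    rw [← a.mem_iff]
    have : aff a.S a.b (aff a.S' (-a.S'.toEuclideanLin a.b) x) = x := by
      have h := congrArg (fun M : Matrix (Fin 2) (Fin 2) ℝ => M.toEuclideanLin) a.mul_inv
      simp only [Matrix.toLpLin_mul_same, Matrix.toLpLin_one] at h
      have h1 : ∀ y, a.S.toEuclideanLin (a.S'.toEuclideanLin y) = y := fun y =>
        LinearMap.congr_fun h y
      simp only [aff, map_add, map_neg, h1]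
      abel
    rw [this]

theorem map_symm (x : Pt) : a.map (a.symm.map x) = x := by
  have h := congrArg (fun M : Matrix (Fin 2) (Fin 2) ℝ => M.toEuclideanLin) a.mul_inv
  simp only [Matrix.toLpLin_mul_same, Matrix.toLpLin_one] at h
  have h1 : ∀ y, a.S.toEuclideanLin (a.S'.toEuclideanLin y) = y := fun y =>
    LinearMap.congr_fun h y
  simp only [map, symm, aff, map_add, map_neg, h1]
  abel

theorem symm_map (x : Pt) : a.symm.map (a.map x) = x := by
  have h := congrArg (fun M : Matrix (Fin 2) (Fin 2) ℝ => M.toEuclideanLin) a.inv_mul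
  simp only [Matrix.toLpLin_mul_same, Matrix.toLpLin_one] at h
  have h1 : ∀ y, a.S'.toEuclideanLin (a.S.toEuclideanLin y) = y := fun y =>
    LinearMap.congr_fun h y
  simp only [map, symm, aff, map_add, h1]
  abel

/-- The volume scaling factor `|det S|⁻¹`. -/
def jac : ℝ := |a.S'.det|

theorem jac_mul_jac_symm : a.jac * a.symm.jac = 1 := by
  change |a.S'.det| * |a.S.det| = 1
  rw [← abs_mul, ← Matrix.det_mul, a.inv_mul, Matrix.det_one, abs_one]

theorem jac_pos : 0 < a.jac := by
  rcases (abs_nonneg a.S'.det).eq_or_lt with h | h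
  · have := a.jac_mul_jac_symm
    rw [jac, ← h, zero_mul] at this
    exact absurd this (by norm_num)
  · exact h

theorem measurableEmbedding : MeasurableEmbedding a.map := by
  refine (a.contDiff_map.continuous.measurableEmbedding ?_)
  exact Function.LeftInverse.injective a.symm_map

theorem map_volume : (volume.restrict G).map a.map = ENNReal.ofReal a.jac • volume.restrict G' := by
  have hd : LinearMap.det a.S.toEuclideanLin = a.S.det := LinearMap.det_toLpLin _ _
  have hdd : a.S.det * a.S'.det = 1 := by rw [← Matrix.det_mul, a.mul_inv, Matrix.det_one]
  have hne : a.S.det ≠ 0 := left_ne_zero_of_mul_eq_one hdd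
  have hv : Measure.map a.map volume = ENNReal.ofReal a.jac • volume := by
    have h1 := Measure.map_linearMap_addHaar_eq_smul_addHaar (volume : Measure Pt)
      (f := a.S.toEuclideanLin) (by rwa [hd])
    have h2 : a.map = (fun x => a.b + x) ∘ a.S.toEuclideanLin := rfl
    rw [h2, ← Measure.map_map (by fun_prop)
      (LinearMap.continuous_of_finiteDimensional _).measurable, h1, Measure.map_smul,
      (measurePreserving_add_left volume a.b).map_eq, hd]
    congr 2
    rw [jac]
    congr 1
    exact inv_eq_of_mul_eq_one_right hdd
  have hG : a.map ⁻¹' G' = G := Set.ext a.mem_iff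
  have h3 : (volume.restrict G).map a.map = (volume.restrict (a.map ⁻¹' G')).map a.map := by
    rw [hG]
  rw [h3, ← Measure.restrict_map a.measurableEmbedding.measurable a.meas', hv,
    Measure.restrict_smul]

theorem quasiMeasurePreserving :
    Measure.QuasiMeasurePreserving a.map (volume.restrict G) (volume.restrict G') := by
  refine ⟨a.measurableEmbedding.measurable, ?_⟩
  rw [a.map_volume]
  exact Measure.smul_absolutelyContinuous

theorem integral_comp {F : Type*} [NormedAddCommGroup F] [NormedSpace ℝ F] (f : Pt → F) :
    ∫ x in G, f (a.map x) = a.jac • ∫ x in G', f x := by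
  rw [← a.measurableEmbedding.integral_map, a.map_volume, integral_smul_measure,
    ENNReal.toReal_ofReal a.jac_pos.le]

theorem memLp_comp {F : Type} [NormedAddCommGroup F] (u : Lp F 2 (volume.restrict G')) :
    MemLp (fun x => u (a.map x)) 2 (volume.restrict G) := by
  refine MemLp.comp_of_map ?_ a.measurableEmbedding.measurable.aemeasurable
  rw [a.map_volume]
  exact (Lp.memLp u).smul_measure ENNReal.ofReal_ne_top

section Comp

variable {F : Type} [NormedAddCommGroup F] [InnerProductSpace ℝ F]

/-- Composition of square-integrable functions with the affine map, as a linear map. -/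
def compₗ : Lp F 2 (volume.restrict G') →ₗ[ℝ] Lp F 2 (volume.restrict G) where
  toFun u := (a.memLp_comp u).toLp _
  map_add' u v := by
    apply Lp.ext
    refine (MemLp.coeFn_toLp _).trans ?_
    refine EventuallyEq.trans ?_ (Lp.coeFn_add _ _).symm
    filter_upwards [(a.memLp_comp u).coeFn_toLp, (a.memLp_comp v).coeFn_toLp,
      a.quasiMeasurePreserving.ae (Lp.coeFn_add u v)] with x h1 h2 h3
    rw [h3, Pi.add_apply, Pi.add_apply, h1, h2]
  map_smul' c u := by
    apply Lp.ext
    refine (MemLp.coeFn_toLp _).trans ?_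
    refine EventuallyEq.trans ?_ (Lp.coeFn_smul _ _).symm
    filter_upwards [(a.memLp_comp u).coeFn_toLp,
      a.quasiMeasurePreserving.ae (Lp.coeFn_smul c u)] with x h1 h2
    rw [h2, Pi.smul_apply, Pi.smul_apply, h1, RingHom.id_apply]

theorem coeFn_compₗ (u : Lp F 2 (volume.restrict G')) :
    a.compₗ u =ᵐ[volume.restrict G] fun x => u (a.map x) :=
  (a.memLp_comp u).coeFn_toLp

theorem inner_compₗ (u v : Lp F 2 (volume.restrict G')) :
    ⟪a.compₗ u, a.compₗ v⟫ = a.jac * ⟪u, v⟫ := by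
  rw [L2.inner_def, L2.inner_def, ← smul_eq_mul, ← a.integral_comp fun x => ⟪u x, v x⟫]
  refine integral_congr_ae ?_
  filter_upwards [a.coeFn_compₗ u, a.coeFn_compₗ v] with x h1 h2
  rw [h1, h2]

theorem norm_compₗ (u : Lp F 2 (volume.restrict G')) : ‖a.compₗ u‖ = √a.jac * ‖u‖ := by
  rw [@norm_eq_sqrt_real_inner _ _ _ (a.compₗ u), inner_compₗ, Real.sqrt_mul a.jac_pos.le,
    ← norm_eq_sqrt_real_inner]

/-- Composition of square-integrable functions with the affine map. -/
def comp : Lp F 2 (volume.restrict G') →L[ℝ] Lp F 2 (volume.restrict G) :=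
  a.compₗ.mkContinuous (√a.jac) fun u => (a.norm_compₗ u).le

theorem coeFn_comp (u : Lp F 2 (volume.restrict G')) :
    a.comp u =ᵐ[volume.restrict G] fun x => u (a.map x) :=
  (a.memLp_comp u).coeFn_toLp

theorem norm_comp (u : Lp F 2 (volume.restrict G')) : ‖a.comp u‖ = √a.jac * ‖u‖ := a.norm_compₗ u

theorem comp_symm_comp (u : Lp F 2 (volume.restrict G)) : a.comp (a.symm.comp u) = u := by
  apply Lp.ext
  refine (a.coeFn_comp _).trans ?_
  filter_upwards [a.quasiMeasurePreserving.ae (a.symm.coeFn_comp u)] with x hx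
  rw [hx, a.symm_map]

theorem symm_comp_comp (u : Lp F 2 (volume.restrict G')) : a.symm.comp (a.comp u) = u := by
  apply Lp.ext
  refine (a.symm.coeFn_comp _).trans ?_
  filter_upwards [a.symm.quasiMeasurePreserving.ae (a.coeFn_comp u)] with x hx
  rw [hx, a.map_symm]

theorem inner_comp (u v : Lp F 2 (volume.restrict G')) :
    ⟪a.comp u, a.comp v⟫ = a.jac * ⟪u, v⟫ := a.inner_compₗ u v

/-- Change of variables moves the composition to the other factor. This is how functionals on a
triangle become functionals on the reference triangle. -/
theorem inner_symm_comp (u : Lp F 2 (volume.restrict G')) (v : Lp F 2 (volume.restrict G)) :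
    ⟪u, a.symm.comp v⟫ = a.symm.jac * ⟪a.comp u, v⟫ := by
  conv_rhs => rw [← a.comp_symm_comp v, inner_comp, ← mul_assoc, mul_comm a.symm.jac,
    a.jac_mul_jac_symm, one_mul]

theorem comp_ae_eq {u : Lp F 2 (volume.restrict G')} {f : Pt → F}
    (h : u =ᵐ[volume.restrict G'] f) : a.comp u =ᵐ[volume.restrict G] fun x => f (a.map x) := by
  refine (a.coeFn_comp u).trans ?_
  filter_upwards [a.quasiMeasurePreserving.ae h] with x hx
  exact hx

end Comp

end AffEquiv

/-! ### The reference triangle -/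

/-- The vertices of the reference triangle. -/
def refVert : Fin 3 → Pt := ![!₂[0, 0], !₂[1, 0], !₂[0, 1]]

/-- The open reference triangle. -/
abbrev refTri : Set Pt := tri refVert

/-- Outer normals of the reference triangle, as long as the edges. -/
def refNormal : Fin 3 → Fin 2 → ℝ := ![![0, -1], ![1, 1], ![-1, 0]]

/-- The closed reference triangle. -/
def refClosed : Set Pt := {x | 0 ≤ x 0 ∧ 0 ≤ x 1 ∧ x 0 + x 1 ≤ 1}

theorem closedTri_refVert : closedTri refVert = refClosed := by
  apply Set.Subset.antisymm
  · refine convexHull_min ?_ ?_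
    · rintro _ ⟨i, rfl⟩
      fin_cases i <;> simp [refVert, refClosed]
    · intro x hx y hy a b ha hb hab
      obtain ⟨h1, h2, h3⟩ := hx
      obtain ⟨k1, k2, k3⟩ := hy
      refine ⟨?_, ?_, ?_⟩
      · simpa using add_nonneg (mul_nonneg ha h1) (mul_nonneg hb k1)
      · simpa using add_nonneg (mul_nonneg ha h2) (mul_nonneg hb k2)
      · simp only [PiLp.add_apply, PiLp.smul_apply, smul_eq_mul]
        nlinarith
  · intro x hx
    obtain ⟨h1, h2, h3⟩ := hx
    have hc : Convex ℝ (closedTri refVert) := convex_convexHull ℝ _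
    have hm : ∀ i, refVert i ∈ closedTri refVert := fun i => subset_convexHull ℝ _ ⟨i, rfl⟩
    have h := hc.sum_mem (t := Finset.univ) (w := ![1 - x 0 - x 1, x 0, x 1]) (z := refVert)
      (fun i _ => by
        fin_cases i
        · simp; linarith
        · simpa using h1
        · simpa using h2) (by simp [Fin.sum_univ_three]; ring) (fun i _ => hm i)
    convert h using 1
    ext i
    fin_cases i <;> simp [Fin.sum_univ_three, refVert]

theorem restrict_tri (P : Fin 3 → Pt) :
    (volume.restrict (tri P) : Measure Pt) = volume.restrict (closedTri P) :=
  Measure.restrict_congr_set (interior_ae_eq_of_null_frontier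
    ((convex_convexHull ℝ (Set.range P)).addHaar_frontier volume))

theorem isCompact_closedTri (P : Fin 3 → Pt) : IsCompact (closedTri P) :=
  (Set.finite_range P).isCompact_convexHull (𝕜 := ℝ)

theorem measurableSet_tri (P : Fin 3 → Pt) : MeasurableSet (tri P) := isOpen_interior.measurableSet

theorem integrable_tri {F : Type*} [NormedAddCommGroup F] (P : Fin 3 → Pt) {f : Pt → F}
    (hf : Continuous f) : Integrable f (volume.restrict (tri P)) := by
  rw [restrict_tri]
  exact hf.continuousOn.integrableOn_compact (isCompact_closedTri P)

/-- The point of the plane with given coordinates. -/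
def mkPt (x y : ℝ) : Pt := !₂[x, y]

theorem continuous_mkPt : Continuous fun z : ℝ × ℝ => mkPt z.1 z.2 := by
  unfold mkPt
  refine (PiLp.continuous_toLp 2 _).comp (continuous_pi fun i => ?_)
  fin_cases i
  · exact continuous_fst
  · exact continuous_snd

theorem measurePreserving_mkPt : MeasurePreserving (fun z : ℝ × ℝ => mkPt z.1 z.2) := by
  have h := (PiLp.volume_preserving_toLp (Fin 2)).comp (volume_preserving_finTwoArrow ℝ).symm
  have e : (fun z : ℝ × ℝ => mkPt z.1 z.2)
      = WithLp.toLp 2 ∘ (MeasurableEquiv.finTwoArrow (α := ℝ)).symm := by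
    funext z
    ext i
    fin_cases i <;> rfl
  rw [e]
  exact h

theorem measurableEmbedding_mkPt : MeasurableEmbedding fun z : ℝ × ℝ => mkPt z.1 z.2 := by
  refine continuous_mkPt.measurableEmbedding fun z w h => ?_
  have h0 := congrArg (fun p : Pt => p 0) h
  have h1 := congrArg (fun p : Pt => p 1) h
  exact Prod.ext h0 h1

/-- The reference triangle as a subset of `ℝ × ℝ`. -/
def refProd : Set (ℝ × ℝ) := {z | 0 ≤ z.1 ∧ 0 ≤ z.2 ∧ z.1 + z.2 ≤ 1}

theorem isCompact_refProd : IsCompact refProd := by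
  refine Metric.isCompact_of_isClosed_isBounded ?_ ?_
  · exact (isClosed_le continuous_const continuous_fst).inter
      ((isClosed_le continuous_const continuous_snd).inter
        (isClosed_le (continuous_fst.add continuous_snd) continuous_const))
  · refine (Metric.isBounded_Icc (0 : ℝ × ℝ) 1).subset fun z hz => ?_
    obtain ⟨h1, h2, h3⟩ := hz
    exact ⟨⟨h1, h2⟩, ⟨by change z.1 ≤ 1; linarith, by change z.2 ≤ 1; linarith⟩⟩

/-! ### Fubini, the fundamental theorem of calculus and the divergence theorem on the reference
triangle -/

theorem integral_refProd {g : ℝ × ℝ → ℝ} (hg : Continuous g) :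
    ∫ z in refProd, g z = ∫ x in Set.Icc (0 : ℝ) 1, ∫ y in (0 : ℝ)..(1 - x), g (x, y) := by
  have hm : MeasurableSet refProd := isCompact_refProd.isClosed.measurableSet
  have hi : Integrable (refProd.indicator g) (volume.prod volume) :=
    (integrable_indicator_iff hm).2 (hg.continuousOn.integrableOn_compact isCompact_refProd)
  rw [← integral_indicator hm, Measure.volume_eq_prod, integral_prod _ hi,
    ← integral_indicator measurableSet_Icc]
  congr 1
  funext x
  by_cases hx : x ∈ Set.Icc (0 : ℝ) 1
  · rw [Set.indicator_of_mem hx, intervalIntegral.integral_of_le (by linarith [hx.2]),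
      ← integral_Icc_eq_integral_Ioc, ← integral_indicator measurableSet_Icc]
    congr 1
    funext y
    by_cases hy : y ∈ Set.Icc (0 : ℝ) (1 - x)
    · rw [Set.indicator_of_mem hy, Set.indicator_of_mem]
      exact ⟨hx.1, hy.1, by simp only; linarith [hy.2]⟩
    · rw [Set.indicator_of_notMem hy, Set.indicator_of_notMem]
      exact fun h => hy ⟨h.2.1, by have := h.2.2; simp only at this; linarith⟩
  · rw [Set.indicator_of_notMem hx]
    refine integral_eq_zero_of_ae (ae_of_all _ fun y => Set.indicator_of_notMem (fun h => hx ?_) _)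
    exact ⟨h.1, by have h1 := h.2.1; have h2 := h.2.2; simp only at h1 h2; linarith⟩

theorem integral_refProd_swap (g : ℝ × ℝ → ℝ) :
    ∫ z in refProd, g z = ∫ z in refProd, g z.swap := by
  have h := (Measure.measurePreserving_swap (μ := (volume : Measure ℝ))
    (ν := (volume : Measure ℝ))).setIntegral_preimage_emb
      MeasurableEquiv.prodComm.measurableEmbedding g refProd
  have e : (Prod.swap ⁻¹' refProd : Set (ℝ × ℝ)) = refProd := by
    ext z
    simp only [refProd, Set.mem_preimage, Set.mem_ofPred_eq, Prod.fst_swap, Prod.snd_swap]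
    constructor <;> rintro ⟨h1, h2, h3⟩ <;> exact ⟨h2, h1, by linarith⟩
  rw [e] at h
  exact h.symm

theorem integral_refTri (f : Pt → ℝ) :
    ∫ x in refTri, f x = ∫ z in refProd, f (mkPt z.1 z.2) := by
  have h := measurePreserving_mkPt.setIntegral_preimage_emb measurableEmbedding_mkPt f refClosed
  rw [restrict_tri, closedTri_refVert, ← h]
  rfl

/-- The value of `∫_T div f` by the fundamental theorem of calculus. -/
theorem integral_pd_zero {f : Pt → ℝ} (hf : ContDiff ℝ ∞ f) :
    ∫ x in refTri, pd 0 f x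
      = ∫ t in Set.Icc (0 : ℝ) 1, (f (mkPt (1 - t) t) - f (mkPt 0 t)) := by
  have hc := (contDiff_pd hf 0).continuous
  -- The coordinates are swapped so that the inner integral runs in the direction of the derivative.
  rw [integral_refTri, integral_refProd_swap, integral_refProd (by
    exact (hc.comp continuous_mkPt).comp continuous_swap)]
  congr 1
  funext t
  have hd : ∀ x, HasDerivAt (fun s : ℝ => f (mkPt s t)) (pd 0 f (mkPt x t)) x := by
    intro x
    have h1 : HasDerivAt (fun s : ℝ => mkPt s t) (EuclideanSpace.single 0 1) x := by
      have e : (fun s : ℝ => mkPt s t) = fun s => mkPt 0 t + s • EuclideanSpace.single 0 1 := by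
        funext s
        ext i
        fin_cases i <;> simp [mkPt]
      rw [e]
      simpa using ((hasDerivAt_id' x).smul_const (EuclideanSpace.single (0 : Fin 2) (1 : ℝ))).const_add
        (mkPt 0 t)
    exact (hf.differentiable (by simp) _).hasFDerivAt.comp_hasDerivAt x h1
  exact intervalIntegral.integral_eq_sub_of_hasDerivAt (fun x _ => hd x)
    ((hc.comp (continuous_mkPt.comp (by fun_prop : Continuous fun s : ℝ => (s, t))))
      |>.intervalIntegrable _ _)

theorem integral_pd_one {f : Pt → ℝ} (hf : ContDiff ℝ ∞ f) :
    ∫ x in refTri, pd 1 f x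
      = ∫ t in Set.Icc (0 : ℝ) 1, (f (mkPt t (1 - t)) - f (mkPt t 0)) := by
  have hc := (contDiff_pd hf 1).continuous
  rw [integral_refTri, integral_refProd (by exact hc.comp continuous_mkPt)]
  congr 1
  funext t
  have hd : ∀ x, HasDerivAt (fun s : ℝ => f (mkPt t s)) (pd 1 f (mkPt t x)) x := by
    intro x
    have h1 : HasDerivAt (fun s : ℝ => mkPt t s) (EuclideanSpace.single 1 1) x := by
      have e : (fun s : ℝ => mkPt t s) = fun s => mkPt t 0 + s • EuclideanSpace.single 1 1 := by
        funext s
        ext i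
        fin_cases i <;> simp [mkPt]
      rw [e]
      simpa using ((hasDerivAt_id' x).smul_const (EuclideanSpace.single (1 : Fin 2) (1 : ℝ))).const_add
        (mkPt t 0)
    exact (hf.differentiable (by simp) _).hasFDerivAt.comp_hasDerivAt x h1
  exact intervalIntegral.integral_eq_sub_of_hasDerivAt (fun x _ => hd x)
    ((hc.comp (continuous_mkPt.comp (by fun_prop : Continuous fun s : ℝ => (t, s))))
      |>.intervalIntegrable _ _)

theorem setIntegral_Icc_reflect (g : ℝ → ℝ) :
    ∫ t in Set.Icc (0 : ℝ) 1, g (1 - t) = ∫ t in Set.Icc (0 : ℝ) 1, g t := by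
  rw [integral_Icc_eq_integral_Ioc, integral_Icc_eq_integral_Ioc,
    ← intervalIntegral.integral_of_le zero_le_one, ← intervalIntegral.integral_of_le zero_le_one]
  simp

theorem edgePt_refVert_zero (t : ℝ) : edgePt refVert 0 t = mkPt t 0 := by
  ext i
  fin_cases i <;> simp [edgePt, refVert, mkPt]

theorem edgePt_refVert_one (t : ℝ) : edgePt refVert 1 t = mkPt (1 - t) t := by
  ext i
  fin_cases i <;> simp [edgePt, refVert, mkPt]
  ring

theorem edgePt_refVert_two (t : ℝ) : edgePt refVert 2 t = mkPt 0 (1 - t) := by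
  ext i
  fin_cases i <;> simp [edgePt, refVert, mkPt]
  ring

theorem contDiff_edgePt (P : Fin 3 → Pt) (e : Fin 3) : ContDiff ℝ ∞ (edgePt P e) := by
  unfold edgePt
  fun_prop

theorem integrable_Icc {g : ℝ → ℝ} (hg : Continuous g) :
    Integrable g (volume.restrict (Set.Icc (0 : ℝ) 1)) :=
  hg.continuousOn.integrableOn_compact isCompact_Icc

/-- The divergence theorem on the reference triangle. -/
theorem integral_div_refTri {f : Fin 2 → Pt → ℝ} (hf : ∀ i, ContDiff ℝ ∞ (f i)) :
    ∫ x in refTri, ∑ i, pd i (f i) x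
      = ∑ e, ∫ t in Set.Icc (0 : ℝ) 1, ∑ i, refNormal e i * f i (edgePt refVert e t) := by
  have hc : ∀ i e, Continuous fun t => f i (edgePt refVert e t) := fun i e =>
    (hf i).continuous.comp (contDiff_edgePt _ e).continuous
  have hi : ∀ i e, Integrable (fun t => f i (edgePt refVert e t))
    (volume.restrict (Set.Icc (0 : ℝ) 1)) := fun i e => integrable_Icc (hc i e)
  have h00 := hi 0 1
  have h02 := hi 0 2
  have h10 := hi 1 0
  have h11 := hi 1 1
  have r02 := setIntegral_Icc_reflect fun t => f 0 (mkPt 0 t)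
  have r11 := setIntegral_Icc_reflect fun t => f 1 (mkPt t (1 - t))
  simp only [sub_sub_cancel] at r11
  have c02 : Continuous fun t => f 0 (mkPt 0 t) :=
    (hf 0).continuous.comp (continuous_mkPt.comp (by fun_prop : Continuous fun s : ℝ => ((0 : ℝ), s)))
  have c11 : Continuous fun t => f 1 (mkPt t (1 - t)) :=
    (hf 1).continuous.comp (continuous_mkPt.comp (by fun_prop : Continuous fun s : ℝ => (s, 1 - s)))
  simp only [edgePt_refVert_zero, edgePt_refVert_one, edgePt_refVert_two] at h00 h02 h10 h11
  simp only [Fin.sum_univ_two, Fin.sum_univ_three]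
  rw [integral_add (integrable_tri _ (contDiff_pd (hf 0) 0).continuous)
    (integrable_tri _ (contDiff_pd (hf 1) 1).continuous), integral_pd_zero (hf 0),
    integral_pd_one (hf 1), integral_sub h00 (integrable_Icc c02),
    integral_sub (integrable_Icc c11) h10]
  simp only [edgePt_refVert_zero, edgePt_refVert_one, edgePt_refVert_two, refNormal,
    Matrix.cons_val_zero, Matrix.cons_val_one, Matrix.cons_val, zero_mul, one_mul, neg_mul,
    zero_add, add_zero]
  rw [integral_add h00 h11, integral_neg, integral_neg, r02, r11]
  ring

/-! ### Green's formula and the trace inequality on the reference triangle -/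

/-- `n · Div q` on the edge number `e`, with the unnormalized normal. -/
def edgeShear (q : Pt → Mat) (e : Fin 3) (t : ℝ) : ℝ :=
  ∑ i, ∑ j, refNormal e i * pd j (fun y => q y (i, j)) (edgePt refVert e t)

/-- The component `j` of `n · q` on the edge number `e`, with the unnormalized normal. -/
def edgeFlux (q : Pt → Mat) (e : Fin 3) (j : Fin 2) (t : ℝ) : ℝ :=
  ∑ i, refNormal e i * q (edgePt refVert e t) (i, j)

theorem continuous_edgeShear {q : Pt → Mat} (hq : ContDiff ℝ ∞ q) (e : Fin 3) :
    Continuous (edgeShear q e) := by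
  unfold edgeShear
  refine continuous_finsetSum _ fun i _ => continuous_finsetSum _ fun j _ => ?_
  exact continuous_const.mul ((contDiff_pd (contDiff_entry hq _) _).continuous.comp
    (contDiff_edgePt _ _).continuous)

theorem continuous_edgeFlux {q : Pt → Mat} (hq : ContDiff ℝ ∞ q) (e : Fin 3) (j : Fin 2) :
    Continuous (edgeFlux q e j) := by
  unfold edgeFlux
  refine continuous_finsetSum _ fun i _ => ?_
  exact continuous_const.mul ((contDiff_entry hq _).continuous.comp
    (contDiff_edgePt _ _).continuous)

theorem continuous_hess {φ : Pt → ℝ} (hφ : ContDiff ℝ ∞ φ) : Continuous (hess φ) := by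
  unfold hess
  exact (PiLp.continuous_toLp 2 _).comp
    (continuous_pi fun ij => (contDiff_pd (contDiff_pd hφ _) _).continuous)

theorem continuous_divDiv {q : Pt → Mat} (hq : ContDiff ℝ ∞ q) : Continuous (divDiv q) := by
  unfold divDiv
  exact continuous_finsetSum _ fun i _ => continuous_finsetSum _ fun j _ =>
    (contDiff_pd (contDiff_pd (contDiff_entry hq _) _) _).continuous

theorem inner_mat (A B : Mat) : ⟪A, B⟫ = ∑ i, ∑ j, A (i, j) * B (i, j) := by
  rw [PiLp.inner_apply, Fintype.sum_prod_type]
  simp [mul_comm]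

/-- Divergence theorem for the vector field `φ Div q - q ∇φ`. Its divergence is `φ div Div q - D²φ :
q`, since the two mixed first-order terms cancel by the symmetry of `q`. -/
theorem green_refTri {φ : Pt → ℝ} (hφ : ContDiff ℝ ∞ φ) {q : Pt → Mat} (hq : ContDiff ℝ ∞ q)
    (sq : ∀ x i j, q x (i, j) = q x (j, i)) :
    (∫ x in refTri, φ x * divDiv q x) - ∫ x in refTri, ⟪hess φ x, q x⟫
      = ∑ e, ((∫ t in Set.Icc (0 : ℝ) 1, φ (edgePt refVert e t) * edgeShear q e t)
        - ∑ j, ∫ t in Set.Icc (0 : ℝ) 1, pd j φ (edgePt refVert e t) * edgeFlux q e j t) := by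
  have hφe : ∀ e, Continuous fun t => φ (edgePt refVert e t) := fun e =>
    hφ.continuous.comp (contDiff_edgePt _ _).continuous
  have hpe : ∀ j e, Continuous fun t => pd j φ (edgePt refVert e t) := fun j e =>
    (contDiff_pd hφ j).continuous.comp (contDiff_edgePt _ _).continuous
  have hpq : ∀ i j k, ContDiff ℝ ∞ (pd k fun y => q y (i, j)) := fun i j k =>
    contDiff_pd (contDiff_entry hq _) _
  let f : Fin 2 → Pt → ℝ := fun i x =>
    ∑ j, (pd j (fun y => q y (i, j)) x * φ x + -1 * (q x (i, j) * pd j φ x))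
  have hfj : ∀ i j, ContDiff ℝ ∞ fun x =>
      pd j (fun y => q y (i, j)) x * φ x + -1 * (q x (i, j) * pd j φ x) := fun i j =>
    ((hpq i j j).mul hφ).add (contDiff_const.mul ((contDiff_entry hq _).mul (contDiff_pd hφ j)))
  have h := integral_div_refTri (f := f) fun i => ContDiff.sum fun j _ => hfj i j
  have hL : ∀ x, ∑ i, pd i (f i) x = φ x * divDiv q x - ⟪hess φ x, q x⟫ := by
    intro x
    have h1 : ∀ i, pd i (f i) x = ∑ j, (pd i (pd j fun y => q y (i, j)) x * φ x
        + pd j (fun y => q y (i, j)) x * pd i φ x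
        + -1 * (pd i (fun y => q y (i, j)) x * pd j φ x + q x (i, j) * pd i (pd j φ) x)) := by
      intro i
      rw [pd_sum _ (hfj i)]
      refine Finset.sum_congr rfl fun j _ => ?_
      rw [pd_fun_add ((hpq i j j).mul hφ)
        (contDiff_const.mul ((contDiff_entry hq _).mul (contDiff_pd hφ j))), pd_const_mul,
        pd_mul (hpq i j j) hφ, pd_mul (contDiff_entry hq _) (contDiff_pd hφ j)]
    have hs : (fun y => q y (0, 1)) = fun y => q y (1, 0) := funext fun y => sq y 0 1
    simp only [h1, inner_mat, hess, divDiv, Fin.sum_univ_two, hs, sq x 0 1]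
    ring
  have hR : ∀ e t, ∑ i, refNormal e i * f i (edgePt refVert e t)
      = φ (edgePt refVert e t) * edgeShear q e t
        - ∑ j, pd j φ (edgePt refVert e t) * edgeFlux q e j t := by
    intro e t
    simp only [f, edgeShear, edgeFlux, Fin.sum_univ_two]
    ring
  simp only [hL, hR] at h
  have i1 : Integrable (fun x => φ x * divDiv q x) (volume.restrict refTri) :=
    integrable_tri _ (hφ.continuous.mul (continuous_divDiv hq))
  have i2 : Integrable (fun x => ⟪hess φ x, q x⟫) (volume.restrict refTri) :=
    integrable_tri _ ((continuous_hess hφ).inner hq.continuous)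
  rw [integral_sub i1 i2] at h
  rw [h]
  refine Finset.sum_congr rfl fun e _ => ?_
  have hj : ∀ j, Continuous fun t => pd j φ (edgePt refVert e t) * edgeFlux q e j t := fun j =>
    (hpe j e).mul (continuous_edgeFlux hq e j)
  have i3 : Integrable (fun t => φ (edgePt refVert e t) * edgeShear q e t)
      (volume.restrict (Set.Icc (0 : ℝ) 1)) :=
    integrable_Icc ((hφe e).mul (continuous_edgeShear hq e))
  rw [integral_sub i3 (integrable_Icc (continuous_finsetSum _ fun j _ => hj j)),
    integral_finsetSum _ fun j _ => integrable_Icc (hj j)]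

/-- The position vector based at the vertex opposite to edge `e` is tangential on the two other
edges. On `e` its product with the unnormalized normal is twice the area of the triangle, which is
`1`. -/
theorem refNormal_position (e e' : Fin 3) (t : ℝ) :
    ∑ i, refNormal e' i * (edgePt refVert e' t i - refVert (e + 2) i) = if e' = e then 1 else 0 := by
  fin_cases e <;> fin_cases e' <;>
    simp [refNormal, refVert, edgePt, Fin.sum_univ_two]
  ring

/-- Divergence theorem for `f² (x - v)`, with `v` the vertex opposite to edge `e`: by
`refNormal_position` only edge `e` contributes to the flux. Inside the triangle `|xᵢ - vᵢ| ≤ 1`, and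
Young's inequality bounds the divergence. -/
theorem trace_inequality {f : Pt → ℝ} (hf : ContDiff ℝ ∞ f) (e : Fin 3) :
    ∫ t in Set.Icc (0 : ℝ) 1, f (edgePt refVert e t) ^ 2
      ≤ ∫ x in refTri, (4 * f x ^ 2 + ∑ i, pd i f x ^ 2) := by
  have hc : ∀ i, ContDiff ℝ ∞ fun x : Pt => x i + -refVert (e + 2) i := fun i => by fun_prop
  have h := integral_div_refTri (f := fun i x => f x ^ 2 * (x i + -refVert (e + 2) i))
    fun i => (hf.pow 2).mul (hc i)
  have hR : ∑ e', ∫ t in Set.Icc (0 : ℝ) 1, ∑ i, refNormal e' i *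
      (f (edgePt refVert e' t) ^ 2 * (edgePt refVert e' t i + -refVert (e + 2) i))
      = ∫ t in Set.Icc (0 : ℝ) 1, f (edgePt refVert e t) ^ 2 := by
    have h1 : ∀ e' t, ∑ i, refNormal e' i *
        (f (edgePt refVert e' t) ^ 2 * (edgePt refVert e' t i + -refVert (e + 2) i))
        = if e' = e then f (edgePt refVert e' t) ^ 2 else 0 := by
      intro e' t
      have h2 := congrArg (fun z => f (edgePt refVert e' t) ^ 2 * z) (refNormal_position e e' t)
      simp only [Finset.mul_sum, mul_ite, mul_one, mul_zero] at h2
      rw [← h2]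
      exact Finset.sum_congr rfl fun i _ => by ring
    simp only [h1]
    rw [Finset.sum_eq_single e]
    · simp
    · intro b _ hb
      simp [hb]
    · simp
  rw [hR] at h
  rw [← h]
  have hpd : ∀ x, ∑ i, pd i (fun x => f x ^ 2 * (x i + -refVert (e + 2) i)) x
      = ∑ i, (2 * f x * pd i f x * (x i + -refVert (e + 2) i) + f x ^ 2) := by
    intro x
    refine Finset.sum_congr rfl fun i _ => ?_
    rw [pd_mul (hf.pow 2) (hc i), pd_pow hf, pd_fun_add (by fun_prop) contDiff_const, pd_coord,
      pd_const]
    simp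
  simp only [hpd]
  refine integral_mono_ae (integrable_tri _ (continuous_finsetSum _ fun i _ => ?_))
    (integrable_tri _ ?_) ?_
  · exact (((continuous_const.mul hf.continuous).mul (contDiff_pd hf i).continuous).mul
      (hc i).continuous).add (hf.continuous.pow 2)
  · exact (continuous_const.mul (hf.continuous.pow 2)).add (continuous_finsetSum _ fun i _ =>
      (contDiff_pd hf i).continuous.pow 2)
  · have hm : ∀ᵐ x ∂volume.restrict refTri, x ∈ refClosed := by
      rw [restrict_tri, closedTri_refVert]
      refine ae_restrict_mem ?_
      rw [← closedTri_refVert]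
      exact (isCompact_closedTri _).isClosed.measurableSet
    filter_upwards [hm] with x hx
    obtain ⟨h1, h2, h3⟩ := hx
    have hb : ∀ i, (x i + -refVert (e + 2) i) ^ 2 ≤ 1 := by
      intro i
      rw [sq_le_one_iff_abs_le_one, abs_le]
      fin_cases e <;> fin_cases i <;> simp [refVert] <;> constructor <;> linarith
    have hi : ∀ i, 2 * f x * pd i f x * (x i + -refVert (e + 2) i) + f x ^ 2
        ≤ 2 * f x ^ 2 + pd i f x ^ 2 := by
      intro i
      nlinarith [sq_nonneg (pd i f x - f x * (x i + -refVert (e + 2) i)),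
        mul_le_mul_of_nonneg_left (hb i) (sq_nonneg (f x))]
    have h0 := hi 0
    have h1 := hi 1
    simp only [Fin.sum_univ_two]
    linarith

/-! ### Traces on the reference triangle, including the full gradient -/

theorem inner_real (a b : ℝ) : ⟪a, b⟫ = a * b := by
  simp [mul_comm]

theorem inner_eq_of_ae {α F : Type*} [MeasurableSpace α] {μ : Measure α} [NormedAddCommGroup F]
    [InnerProductSpace ℝ F] {u v : Lp F 2 μ} {f g : α → F} (hu : u =ᵐ[μ] f) (hv : v =ᵐ[μ] g) :
    ⟪u, v⟫ = ∫ x, ⟪f x, g x⟫ ∂μ := by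
  rw [L2.inner_def]
  refine integral_congr_ae ?_
  filter_upwards [hu, hv] with x h1 h2
  rw [h1, h2]

theorem memLp_Icc {g : ℝ → ℝ} (hg : Continuous g) :
    MemLp g 2 (volume.restrict (Set.Icc (0 : ℝ) 1)) := by
  obtain ⟨C, hC⟩ := isCompact_Icc.exists_bound_of_continuousOn (s := Set.Icc (0 : ℝ) 1)
    hg.continuousOn
  exact MemLp.of_bound hg.aestronglyMeasurable C
    ((ae_restrict_iff' measurableSet_Icc).2 (ae_of_all _ hC))

/-- A continuous function as an element of `L²(0,1)`. -/
def toL2I (g : ℝ → ℝ) (hg : Continuous g) : L2I := (memLp_Icc hg).toLp g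

theorem coeFn_toL2I {g : ℝ → ℝ} (hg : Continuous g) :
    toL2I g hg =ᵐ[volume.restrict (Set.Icc (0 : ℝ) 1)] g :=
  (memLp_Icc hg).coeFn_toLp

theorem inner_toL2I (u : L2I) {g : ℝ → ℝ} (hg : Continuous g) :
    ⟪u, toL2I g hg⟫ = ∫ t in Set.Icc (0 : ℝ) 1, u t * g t := by
  rw [inner_eq_of_ae (EventuallyEq.refl _ _) (coeFn_toL2I hg)]
  simp only [inner_real]

/-- Jets on the reference triangle with boundary values of the function and of its gradient. -/
abbrev RefTrace : Type := Jet refTri × (Fin 3 → L2I) × (Fin 3 → Fin 2 → L2I)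

/-- The jets of smooth functions on the reference triangle, with their boundary values. -/
def refGraph : Submodule ℝ RefTrace where
  carrier := {z | ∃ φ : Pt → ℝ, ContDiff ℝ ∞ φ ∧
    z.1.1 =ᵐ[volume.restrict refTri] φ ∧
    (∀ i, z.1.2.1 i =ᵐ[volume.restrict refTri] pd i φ) ∧
    z.1.2.2 =ᵐ[volume.restrict refTri] hess φ ∧
    (∀ e, z.2.1 e =ᵐ[volume.restrict (Set.Icc (0 : ℝ) 1)] fun t => φ (edgePt refVert e t)) ∧
    ∀ e i, z.2.2 e i =ᵐ[volume.restrict (Set.Icc (0 : ℝ) 1)]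
      fun t => pd i φ (edgePt refVert e t)}
  add_mem' := by
    rintro a b ⟨φ, hφ, h1, h2, h3, h4, h5⟩ ⟨ψ, hψ, k1, k2, k3, k4, k5⟩
    refine ⟨φ + ψ, hφ.add hψ, (Lp.coeFn_add _ _).trans (h1.add k1), fun i => ?_, ?_, fun e => ?_,
      fun e i => ?_⟩
    · rw [pd_add hφ hψ]
      exact (Lp.coeFn_add _ _).trans ((h2 i).add (k2 i))
    · rw [hess_add hφ hψ]
      exact (Lp.coeFn_add _ _).trans (h3.add k3)
    · exact (Lp.coeFn_add _ _).trans ((h4 e).add (k4 e))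
    · rw [pd_add hφ hψ]
      exact (Lp.coeFn_add _ _).trans ((h5 e i).add (k5 e i))
  zero_mem' := by
    refine ⟨0, contDiff_const, Lp.coeFn_zero _ _ _, fun i => ?_, ?_, fun e => Lp.coeFn_zero _ _ _,
      fun e i => ?_⟩
    · rw [pd_zero]
      exact Lp.coeFn_zero _ _ _
    · rw [hess_zero]
      exact Lp.coeFn_zero _ _ _
    · rw [pd_zero]
      exact Lp.coeFn_zero _ _ _
  smul_mem' := by
    rintro c a ⟨φ, hφ, h1, h2, h3, h4, h5⟩
    refine ⟨c • φ, hφ.const_smul c, (Lp.coeFn_smul _ _).trans (h1.const_smul c), fun i => ?_, ?_,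
      fun e => ?_, fun e i => ?_⟩
    · rw [pd_smul]
      exact (Lp.coeFn_smul _ _).trans ((h2 i).const_smul c)
    · rw [hess_smul]
      exact (Lp.coeFn_smul _ _).trans (h3.const_smul c)
    · exact (Lp.coeFn_smul _ _).trans ((h4 e).const_smul c)
    · rw [pd_smul]
      exact (Lp.coeFn_smul _ _).trans ((h5 e i).const_smul c)

theorem coeFn_entry {G : Set Pt} (ij : Fin 2 × Fin 2) (Q : L2Mat G) :
    entry ij Q =ᵐ[volume.restrict G] fun x => Q x ij :=
  (EuclideanSpace.proj ij : Mat →L[ℝ] ℝ).coeFn_compLpL Q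

theorem norm_sq_eq_integral {α : Type*} [MeasurableSpace α] {μ : Measure α} {u : Lp ℝ 2 μ}
    {f : α → ℝ} (hu : u =ᵐ[μ] f) : ‖u‖ ^ 2 = ∫ x, f x ^ 2 ∂μ := by
  rw [← real_inner_self_eq_norm_sq, inner_eq_of_ae hu hu]
  simp only [inner_real, sq]

/-- This is `trace_inequality` for `∂ᵢφ`. It makes the gradient traces of smooth functions converge
as soon as their jets converge. -/
theorem norm_gradTrace_le : ∃ K : ℝ, ∀ z ∈ refGraph, ∀ e i, ‖z.2.2 e i‖ ≤ K * ‖z.1‖ := by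
  have hN : ∀ ij, ∃ C : ℝ, ∀ Q : L2Mat refTri, ‖entry ij Q‖ ≤ C * ‖Q‖ := fun ij =>
    ⟨‖entry (G := refTri) ij‖, fun Q => (entry ij).le_opNorm Q⟩
  choose C hC using hN
  refine ⟨√(4 + (C (0, 0) ^ 2 + C (0, 1) ^ 2 + C (1, 0) ^ 2 + C (1, 1) ^ 2)), ?_⟩
  rintro z ⟨φ, hφ, -, h2, h3, -, h5⟩ e i
  have hz1 : ‖z.1.2.1 i‖ ≤ ‖z.1‖ :=
    ((norm_le_pi_norm z.1.2.1 i).trans (norm_fst_le z.1.2)).trans (norm_snd_le z.1)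
  have hz2 : ‖z.1.2.2‖ ≤ ‖z.1‖ := (norm_snd_le z.1.2).trans (norm_snd_le z.1)
  have hent : ∀ j, entry (i, j) z.1.2.2 =ᵐ[volume.restrict refTri] pd j (pd i φ) := fun j => by
    filter_upwards [coeFn_entry (i, j) z.1.2.2, h3] with x k1 k2
    rw [k1, k2]
    rfl
  have hp := contDiff_pd hφ i
  have key : ‖z.2.2 e i‖ ^ 2 ≤ 4 * ‖z.1.2.1 i‖ ^ 2 + ∑ j, ‖entry (i, j) z.1.2.2‖ ^ 2 := by
    rw [norm_sq_eq_integral (h5 e i), norm_sq_eq_integral (h2 i)]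
    simp only [norm_sq_eq_integral (hent _)]
    refine (trace_inequality hp e).trans_eq ?_
    have i1 : Integrable (fun x => 4 * pd i φ x ^ 2) (volume.restrict refTri) :=
      integrable_tri _ (continuous_const.mul (hp.continuous.pow 2))
    have i2 : ∀ j ∈ Finset.univ,
        Integrable (fun x => pd j (pd i φ) x ^ 2) (volume.restrict refTri) := fun j _ =>
      integrable_tri _ ((contDiff_pd hp j).continuous.pow 2)
    rw [integral_add i1 (integrable_finsetSum _ i2), integral_const_mul, integral_finsetSum _ i2]
  have hb : ∀ ij, ‖entry ij z.1.2.2‖ ^ 2 ≤ C ij ^ 2 * ‖z.1‖ ^ 2 := fun ij => by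
    have h0 : 0 ≤ C ij * ‖z.1.2.2‖ := (norm_nonneg _).trans (hC ij _)
    calc ‖entry ij z.1.2.2‖ ^ 2 ≤ (C ij * ‖z.1.2.2‖) ^ 2 := by gcongr; exact hC ij _
      _ = C ij ^ 2 * ‖z.1.2.2‖ ^ 2 := by ring
      _ ≤ C ij ^ 2 * ‖z.1‖ ^ 2 := by gcongr
  refine abs_le_of_sq_le_sq' ?_ (by positivity) |>.2
  rw [mul_pow, Real.sq_sqrt (by positivity)]
  have h1 : ‖z.1.2.1 i‖ ^ 2 ≤ ‖z.1‖ ^ 2 := by gcongr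
  have b00 := hb (0, 0)
  have b01 := hb (0, 1)
  have b10 := hb (1, 0)
  have b11 := hb (1, 1)
  have p := fun ij => mul_nonneg (sq_nonneg (C ij)) (sq_nonneg ‖z.1‖)
  have p00 := p (0, 0)
  have p01 := p (0, 1)
  have p10 := p (1, 0)
  have p11 := p (1, 1)
  rw [Fin.sum_univ_two] at key
  fin_cases i
  · simp only [Fin.zero_eta, Fin.isValue] at *
    nlinarith
  · simp only [Fin.mk_one, Fin.isValue] at *
    nlinarith

/-- Green's formula for functions with traces. -/
theorem green_closure {z : RefTrace} (hz : z ∈ refGraph.topologicalClosure) {Q : HdDiv refTri}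
    {q : Pt → Mat} (hq : ContDiff ℝ ∞ q) (sq : ∀ x i j, q x (i, j) = q x (j, i))
    (h1 : field Q =ᵐ[volume.restrict refTri] q)
    (h2 : dDiv Q =ᵐ[volume.restrict refTri] divDiv q) :
    ⟪z.1.1, dDiv Q⟫ - ⟪z.1.2.2, field Q⟫
      = ∑ e, ((∫ t in Set.Icc (0 : ℝ) 1, z.2.1 e t * edgeShear q e t)
        - ∑ j, ∫ t in Set.Icc (0 : ℝ) 1, z.2.2 e j t * edgeFlux q e j t) := by
  have hs := continuous_edgeShear hq
  have hf := continuous_edgeFlux hq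
  -- Written with inner products, both sides are visibly continuous in `z`, so that the identity
  -- extends from smooth functions to the closure.
  simp only [← inner_toL2I _ (hs _), ← inner_toL2I _ (hf _ _)]
  refine closure_minimal (t := {z : RefTrace | ⟪z.1.1, dDiv Q⟫ - ⟪z.1.2.2, field Q⟫
    = ∑ e, (⟪z.2.1 e, toL2I _ (hs e)⟫ - ∑ j, ⟪z.2.2 e j, toL2I _ (hf e j)⟫)}) ?_ ?_ hz
  · rintro z ⟨φ, hφ, k1, -, k3, k4, k5⟩
    have hg := green_refTri hφ hq sq
    rw [Set.mem_ofPred_eq, inner_eq_of_ae k1 h2, inner_eq_of_ae k3 h1]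
    simp only [inner_eq_of_ae (k4 _) (coeFn_toL2I (hs _)),
      inner_eq_of_ae (k5 _ _) (coeFn_toL2I (hf _ _)), inner_real]
    exact hg
  · exact isClosed_eq (by fun_prop) (by fun_prop)

/-- The increment along the edge number `e` of the reference triangle. -/
def refEdge (e : Fin 3) (i : Fin 2) : ℝ := refVert (e + 1) i - refVert e i

theorem hasDerivAt_edge {φ : Pt → ℝ} (hφ : ContDiff ℝ ∞ φ) (e : Fin 3) (t : ℝ) :
    HasDerivAt (fun t => φ (edgePt refVert e t))
      (∑ i, refEdge e i * pd i φ (edgePt refVert e t)) t := by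
  have h1 : HasDerivAt (edgePt refVert e) (refVert (e + 1) - refVert e) t := by
    unfold edgePt
    simpa using ((hasDerivAt_id' t).smul_const (refVert (e + 1) - refVert e)).const_add (refVert e)
  have h := (hφ.differentiable (by simp) (edgePt refVert e t)).hasFDerivAt.comp_hasDerivAt t h1
  have e1 : refVert (e + 1) - refVert e
      = ∑ i, refEdge e i • EuclideanSpace.single i (1 : ℝ) := by
    ext k
    fin_cases k <;> simp [refEdge, Fin.sum_univ_two]
  rw [e1, map_sum] at h
  refine HasDerivAt.congr_deriv h ?_
  simp [pd]

/-- Integration by parts along the edge for smooth functions, then closure. It says that the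
tangential part of the gradient trace is the weak derivative of the trace. -/
theorem integral_tangential {z : RefTrace} (hz : z ∈ refGraph.topologicalClosure) (e : Fin 3)
    {ψ : ℝ → ℝ} (hψ : ContDiff ℝ ∞ ψ) (h0 : ψ 0 = 0) (h1 : ψ 1 = 0) :
    ∑ i, refEdge e i * ∫ t in Set.Icc (0 : ℝ) 1, z.2.2 e i t * ψ t
      = -∫ t in Set.Icc (0 : ℝ) 1, z.2.1 e t * deriv ψ t := by
  have hd : Continuous (deriv ψ) := hψ.continuous_deriv (by simp)
  simp only [← inner_toL2I _ hψ.continuous, ← inner_toL2I _ hd]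
  refine closure_minimal (t := {z : RefTrace |
    ∑ i, refEdge e i * ⟪z.2.2 e i, toL2I _ hψ.continuous⟫ = -⟪z.2.1 e, toL2I _ hd⟫}) ?_ ?_ hz
  · rintro z ⟨φ, hφ, -, -, -, k4, k5⟩
    rw [Set.mem_ofPred_eq, inner_eq_of_ae (k4 _) (coeFn_toL2I hd)]
    simp only [inner_eq_of_ae (k5 _ _) (coeFn_toL2I hψ.continuous), inner_real]
    have hc : ∀ i, Continuous fun t => pd i φ (edgePt refVert e t) := fun i =>
      (contDiff_pd hφ i).continuous.comp (contDiff_edgePt _ _).continuous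
    have hp := intervalIntegral.integral_mul_deriv_eq_deriv_mul (a := 0) (b := 1)
      (fun t _ => hasDerivAt_edge hφ e t)
      (fun t _ => (hψ.differentiable (by simp) t).hasDerivAt)
      ((continuous_finsetSum _ fun i _ => continuous_const.mul (hc i)).intervalIntegrable _ _)
      (hd.intervalIntegrable _ _)
    rw [h0, h1, intervalIntegral.integral_of_le zero_le_one,
      intervalIntegral.integral_of_le zero_le_one, ← integral_Icc_eq_integral_Ioc,
      ← integral_Icc_eq_integral_Ioc] at hp
    rw [hp]
    simp only [← integral_const_mul, mul_zero, sub_zero, zero_sub, neg_neg]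
    have i1 : ∀ i ∈ Finset.univ,
        Integrable (fun t => refEdge e i * (pd i φ (edgePt refVert e t) * ψ t))
          (volume.restrict (Set.Icc (0 : ℝ) 1)) := fun i _ =>
      integrable_Icc (continuous_const.mul ((hc i).mul hψ.continuous))
    rw [← integral_finsetSum _ i1]
    refine integral_congr_ae (ae_of_all _ fun t => ?_)
    simp only [Finset.sum_mul, mul_assoc]
  · exact isClosed_eq (by fun_prop) (by fun_prop)

/-- If the boundary values are polynomial, so are those of the tangential derivative. -/
theorem tangential_eq_derivative {z : RefTrace} (hz : z ∈ refGraph.topologicalClosure) (e : Fin 3)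
    {p : Polynomial ℝ}
    (hp : z.2.1 e =ᵐ[volume.restrict (Set.Icc (0 : ℝ) 1)] fun t => p.eval t) :
    ∀ᵐ t ∂volume.restrict (Set.Icc (0 : ℝ) 1),
      ∑ i, refEdge e i * z.2.2 e i t = p.derivative.eval t := by
  have hi : ∀ i, Integrable (z.2.2 e i) (volume.restrict (Set.Icc (0 : ℝ) 1)) := fun i =>
    (Lp.memLp (z.2.2 e i)).integrable (by norm_num)
  let f : ℝ → ℝ := fun t => ∑ i, refEdge e i * z.2.2 e i t - p.derivative.eval t
  have hf : IntegrableOn f (Set.Icc (0 : ℝ) 1) :=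
    (integrable_finsetSum _ fun i _ => (hi i).const_mul _).sub
      (integrable_Icc p.derivative.continuous)
  -- The tangential trace and `p.derivative` are both weak derivatives of `p` on the open interval,
  -- so their difference is orthogonal to all test functions.
  have key : ∀ᵐ t, t ∈ Set.Ioo (0 : ℝ) 1 → f t = 0 := by
    refine isOpen_Ioo.ae_eq_zero_of_integral_contDiff_smul_eq_zero
      (hf.mono_set Set.Ioo_subset_Icc_self).locallyIntegrableOn fun ψ hψ _ hs => ?_
    have hz0 : ∀ t, t ∉ Set.Ioo (0 : ℝ) 1 → ψ t = 0 := fun t ht =>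
      image_eq_zero_of_notMem_tsupport fun h => ht (hs h)
    have h0 : ψ 0 = 0 := hz0 0 (by simp)
    have h1 : ψ 1 = 0 := hz0 1 (by simp)
    have hd : Continuous (deriv ψ) := hψ.continuous_deriv (by simp)
    have hT := integral_tangential hz e hψ h0 h1
    have hib := intervalIntegral.integral_mul_deriv_eq_deriv_mul (a := 0) (b := 1)
      (fun t _ => p.hasDerivAt t) (fun t _ => (hψ.differentiable (by simp) t).hasDerivAt)
      (p.derivative.continuous.intervalIntegrable _ _) (hd.intervalIntegrable _ _)
    rw [h0, h1, intervalIntegral.integral_of_le zero_le_one,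
      intervalIntegral.integral_of_le zero_le_one, ← integral_Icc_eq_integral_Ioc,
      ← integral_Icc_eq_integral_Ioc] at hib
    have hib2 : ∫ t in Set.Icc (0 : ℝ) 1, z.2.1 e t * deriv ψ t
        = ∫ t in Set.Icc (0 : ℝ) 1, p.eval t * deriv ψ t := by
      refine integral_congr_ae ?_
      filter_upwards [hp] with t ht
      rw [ht]
    rw [hib2, hib] at hT
    have hiψ : ∀ i, Integrable (fun t => z.2.2 e i t * ψ t)
        (volume.restrict (Set.Icc (0 : ℝ) 1)) := fun i => by
      exact MemLp.integrable_mul (p := 2) (q := 2) (Lp.memLp _) (memLp_Icc hψ.continuous)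
    have e1 : ∫ t, ψ t • f t = ∫ t in Set.Icc (0 : ℝ) 1, ψ t • f t := by
      refine (setIntegral_eq_integral_of_forall_compl_eq_zero fun t ht => ?_).symm
      rw [hz0 t fun h => ht (Set.Ioo_subset_Icc_self h), zero_smul]
    have e2 : ∀ t, ψ t • f t
        = ∑ i, refEdge e i * (z.2.2 e i t * ψ t) - p.derivative.eval t * ψ t := by
      intro t
      simp only [f, smul_eq_mul, Fin.sum_univ_two]
      ring
    rw [e1]
    simp only [e2]
    have i1 : Integrable (fun t => p.derivative.eval t * ψ t)
        (volume.restrict (Set.Icc (0 : ℝ) 1)) :=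
      integrable_Icc (p.derivative.continuous.mul hψ.continuous)
    rw [integral_sub (integrable_finsetSum _ fun i _ => (hiψ i).const_mul _) i1,
      integral_finsetSum _ fun i _ => (hiψ i).const_mul _]
    simp only [integral_const_mul]
    rw [hT]
    simp
  have hae : (Set.Icc (0 : ℝ) 1 : Set ℝ) =ᵐ[volume] Set.Ioo (0 : ℝ) 1 := Ioo_ae_eq_Icc.symm
  rw [ae_restrict_iff' measurableSet_Icc]
  filter_upwards [key, hae.mem_iff] with t ht hm h
  exact sub_eq_zero.1 (ht (hm.1 h))

/-! ### `div Div` is determined by the field -/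

theorem memLp_tri {F : Type*} [NormedAddCommGroup F] (P : Fin 3 → Pt) {f : Pt → F}
    (hf : Continuous f) [SecondCountableTopologyEither Pt F] :
    MemLp f 2 (volume.restrict (tri P)) := by
  have : IsFiniteMeasure (volume.restrict (tri P)) := by
    rw [restrict_tri]
    exact ⟨by simpa using (isCompact_closedTri P).measure_lt_top⟩
  obtain ⟨C, hC⟩ := (isCompact_closedTri P).exists_bound_of_continuousOn hf.continuousOn
  refine MemLp.of_bound hf.aestronglyMeasurable C ?_
  rw [restrict_tri]
  exact (ae_restrict_iff' (isCompact_closedTri P).isClosed.measurableSet).2 (ae_of_all _ hC)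

theorem integral_mul_pd {f g : Pt → ℝ} (hf : ContDiff ℝ ∞ f) (hg : ContDiff ℝ ∞ g)
    (hc : HasCompactSupport g) (i : Fin 2) :
    ∫ x, f x * pd i g x = -∫ x, pd i f x * g x := by
  have hpg : HasCompactSupport (pd i g) := hc.fderiv_apply (𝕜 := ℝ) _
  have h := integral_mul_fderiv_eq_neg_fderiv_mul_of_integrable (𝕜 := ℝ) (f := f) (g := g)
    (v := EuclideanSpace.single i 1) (μ := (volume : Measure Pt))
    (((contDiff_pd hf i).continuous.mul hg.continuous).integrable_of_hasCompactSupport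
      hc.mul_left)
    ((hf.continuous.mul (contDiff_pd hg i).continuous).integrable_of_hasCompactSupport
      hpg.mul_left)
    ((hf.continuous.mul hg.continuous).integrable_of_hasCompactSupport hc.mul_left)
    (fun x _ => hf.differentiable (by simp) x) (fun x _ => hg.differentiable (by simp) x)
  exact h

theorem setIntegral_test {G : Set Pt} {φ : Pt → ℝ} (hφ : IsTest G φ) (f : Pt → ℝ) :
    ∫ x in G, f x * φ x = ∫ x, f x * φ x := by
  refine setIntegral_eq_integral_of_forall_compl_eq_zero fun x hx => ?_
  rw [image_eq_zero_of_notMem_tsupport fun h => hx (hφ.2.2 h), mul_zero]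

theorem integral_divDiv_test {G : Set Pt} {q : Pt → Mat} (hq : ContDiff ℝ ∞ q) {φ : Pt → ℝ}
    (hφ : IsTest G φ) :
    ∫ x in G, divDiv q x * φ x
      = ∑ i, ∑ j, ∫ x in G, q x (i, j) * pd j (pd i φ) x := by
  have h1 : ∀ i j, ∫ x in G, pd i (pd j fun y => q y (i, j)) x * φ x
      = ∫ x in G, q x (i, j) * pd j (pd i φ) x := by
    intro i j
    have e1 := integral_mul_pd (contDiff_pd (contDiff_entry hq (i, j)) j) hφ.1 hφ.2.1 i
    have e2 := integral_mul_pd (contDiff_entry hq (i, j)) (hφ.pd i).1 (hφ.pd i).2.1 j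
    rw [setIntegral_test hφ, setIntegral_test ((hφ.pd i).pd j), e2, e1, neg_neg]
  have hi : ∀ i j, Integrable (fun x => pd i (pd j fun y => q y (i, j)) x * φ x)
      (volume.restrict G) := fun i j =>
    (((contDiff_pd (contDiff_pd (contDiff_entry hq _) _) _).continuous.mul
      hφ.1.continuous).integrable_of_hasCompactSupport hφ.2.1.mul_left).integrableOn
  simp only [← h1, divDiv, Finset.sum_mul]
  rw [integral_finsetSum _ fun i _ => integrable_finsetSum _ fun j _ => hi i j]
  exact Finset.sum_congr rfl fun i _ => integral_finsetSum _ fun j _ => hi i j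

/-- A test function as an element of `L²(G)`. -/
def IsTest.toL2 {G : Set Pt} {φ : Pt → ℝ} (hφ : IsTest G φ) : L2 G :=
  (hφ.1.continuous.memLp_of_hasCompactSupport (μ := volume.restrict G) hφ.2.1).toLp φ

theorem IsTest.coeFn_toL2 {G : Set Pt} {φ : Pt → ℝ} (hφ : IsTest G φ) :
    hφ.toL2 =ᵐ[volume.restrict G] φ :=
  MemLp.coeFn_toLp (hφ.1.continuous.memLp_of_hasCompactSupport (μ := volume.restrict G) hφ.2.1)

/-- Two integrations by parts for smooth fields, then closure: in the completion, `dDiv` is still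
the distributional `div Div` of `field`. -/
theorem inner_dDiv_test {G : Set Pt} (Q : HdDiv G) {φ : Pt → ℝ} (hφ : IsTest G φ) :
    ⟪dDiv Q, hφ.toL2⟫ = ∑ i, ∑ j, ⟪entry (i, j) (field Q), ((hφ.pd i).pd j).toL2⟫ := by
  refine closure_minimal (t := {z : WithLp 2 (L2Mat G × L2 G) |
    ⟪z.snd, hφ.toL2⟫ = ∑ i, ∑ j, ⟪entry (i, j) z.fst, ((hφ.pd i).pd j).toL2⟫}) ?_ ?_ Q.2
  · rintro z ⟨q, hq, -, h1, h2⟩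
    have he : ∀ ij, entry ij z.fst =ᵐ[volume.restrict G] fun x => q x ij := fun ij => by
      filter_upwards [coeFn_entry ij z.fst, h1] with x k1 k2
      rw [k1, k2]
    rw [Set.mem_ofPred_eq, inner_eq_of_ae h2 hφ.coeFn_toL2]
    simp only [inner_eq_of_ae (he _) ((hφ.pd _).pd _).coeFn_toL2, inner_real]
    exact integral_divDiv_test hq hφ
  · exact isClosed_eq (by fun_prop) (by fun_prop)

theorem eq_zero_of_inner_test {G : Set Pt} (hG : IsOpen G) (u : L2 G)
    (h : ∀ φ (hφ : IsTest G φ), ⟪u, hφ.toL2⟫ = 0) : u = 0 := by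
  have hloc : LocallyIntegrableOn u G := by
    refine (locallyIntegrableOn_iff hG.isLocallyClosed).2 fun K hK hKc => ?_
    have : IsFiniteMeasure (volume.restrict K) := ⟨by simpa using hKc.measure_lt_top⟩
    exact ((Lp.memLp u).mono_measure (Measure.restrict_mono hK le_rfl)).integrable (by norm_num)
  have key := hG.ae_eq_zero_of_integral_contDiff_smul_eq_zero hloc fun φ h1 h2 h3 => by
    have hφ : IsTest G φ := ⟨h1, h2, h3⟩
    have := h φ hφ
    rw [inner_eq_of_ae (EventuallyEq.refl _ _) hφ.coeFn_toL2] at this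
    simp only [inner_real, setIntegral_test hφ] at this
    simpa only [smul_eq_mul, mul_comm] using this
  apply Lp.ext
  refine EventuallyEq.trans ?_ (Lp.coeFn_zero _ _ _).symm
  exact (ae_restrict_iff' hG.measurableSet).2 key

theorem entry_ext {G : Set Pt} {Q R : L2Mat G} (h : ∀ ij, entry ij Q = entry ij R) : Q = R := by
  apply Lp.ext
  have h1 : ∀ ij, ∀ᵐ x ∂volume.restrict G, Q x ij = R x ij := fun ij => by
    have k1 := coeFn_entry ij Q
    rw [h ij] at k1
    filter_upwards [k1, coeFn_entry ij R] with x k1 k2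
    rw [← k1, k2]
  filter_upwards [ae_all_iff.2 h1] with x hx
  exact PiLp.ext hx

/-- A zero field has zero distributional `div Div`, and test functions separate `L²(G)`. Finite
dimension of polynomial subspaces of `HdDiv G` can therefore be read off from the entries of the
fields alone. -/
theorem field_injective {G : Set Pt} (hG : IsOpen G) : Function.Injective (field (G := G)) := by
  refine (injective_iff_map_eq_zero _).2 fun Q hQ => ?_
  have hd : dDiv Q = 0 := eq_zero_of_inner_test hG _ fun φ hφ => by
    rw [inner_dDiv_test, hQ]
    simp
  apply Subtype.ext
  apply (WithLp.equiv 2 _).injective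
  exact Prod.ext hQ hd

/-- Elements of `H(div Div; G)` whose entries are polynomials of degree at most `r`. -/
def PolyField (r : ℕ) (G : Set Pt) : Submodule ℝ (HdDiv G) :=
  ⨅ ij, (Poly r G).comap ((entry ij).comp field).toLinearMap

theorem mem_PolyField {r : ℕ} {G : Set Pt} {Q : HdDiv G} :
    Q ∈ PolyField r G ↔ ∀ ij, entry ij (field Q) ∈ Poly r G := by
  simp [PolyField, Submodule.mem_iInf]

theorem finiteDimensional_PolyField (r : ℕ) {G : Set Pt} (hG : IsOpen G) :
    FiniteDimensional ℝ (PolyField r G) := by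
  let f : PolyField r G →ₗ[ℝ] (Fin 2 × Fin 2 → Poly r G) :=
    LinearMap.pi fun ij => LinearMap.codRestrict (Poly r G)
      (((entry ij).comp field).toLinearMap.comp (PolyField r G).subtype)
      fun Q => mem_PolyField.1 Q.2 ij
  refine Module.Finite.of_injective f ((injective_iff_map_eq_zero _).2 fun Q hQ => ?_)
  apply Subtype.ext
  apply field_injective hG
  refine entry_ext fun ij => ?_
  have h := congrArg Subtype.val (congrFun hQ ij)
  simpa [f] using h

/-! ### Smooth elements of `H(div Div; T)` -/

/-- `Q ∈ H(div Div; G)` is represented by the smooth symmetric matrix field `q`. -/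
structure IsRep {G : Set Pt} (Q : HdDiv G) (q : Pt → Mat) : Prop where
  smooth : ContDiff ℝ ∞ q
  symm : ∀ x i j, q x (i, j) = q x (j, i)
  field_eq : field Q =ᵐ[volume.restrict G] q
  dDiv_eq : dDiv Q =ᵐ[volume.restrict G] divDiv q

theorem exists_isRep (P : Fin 3 → Pt) {q : Pt → Mat} (hq : ContDiff ℝ ∞ q)
    (sq : ∀ x i j, q x (i, j) = q x (j, i)) : ∃ Q : HdDiv (tri P), IsRep Q q := by
  have h1 : MemLp q 2 (volume.restrict (tri P)) := memLp_tri P hq.continuous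
  have h2 : MemLp (divDiv q) 2 (volume.restrict (tri P)) := memLp_tri P (continuous_divDiv hq)
  refine ⟨⟨WithLp.toLp 2 (h1.toLp q, h2.toLp _), (smoothGraph (tri P)).le_topologicalClosure
    ⟨q, hq, sq, h1.coeFn_toLp, h2.coeFn_toLp⟩⟩, hq, sq, h1.coeFn_toLp, h2.coeFn_toLp⟩

/-- Smooth fields are dense by construction. Hence the formula on smooth representatives in the
definition of `RefDual` determines a functional completely. -/
theorem eq_zero_of_isRep {G : Set Pt} {μ : StrongDual ℝ (HdDiv G)}
    (h : ∀ Q q, IsRep Q q → μ Q = 0) : μ = 0 := by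
  ext Q
  obtain ⟨x, hx, hlim⟩ := mem_closure_iff_seq_limit.1 Q.2
  let y : ℕ → HdDiv G := fun n => ⟨x n, (smoothGraph G).le_topologicalClosure (hx n)⟩
  have hy : Tendsto y atTop (𝓝 Q) := tendsto_subtype_rng.2 hlim
  have h0 : ∀ n, μ (y n) = 0 := fun n => by
    obtain ⟨q, hq, sq, h1, h2⟩ := hx n
    exact h (y n) q ⟨hq, sq, h1, h2⟩
  have hm := (μ.continuous.tendsto Q).comp hy
  refine tendsto_nhds_unique hm ?_
  simp [Function.comp_def, h0]

/-! ### Boundary functionals on the reference triangle -/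

/-- The functional `q ↦ ∑ₑ ∫ₑ (n · Div q) aₑ - (n · q) · cₑ + ∫ M : q`. -/
def boundaryForm (a : Fin 3 → Polynomial ℝ) (c : Fin 3 → Fin 2 → Polynomial ℝ) (M : Mat)
    (q : Pt → Mat) : ℝ :=
  ∑ e, ((∫ t in Set.Icc (0 : ℝ) 1, (a e).eval t * edgeShear q e t)
    - ∑ j, ∫ t in Set.Icc (0 : ℝ) 1, (c e j).eval t * edgeFlux q e j t)
  + ∫ x in refTri, ⟪M, q x⟫

theorem integrable_poly_mul (p : Polynomial ℝ) {g : ℝ → ℝ} (hg : Continuous g) :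
    Integrable (fun t => p.eval t * g t) (volume.restrict (Set.Icc (0 : ℝ) 1)) :=
  integrable_Icc (p.continuous.mul hg)

theorem boundaryForm_add {q : Pt → Mat} (hq : ContDiff ℝ ∞ q) (a a' : Fin 3 → Polynomial ℝ)
    (c c' : Fin 3 → Fin 2 → Polynomial ℝ) (M M' : Mat) :
    boundaryForm (a + a') (c + c') (M + M') q
      = boundaryForm a c M q + boundaryForm a' c' M' q := by
  have h1 : ∀ (p p' : Polynomial ℝ) (g : ℝ → ℝ), Continuous g →
      ∫ t in Set.Icc (0 : ℝ) 1, (p + p').eval t * g t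
      = (∫ t in Set.Icc (0 : ℝ) 1, p.eval t * g t) + ∫ t in Set.Icc (0 : ℝ) 1, p'.eval t * g t := by
    intro p p' g hg
    rw [← integral_add (integrable_poly_mul p hg) (integrable_poly_mul p' hg)]
    simp only [Polynomial.eval_add, add_mul]
  have h2 : ∀ M : Mat, Integrable (fun x => ⟪M, q x⟫) (volume.restrict refTri) := fun M =>
    integrable_tri _ (continuous_const.inner hq.continuous)
  simp only [boundaryForm, Pi.add_apply, h1 _ _ _ (continuous_edgeShear hq _),
    h1 _ _ _ (continuous_edgeFlux hq _ _), inner_add_left, integral_add (h2 M) (h2 M'),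
    Finset.sum_add_distrib, Finset.sum_sub_distrib]
  ring

theorem boundaryForm_smul (r : ℝ) (q : Pt → Mat) (a : Fin 3 → Polynomial ℝ)
    (c : Fin 3 → Fin 2 → Polynomial ℝ) (M : Mat) :
    boundaryForm (r • a) (r • c) (r • M) q = r * boundaryForm a c M q := by
  simp only [boundaryForm, Pi.smul_apply, Polynomial.eval_smul, smul_eq_mul, mul_assoc,
    integral_const_mul, inner_smul_left, mul_add, Finset.mul_sum, mul_sub]
  simp

/-- The functionals on `H(div Div; T)` given by boundary integrals against polynomials and the
integral against a constant matrix. -/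
def RefDual : Submodule ℝ (StrongDual ℝ (HdDiv refTri)) where
  carrier := {μ | ∃ (a : Fin 3 → Polynomial ℝ) (c : Fin 3 → Fin 2 → Polynomial ℝ) (M : Mat),
    (∀ e, (a e).natDegree ≤ 3) ∧ (∀ e j, (c e j).natDegree ≤ 2) ∧
    ∀ Q q, IsRep Q q → μ Q = boundaryForm a c M q}
  add_mem' := by
    rintro μ ν ⟨a, c, M, h1, h2, h3⟩ ⟨a', c', M', k1, k2, k3⟩
    refine ⟨a + a', c + c', M + M', fun e => ?_, fun e j => ?_, fun Q q h => ?_⟩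
    · exact (Polynomial.natDegree_add_le _ _).trans (max_le (h1 e) (k1 e))
    · exact (Polynomial.natDegree_add_le _ _).trans (max_le (h2 e j) (k2 e j))
    · rw [boundaryForm_add h.smooth, ← h3 Q q h, ← k3 Q q h]
      rfl
  zero_mem' := by
    refine ⟨0, 0, 0, by simp, by simp, fun Q q _ => ?_⟩
    simp [boundaryForm]
  smul_mem' := by
    rintro r μ ⟨a, c, M, h1, h2, h3⟩
    refine ⟨r • a, r • c, r • M, fun e => ?_, fun e j => ?_, fun Q q h => ?_⟩
    · exact (Polynomial.natDegree_smul_le _ _).trans (h1 e)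
    · exact (Polynomial.natDegree_smul_le _ _).trans (h2 e j)
    · rw [boundaryForm_smul, ← h3 Q q h]
      rfl

/-! ### Unisolvence -/

/-- Barycentric coordinates of the reference triangle. -/
def bary (k : Fin 3) (x : Pt) : ℝ := ![1 - x 0 - x 1, x 0, x 1] k

theorem isPoly_bary (k : Fin 3) : IsPoly 1 (bary k) := by
  have h : ∀ i : Fin 2, IsPoly 1 fun x => -1 * x i := fun i => (isPoly_coord i).const_mul _
  fin_cases k
  · have := ((isPoly_const 1 1).add (h 0)).add (h 1)
    have e : bary 0 = fun x => 1 + -1 * x 0 + -1 * x 1 := by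
      funext x
      simp [bary]
      ring
    exact e ▸ this
  · exact isPoly_coord 0
  · exact isPoly_coord 1

theorem contDiff_bary (k : Fin 3) : ContDiff ℝ ∞ (bary k) := (isPoly_bary k).contDiff

theorem bary_edgePt (k e : Fin 3) (t : ℝ) :
    bary k (edgePt refVert e t) = if k = e then 1 - t else if k = e + 1 then t else 0 := by
  fin_cases k <;> fin_cases e <;> simp [bary, edgePt, refVert]
  all_goals ring

/-- Derivative in the direction of the edge number `k`. -/
def edgeDeriv (k : Fin 3) (f : Pt → ℝ) (x : Pt) : ℝ := ∑ j, refEdge k j * pd j f x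

theorem edgeDeriv_mul (k : Fin 3) {f g : Pt → ℝ} (hf : ContDiff ℝ ∞ f) (hg : ContDiff ℝ ∞ g)
    (x : Pt) :
    edgeDeriv k (fun y => f y * g y) x = edgeDeriv k f x * g x + f x * edgeDeriv k g x := by
  simp only [edgeDeriv, pd_mul hf hg, Fin.sum_univ_two]
  ring

theorem edgeDeriv_bary (k j : Fin 3) (x : Pt) :
    edgeDeriv k (bary j) x = (if j = k + 1 then 1 else 0) - if j = k then 1 else 0 := by
  have h0 : ∀ i x, pd i (bary 0) x = -1 := by
    intro i x
    have e : bary 0 = fun x => (1 + -1 * x 0) + -1 * x 1 := by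
      funext x
      simp [bary]
      ring
    rw [e, pd_fun_add (by fun_prop) (by fun_prop), pd_fun_add (by fun_prop) (by fun_prop),
      pd_const, pd_const_mul, pd_const_mul, pd_coord, pd_coord]
    fin_cases i <;> simp
  have h1 : ∀ i x, pd i (bary 1) x = if 0 = i then 1 else 0 := fun i x => pd_coord i 0 x
  have h2 : ∀ i x, pd i (bary 2) x = if 1 = i then 1 else 0 := fun i x => pd_coord i 1 x
  fin_cases j <;> simp only [edgeDeriv, Fin.sum_univ_two, Fin.zero_eta, Fin.mk_one,
    Fin.reduceFinMk, h0, h1, h2] <;> fin_cases k <;> simp [refEdge, refVert]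

/-- The matrix field `p tₖ tₖᵀ`. -/
def edgeField (k : Fin 3) (p : Pt → ℝ) (x : Pt) : Mat :=
  WithLp.toLp 2 fun ij => refEdge k ij.1 * refEdge k ij.2 * p x

theorem contDiff_edgeField (k : Fin 3) {p : Pt → ℝ} (hp : ContDiff ℝ ∞ p) :
    ContDiff ℝ ∞ (edgeField k p) := by
  rw [contDiff_euclidean]
  exact fun ij => contDiff_const.mul hp

theorem edgeField_symm (k : Fin 3) (p : Pt → ℝ) (x : Pt) (i j : Fin 2) :
    edgeField k p x (i, j) = edgeField k p x (j, i) := by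
  simp only [edgeField]
  ring

/-- The product of the normal to the edge number `e` and the edge vector number `k`. -/
theorem refNormal_refEdge (e k : Fin 3) :
    ∑ i, refNormal e i * refEdge k i
      = if e = k + 1 then 1 else if e = k + 2 then -1 else 0 := by
  fin_cases e <;> fin_cases k <;> simp [refNormal, refEdge, refVert]

/-- The divergence of `p tₖ tₖᵀ` is `(∂ₜp) tₖ`, with the derivative along `tₖ`; so only the sign `n
· tₖ` enters, and it is zero on edge `k`. -/
theorem edgeShear_edgeField (k e : Fin 3) {p : Pt → ℝ} (t : ℝ) :
    edgeShear (edgeField k p) e t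
      = (if e = k + 1 then 1 else if e = k + 2 then -1 else 0)
        * edgeDeriv k p (edgePt refVert e t) := by
  rw [← refNormal_refEdge]
  have h : ∀ i j x, pd j (fun y => edgeField k p y (i, j)) x
      = refEdge k i * refEdge k j * pd j p x := fun i j x => pd_const_mul _ j x
  simp only [edgeShear, edgeDeriv, h, Fin.sum_univ_two]
  ring

theorem sum_edgeFlux_edgeField (k e : Fin 3) (p : Pt → ℝ) (c : Fin 2 → ℝ) (t : ℝ) :
    ∑ j, c j * edgeFlux (edgeField k p) e j t
      = (if e = k + 1 then 1 else if e = k + 2 then -1 else 0)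
        * (p (edgePt refVert e t) * ∑ j, refEdge k j * c j) := by
  rw [← refNormal_refEdge]
  simp only [edgeFlux, edgeField, Fin.sum_univ_two]
  ring

/-- The tangential component `tₖ · M tₖ`. -/
def edgeEntry (k : Fin 3) (M : Mat) : ℝ := ∑ i, ∑ j, refEdge k i * refEdge k j * M (i, j)

/-- Both boundary terms carry the factor `n · tₖ`. Edge `k` drops out and the two other edges enter
with opposite signs. -/
theorem boundaryForm_edgeField (a : Fin 3 → Polynomial ℝ) (c : Fin 3 → Fin 2 → Polynomial ℝ)
    (M : Mat) (k : Fin 3) {p : Pt → ℝ} (hp : ContDiff ℝ ∞ p) :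
    boundaryForm a c M (edgeField k p)
      = (∫ t in Set.Icc (0 : ℝ) 1, ((a (k + 1)).eval t * edgeDeriv k p (edgePt refVert (k + 1) t)
          - p (edgePt refVert (k + 1) t) * ∑ j, refEdge k j * (c (k + 1) j).eval t))
        - (∫ t in Set.Icc (0 : ℝ) 1, ((a (k + 2)).eval t * edgeDeriv k p (edgePt refVert (k + 2) t)
          - p (edgePt refVert (k + 2) t) * ∑ j, refEdge k j * (c (k + 2) j).eval t))
        + edgeEntry k M * ∫ x in refTri, p x := by
  have hq := contDiff_edgeField k hp
  have h1 : ∀ e, (∫ t in Set.Icc (0 : ℝ) 1, (a e).eval t * edgeShear (edgeField k p) e t)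
      - ∑ j, ∫ t in Set.Icc (0 : ℝ) 1, (c e j).eval t * edgeFlux (edgeField k p) e j t
      = (if e = k + 1 then 1 else if e = k + 2 then -1 else 0) *
        ∫ t in Set.Icc (0 : ℝ) 1, ((a e).eval t * edgeDeriv k p (edgePt refVert e t)
          - p (edgePt refVert e t) * ∑ j, refEdge k j * (c e j).eval t) := by
    intro e
    rw [← integral_finsetSum _ fun j _ => integrable_poly_mul (c e j) (continuous_edgeFlux hq e j),
      ← integral_sub (integrable_poly_mul (a e) (continuous_edgeShear hq e))
        (integrable_finsetSum _ fun j _ => integrable_poly_mul (c e j) (continuous_edgeFlux hq e j)),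
      ← integral_const_mul]
    refine integral_congr_ae (ae_of_all _ fun t => ?_)
    simp only [sum_edgeFlux_edgeField, edgeShear_edgeField]
    ring
  have h2 : ∀ x, ⟪M, edgeField k p x⟫ = edgeEntry k M * p x := by
    intro x
    simp only [inner_mat, edgeField, edgeEntry, Fin.sum_univ_two]
    ring
  simp only [boundaryForm, h1, h2, integral_const_mul]
  congr 1
  -- The edges are listed cyclically as `k`, `k + 1`, `k + 2`.
  rw [← Equiv.sum_comp (Equiv.addLeft k), Fin.sum_univ_three]
  have e1 : ∀ k : Fin 3, k ≠ k + 1 := by decide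
  have e2 : ∀ k : Fin 3, k ≠ k + 2 := by decide
  have e3 : ∀ k : Fin 3, k + 2 ≠ k + 1 := by decide
  simp [e1, e2, e3, sub_eq_add_neg]

/-- A nonnegative continuous function with zero integral vanishes on the open triangle, in
particular at the barycenter. This is needed for the bubble `λₖ² λₖ₊₁²`. -/
theorem integral_refTri_pos {p : Pt → ℝ} (hp : Continuous p) (h0 : ∀ x, 0 ≤ p x)
    (h1 : p (mkPt (1 / 3) (1 / 3)) ≠ 0) : 0 < ∫ x in refTri, p x := by
  refine (integral_nonneg h0).lt_of_ne fun h => h1 ?_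
  have h2 := (integral_eq_zero_iff_of_nonneg h0 (integrable_tri _ hp)).1 h.symm
  have h3 : Set.EqOn p 0 refTri :=
    Measure.eqOn_open_of_ae_eq h2 isOpen_interior hp.continuousOn continuousOn_const
  refine h3 ?_
  have hc : ∀ i : Fin 2, Continuous fun x : Pt => x i := fun i => by fun_prop
  have ho : IsOpen {x : Pt | 0 < x 0 ∧ 0 < x 1 ∧ x 0 + x 1 < 1} :=
    (isOpen_lt continuous_const (hc 0)).inter ((isOpen_lt continuous_const (hc 1)).inter
      (isOpen_lt ((hc 0).add (hc 1)) continuous_const))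
  refine interior_maximal (fun x hx => ?_) ho ⟨?_, ?_, ?_⟩
  · rw [closedTri_refVert]
    exact ⟨hx.1.le, hx.2.1.le, hx.2.2.le⟩
  all_goals norm_num [mkPt]

/-! ### Moment conditions for polynomials in one variable -/

theorem integral_Icc_pow (n : ℕ) : ∫ t in Set.Icc (0 : ℝ) 1, t ^ n = 1 / (n + 1) := by
  rw [integral_Icc_eq_integral_Ioc, ← intervalIntegral.integral_of_le zero_le_one, integral_pow]
  simp

/-- Degree six is what a cubic times a cubic weight requires. Moment conditions become linear
equations for the coefficients. -/
theorem integral_Icc_sextic (g : ℝ → ℝ) (c : Fin 7 → ℝ) (h : ∀ t, g t = ∑ i, c i * t ^ (i : ℕ)) :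
    ∫ t in Set.Icc (0 : ℝ) 1, g t = ∑ i, c i * (1 / ((i : ℕ) + 1)) := by
  simp only [h]
  rw [integral_finsetSum _ fun i _ => (integrable_Icc (continuous_pow _)).const_mul _]
  simp only [integral_const_mul, integral_Icc_pow]

/-- A cubic that is orthogonal to the Hermite weights vanishes. -/
theorem cubic_eq_zero {p : Polynomial ℝ} (hp : p.natDegree ≤ 3)
    (h1 : ∫ t in Set.Icc (0 : ℝ) 1, p.eval t * t ^ 2 = 0)
    (h2 : ∫ t in Set.Icc (0 : ℝ) 1, p.eval t * t ^ 3 = 0)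
    (h3 : ∫ t in Set.Icc (0 : ℝ) 1, p.eval t * (1 - t) ^ 2 = 0)
    (h4 : ∫ t in Set.Icc (0 : ℝ) 1, p.eval t * (1 - t) ^ 3 = 0) : p = 0 := by
  have he : ∀ t, p.eval t = p.coeff 0 + p.coeff 1 * t + p.coeff 2 * t ^ 2 + p.coeff 3 * t ^ 3 := by
    intro t
    rw [Polynomial.eval_eq_sum_range' (n := 4) (by omega)]
    simp [Finset.sum_range_succ]
  generalize p.coeff 0 = u0 at he
  generalize p.coeff 1 = u1 at he
  generalize p.coeff 2 = u2 at he
  generalize p.coeff 3 = u3 at he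
  rw [integral_Icc_sextic _ ![0, 0, u0, u1, u2, u3, 0] fun t => by
    simp [he, Fin.sum_univ_succ]; ring] at h1
  rw [integral_Icc_sextic _ ![0, 0, 0, u0, u1, u2, u3] fun t => by
    simp [he, Fin.sum_univ_succ]; ring] at h2
  rw [integral_Icc_sextic _ ![u0, u1 - 2 * u0, u2 - 2 * u1 + u0, u3 - 2 * u2 + u1, u2 - 2 * u3, u3,
    0] fun t => by simp [he, Fin.sum_univ_succ]; ring] at h3
  rw [integral_Icc_sextic _ ![u0, u1 - 3 * u0, u2 - 3 * u1 + 3 * u0, u3 - 3 * u2 + 3 * u1 - u0,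
    3 * u2 - 3 * u3 - u1, 3 * u3 - u2, -u3] fun t => by
      simp [he, Fin.sum_univ_succ]; ring] at h4
  norm_num [Fin.sum_univ_succ] at h1 h2 h3 h4
  -- The linear system is nonsingular because the weights `t²`, `t³`, `(1 - t)²`, `(1 - t)³` form a
  -- basis of the cubics.
  have z0 : u0 = 0 := by linarith
  have z1 : u1 = 0 := by linarith
  have z2 : u2 = 0 := by linarith
  have z3 : u3 = 0 := by linarith
  refine Polynomial.funext fun t => ?_
  rw [he, z0, z1, z2, z3]
  simp

/-- A quadratic that is orthogonal to `t 𝒫²` vanishes. -/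
theorem quadratic_eq_zero {p : Polynomial ℝ} (hp : p.natDegree ≤ 2)
    (h : ∀ i : Fin 3, ∫ t in Set.Icc (0 : ℝ) 1, p.eval t * t ^ ((i : ℕ) + 1) = 0) : p = 0 := by
  have he : ∀ t, p.eval t = p.coeff 0 + p.coeff 1 * t + p.coeff 2 * t ^ 2 := by
    intro t
    rw [Polynomial.eval_eq_sum_range' (n := 3) (by omega)]
    simp [Finset.sum_range_succ]
  generalize p.coeff 0 = u0 at he
  generalize p.coeff 1 = u1 at he
  generalize p.coeff 2 = u2 at he
  have h1 := h 0
  have h2 := h 1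
  have h3 := h 2
  rw [integral_Icc_sextic _ ![0, u0, u1, u2, 0, 0, 0] fun t => by
    simp [he, Fin.sum_univ_succ]; ring] at h1
  rw [integral_Icc_sextic _ ![0, 0, u0, u1, u2, 0, 0] fun t => by
    simp [he, Fin.sum_univ_succ]; ring] at h2
  rw [integral_Icc_sextic _ ![0, 0, 0, u0, u1, u2, 0] fun t => by
    simp [he, Fin.sum_univ_succ]; ring] at h3
  norm_num [Fin.sum_univ_succ] at h1 h2 h3
  -- The linear system is nonsingular because `∫ t p² > 0` for `p ≠ 0`.
  have z0 : u0 = 0 := by linarith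
  have z1 : u1 = 0 := by linarith
  have z2 : u2 = 0 := by linarith
  refine Polynomial.funext fun t => ?_
  rw [he, z0, z1, z2]
  simp

/-- The product `λₖᵐ λₖ₊₁ⁿ`. -/
def baryPow (k : Fin 3) (m n : ℕ) (x : Pt) : ℝ := bary k x ^ m * bary (k + 1) x ^ n

theorem isPoly_baryPow (k : Fin 3) (m n : ℕ) : IsPoly (m + n) (baryPow k m n) := by
  have h := ((isPoly_bary k).pow m).mul ((isPoly_bary (k + 1)).pow n)
  rw [one_mul, one_mul] at h
  exact h

theorem bary_center (k : Fin 3) : bary k (mkPt (1 / 3) (1 / 3)) = 1 / 3 := by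
  fin_cases k <;> norm_num [bary, mkPt]

theorem edgeDeriv_baryPow (k : Fin 3) (m n : ℕ) (x : Pt) :
    edgeDeriv k (baryPow k m n) x
      = n * bary k x ^ m * bary (k + 1) x ^ (n - 1)
        - m * bary k x ^ (m - 1) * bary (k + 1) x ^ n := by
  have e1 : ∀ k : Fin 3, k ≠ k + 1 := by decide
  have hpow : ∀ (j : Fin 3) (m : ℕ), edgeDeriv k (fun y => bary j y ^ m) x
      = m * bary j x ^ (m - 1) * edgeDeriv k (bary j) x := by
    intro j m
    simp only [edgeDeriv, pd_pow (contDiff_bary j), Fin.sum_univ_two]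
    ring
  have h := edgeDeriv_mul k ((contDiff_bary k).pow m) ((contDiff_bary (k + 1)).pow n) x
  rw [hpow, hpow, edgeDeriv_bary, edgeDeriv_bary, if_neg (e1 k), if_pos rfl, if_pos rfl,
    if_neg (e1 k).symm] at h
  refine h.trans ?_
  ring

/-- The pair `(λₖ, λₖ₊₁)` equals `(0, 1 - t)` on edge `k + 1` and `(t, 0)` on edge `k + 2`. The
powers of zero are kept: with `0 ^ 0 = 1` they show which terms survive for given exponents.
Truncated exponents occur only next to a factor `m` or `n` that vanishes with them. -/
theorem boundaryForm_baryPow (a : Fin 3 → Polynomial ℝ) (c : Fin 3 → Fin 2 → Polynomial ℝ)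
    (M : Mat) (k : Fin 3) (m n : ℕ) :
    boundaryForm a c M (edgeField k (baryPow k m n))
      = (∫ t in Set.Icc (0 : ℝ) 1,
          ((a (k + 1)).eval t * (n * 0 ^ m * (1 - t) ^ (n - 1) - m * 0 ^ (m - 1) * (1 - t) ^ n)
          - 0 ^ m * (1 - t) ^ n * ∑ j, refEdge k j * (c (k + 1) j).eval t))
        - (∫ t in Set.Icc (0 : ℝ) 1,
          ((a (k + 2)).eval t * (n * t ^ m * 0 ^ (n - 1) - m * t ^ (m - 1) * 0 ^ n)
          - t ^ m * 0 ^ n * ∑ j, refEdge k j * (c (k + 2) j).eval t))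
        + edgeEntry k M * ∫ x in refTri, baryPow k m n x := by
  rw [boundaryForm_edgeField a c M k (isPoly_baryPow k m n).contDiff]
  have e1 : ∀ k : Fin 3, k ≠ k + 1 := by decide
  have e2 : ∀ k : Fin 3, k ≠ k + 1 + 1 := by decide
  have e3 : ∀ k : Fin 3, k ≠ k + 2 := by decide
  have e4 : ∀ k : Fin 3, k = k + 2 + 1 := by decide
  have e5 : ∀ k : Fin 3, k + 1 ≠ k + 2 := by decide
  have e6 : ∀ k : Fin 3, k + 1 ≠ k + 2 + 1 := by decide
  simp only [edgeDeriv_baryPow, baryPow, bary_edgePt, if_neg (e1 k), if_neg (e2 k), if_neg (e3 k),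
    if_pos (e4 k), if_neg (e5 k), if_neg (e6 k), if_true]

/-- The system of test fields is triangular. Once the bubble has removed the volume term, fields
whose factor `p` vanishes on the boundary edges involved see only the `aₑ`, through the derivative
of `p`; with those gone, fields whose `p` survives on exactly one of the two visible edges see one
component of one `cₑ`. -/
theorem boundaryData_eq_zero {a : Fin 3 → Polynomial ℝ} {c : Fin 3 → Fin 2 → Polynomial ℝ}
    {M : Mat} (ha : ∀ e, (a e).natDegree ≤ 3) (hc : ∀ e j, (c e j).natDegree ≤ 2)
    (h : ∀ k p, IsPoly 4 p → boundaryForm a c M (edgeField k p) = 0) :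
    (∀ k, edgeEntry k M = 0) ∧ (∀ e, a e = 0) ∧ ∀ e j, c e j = 0 := by
  have hb : ∀ k m n, m + n ≤ 4 → boundaryForm a c M (edgeField k (baryPow k m n)) = 0 :=
    fun k m n hmn => h k _ ((isPoly_baryPow k m n).mono hmn)
  simp only [boundaryForm_baryPow] at hb
  have hM : ∀ k, edgeEntry k M = 0 := by
    intro k
    -- The bubble and its gradient vanish on both edges that could contribute.
    have h22 := hb k 2 2 le_rfl
    have hpos : 0 < ∫ x in refTri, baryPow k 2 2 x := by
      refine integral_refTri_pos (isPoly_baryPow k 2 2).contDiff.continuous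
        (fun x => by unfold baryPow; positivity) ?_
      norm_num [baryPow, bary_center]
    norm_num at h22
    exact h22.resolve_right hpos.ne'
  simp only [hM, zero_mul, add_zero] at hb
  have hA : ∀ e, a e = 0 := by
    intro e
    have f1 : e - 1 + 1 = e := by revert e; decide
    have f2 : e - 2 + 2 = e := by revert e; decide
    -- With exponents `(2, 1)` and `(3, 1)` only edge `k + 2` contributes, with weights `t²` and
    -- `t³`. With `(1, 2)` and `(1, 3)` only edge `k + 1` contributes, with weights `-(1 - t)²` and
    -- `-(1 - t)³` for the derivative.
    refine cubic_eq_zero (ha e) ?_ ?_ ?_ ?_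
    · simpa [f2] using hb (e - 2) 2 1 (by norm_num)
    · simpa [f2] using hb (e - 2) 3 1 (by norm_num)
    · simpa [f1, integral_neg] using hb (e - 1) 1 2 (by norm_num)
    · simpa [f1, integral_neg] using hb (e - 1) 1 3 (by norm_num)
  refine ⟨hM, hA, ?_⟩
  simp only [hA, Polynomial.eval_zero, zero_mul, zero_sub, integral_neg] at hb
  -- `C e k` is the component `tₖ · cₑ`.
  let C : Fin 3 → Fin 3 → Polynomial ℝ := fun e k => ∑ j, refEdge k j • c e j
  have hCe : ∀ e k t, (C e k).eval t = ∑ j, refEdge k j * (c e j).eval t := fun e k t => by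
    simp [C]
  have hCd : ∀ e k, (C e k).natDegree ≤ 2 := fun e k =>
    Polynomial.natDegree_sum_le_of_forall_le _ _ fun j _ =>
      (Polynomial.natDegree_smul_le _ _).trans (hc e j)
  simp only [← hCe] at hb
  have h1 : ∀ k, C (k + 1) k = 0 := by
    intro k
    -- On edge `k + 1` the weights are powers of `1 - t`, so the edge is reversed before
    -- `quadratic_eq_zero` is applied.
    have hr : (C (k + 1) k).comp (1 - Polynomial.X) = 0 := by
      refine quadratic_eq_zero ?_ fun i => ?_
      · refine Polynomial.natDegree_comp_le.trans ?_
        have : (1 - Polynomial.X : Polynomial ℝ).natDegree ≤ 1 := by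
          refine (Polynomial.natDegree_sub_le _ _).trans ?_
          simp
        nlinarith [hCd (k + 1) k]
      · have h0 := hb k 0 (i + 1) (by omega)
        rw [← setIntegral_Icc_reflect]
        simpa [mul_comm] using h0
    refine Polynomial.funext fun t => ?_
    have := congrArg (Polynomial.eval (1 - t)) hr
    simpa using this
  have h2 : ∀ k, C (k + 2) k = 0 := fun k => quadratic_eq_zero (hCd _ _) fun i => by
    have h0 := hb k (i + 1) 0 (by omega)
    simpa [mul_comm] using h0
  -- On each edge both components of `cₑ` along the two other edge vectors vanish, and these two
  -- vectors are linearly independent.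
  have hz : ∀ e t, (∑ j, refEdge (e + 1) j * (c e j).eval t = 0)
      ∧ ∑ j, refEdge (e + 2) j * (c e j).eval t = 0 := by
    intro e t
    have k1 := h1 (e + 2)
    have k2 := h2 (e + 1)
    have f1 : ∀ e : Fin 3, e + 2 + 1 = e := by decide
    have f2 : ∀ e : Fin 3, e + 1 + 2 = e := by decide
    rw [f1] at k1
    rw [f2] at k2
    exact ⟨by rw [← hCe, k2, Polynomial.eval_zero], by rw [← hCe, k1, Polynomial.eval_zero]⟩
  intro e j
  refine Polynomial.funext fun t => ?_
  obtain ⟨z1, z2⟩ := hz e t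
  rw [Fin.sum_univ_two] at z1 z2
  fin_cases e <;> fin_cases j <;> simp [refEdge, refVert] at z1 z2 ⊢ <;> linarith

/-- The matrices `tₖ tₖᵀ` span the symmetric matrices, so the vanishing of all `tₖ · M tₖ` removes
the symmetric part of `M`. The skew part is not seen by a symmetric `q`. -/
theorem boundaryForm_eq_zero {a : Fin 3 → Polynomial ℝ} {c : Fin 3 → Fin 2 → Polynomial ℝ}
    {M : Mat} (ha : ∀ e, (a e).natDegree ≤ 3) (hc : ∀ e j, (c e j).natDegree ≤ 2)
    (h : ∀ k p, IsPoly 4 p → boundaryForm a c M (edgeField k p) = 0) {q : Pt → Mat}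
    (sq : ∀ x i j, q x (i, j) = q x (j, i)) : boundaryForm a c M q = 0 := by
  obtain ⟨hM, hA, hC⟩ := boundaryData_eq_zero ha hc h
  have hin : ∀ x, ⟪M, q x⟫ = 0 := by
    intro x
    have m0 := hM 0
    have m1 := hM 1
    have m2 := hM 2
    simp [edgeEntry, refEdge, refVert, Fin.sum_univ_two] at m0 m1 m2
    have s := sq x 1 0
    simp only [inner_mat, Fin.sum_univ_two, s, m0, m2]
    have m3 : M (0, 1) + M (1, 0) = 0 := by linarith
    linear_combination q x (0, 1) * m3
  simp [boundaryForm, hA, hC, hin]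

/-! ### The operator on the reference triangle -/

/-- Symmetric polynomial matrix fields of degree at most `r` as elements of `H(div Div; G)`. -/
def PolyRep (r : ℕ) (G : Set Pt) : Submodule ℝ (HdDiv G) where
  carrier := {Q | ∃ q, IsRep Q q ∧ ∀ ij, IsPoly r fun x => q x ij}
  add_mem' := by
    rintro Q Q' ⟨q, ⟨h1, h2, h3, h4⟩, hp⟩ ⟨q', ⟨k1, k2, k3, k4⟩, kp⟩
    refine ⟨q + q', ⟨h1.add k1, fun x i j => ?_, ?_, ?_⟩, fun ij => (hp ij).add (kp ij)⟩
    · simp [h2 x i j, k2 x i j]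
    · rw [map_add]
      exact (Lp.coeFn_add _ _).trans (h3.add k3)
    · rw [map_add, divDiv_add h1 k1]
      exact (Lp.coeFn_add _ _).trans (h4.add k4)
  zero_mem' := by
    refine ⟨0, ⟨contDiff_const, fun _ _ _ => rfl, ?_, ?_⟩, fun ij => isPoly_const r 0⟩
    · rw [map_zero]
      exact Lp.coeFn_zero _ _ _
    · have h : divDiv 0 = 0 := by simpa using divDiv_smul (q := 0) 0
      rw [map_zero, h]
      exact Lp.coeFn_zero _ _ _
  smul_mem' := by
    rintro c Q ⟨q, ⟨h1, h2, h3, h4⟩, hp⟩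
    refine ⟨c • q, ⟨h1.const_smul c, fun x i j => ?_, ?_, ?_⟩, fun ij => (hp ij).const_mul c⟩
    · simp [h2 x i j]
    · rw [map_smul]
      exact (Lp.coeFn_smul _ _).trans (h3.const_smul c)
    · rw [map_smul, divDiv_smul]
      exact (Lp.coeFn_smul _ _).trans (h4.const_smul c)

theorem IsPoly.mem_Poly {r : ℕ} {G : Set Pt} {f : Pt → ℝ} (hf : IsPoly r f) {u : L2 G}
    (hu : u =ᵐ[volume.restrict G] f) : u ∈ Poly r G := by
  obtain ⟨P, hP, h⟩ := hf
  exact ⟨P, hP, hu.trans (ae_of_all _ h)⟩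

theorem exists_isPoly {r : ℕ} {G : Set Pt} {u : L2 G} (hu : u ∈ Poly r G) :
    ∃ f, IsPoly r f ∧ u =ᵐ[volume.restrict G] f := by
  obtain ⟨P, hP, h⟩ := hu
  exact ⟨_, ⟨P, hP, fun _ => rfl⟩, h⟩

theorem PolyRep_le (r : ℕ) (G : Set Pt) : PolyRep r G ≤ PolyField r G := by
  rintro Q ⟨q, h, hp⟩
  refine mem_PolyField.2 fun ij => (hp ij).mem_Poly ?_
  filter_upwards [coeFn_entry ij (field Q), h.field_eq] with x h1 h2
  rw [h1, h2]

/-- For quartic fields, `div Div` falls into `𝒫²`, exactly the space whose moments the operator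
preserves. -/
theorem dDiv_mem_of_PolyRep {r : ℕ} {G : Set Pt} {Q : HdDiv G} (hQ : Q ∈ PolyRep (r + 2) G) :
    dDiv Q ∈ Poly r G := by
  obtain ⟨q, h, hp⟩ := hQ
  refine IsPoly.mem_Poly ?_ h.dDiv_eq
  exact IsPoly.sum _ fun i _ => IsPoly.sum _ fun j _ => ((hp (i, j)).pd j).pd i

/-- The coordinate functionals of a basis `b` of `W` extend along the injection `ρ` to functionals
on the dual of `F`. By reflexivity these are evaluations at vectors `f i`, so `ρ w (f i)` is the
coordinate number `i` of `w`. Finite dimension of `W` follows from that of `F`. -/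
theorem exists_dual_system {W F : Type*} [AddCommMonoid W] [Module ℝ W] [AddCommGroup F]
    [Module ℝ F] [FiniteDimensional ℝ F] (ρ : W →ₗ[ℝ] Module.Dual ℝ F)
    (hρ : Function.Injective ρ) :
    ∃ (n : ℕ) (b : Fin n → W) (f : Fin n → F), ∀ w, ∑ i, ρ w (f i) • b i = w := by
  let _ : AddCommGroup W := Module.addCommMonoidToAddCommGroup ℝ
  have hfin' : FiniteDimensional ℝ W := Module.Finite.of_injective ρ hρ
  let b := Module.finBasis ℝ W
  have hev : ∀ ξ : Module.Dual ℝ W, ∃ f : F, ∀ w, ρ w f = ξ w := by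
    intro ξ
    obtain ⟨η, hη⟩ := LinearMap.dualMap_surjective_of_injective hρ ξ
    obtain ⟨f, hf⟩ := (Module.evalEquiv ℝ F).surjective η
    refine ⟨f, fun w => ?_⟩
    rw [← hη, ← hf]
    rfl
  choose f hf using fun i => hev (b.coord i)
  refine ⟨_, b, f, fun w => ?_⟩
  simp only [hf]
  exact b.sum_repr w

/-- An injectivity condition on finite-dimensional test spaces yields a Fortin operator. -/
theorem exists_fortin_operator {H : Type*} [NormedAddCommGroup H] [NormedSpace ℝ H]
    (F : Submodule ℝ H) [FiniteDimensional ℝ F] (Λ : Submodule ℝ (StrongDual ℝ H))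
    (hinj : ∀ μ ∈ Λ, (∀ f ∈ F, μ f = 0) → μ = 0) :
    ∃ π : H →L[ℝ] H, (∀ Q, π Q ∈ F) ∧ ∀ μ ∈ Λ, ∀ Q, μ (π Q) = μ Q := by
  let ρ : Λ →ₗ[ℝ] Module.Dual ℝ F :=
    { toFun := fun μ => (μ.1 : H →ₗ[ℝ] ℝ).comp F.subtype
      map_add' := fun _ _ => rfl
      map_smul' := fun _ _ => rfl }
  have hρ : Function.Injective ρ := by
    intro μ ν h
    refine Subtype.ext (sub_eq_zero.1 (hinj _ (Λ.sub_mem μ.2 ν.2) fun f hf => ?_))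
    exact sub_eq_zero.2 (LinearMap.congr_fun h ⟨f, hf⟩)
  obtain ⟨n, b, f, h⟩ := exists_dual_system ρ hρ
  -- The operator is `Q ↦ ∑ᵢ bᵢ(Q) fᵢ`. It is bounded because the `bᵢ` are, and `μ = ∑ᵢ μ(fᵢ) bᵢ`
  -- shows that it preserves every `μ ∈ Λ`.
  refine ⟨∑ i, (b i).1.smulRight (f i).1, fun Q => ?_, fun μ hμ Q => ?_⟩
  · rw [sum_apply]
    exact Submodule.sum_mem _ fun i _ => Submodule.smul_mem _ _ (f i).2
  · have h1 : ∑ i, μ (f i).1 • (b i).1 = μ := by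
      have h2 := congrArg Subtype.val (h ⟨μ, hμ⟩)
      rw [Submodule.coe_sum] at h2
      exact h2
    conv_rhs => rw [← h1]
    rw [sum_apply, sum_apply, map_sum]
    refine Finset.sum_congr rfl fun i _ => ?_
    rw [ContinuousLinearMap.smulRight_apply, map_smul, smul_apply, smul_eq_mul, smul_eq_mul,
      mul_comm]

/-- A bounded operator onto polynomial fields that preserves all functionals in `RefDual`. -/
theorem exists_refOperator : ∃ π : HdDiv refTri →L[ℝ] HdDiv refTri,
    (∀ Q, π Q ∈ PolyRep 4 refTri) ∧ ∀ μ ∈ RefDual, ∀ Q, μ (π Q) = μ Q := by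
  have := finiteDimensional_PolyField 4 (G := refTri) isOpen_interior
  have := Submodule.finiteDimensional_of_le (PolyRep_le 4 refTri)
  refine exists_fortin_operator _ _ fun μ hμ h0 => ?_
  obtain ⟨a, c, M, ha, hc, h⟩ := hμ
  refine eq_zero_of_isRep fun Q q hq => ?_
  rw [h Q q hq]
  refine boundaryForm_eq_zero ha hc (fun k p hp => ?_) hq.symm
  obtain ⟨R, hR⟩ := exists_isRep refVert (contDiff_edgeField k hp.contDiff) (edgeField_symm k p)
  rw [← h R _ hR]
  exact h0 R ⟨_, hR, fun ij => hp.const_mul _⟩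

/-! ### Affine transport of `H(div Div)` and of jets -/

/-- The congruence `A ↦ N A Nᵀ`. -/
def conjMat (N : Matrix (Fin 2) (Fin 2) ℝ) : Mat →L[ℝ] Mat :=
  LinearMap.toContinuousLinearMap
    { toFun := fun A => WithLp.toLp 2 fun ij => ∑ k, ∑ l, N ij.1 k * N ij.2 l * A (k, l)
      map_add' := fun A B => by
        ext ij
        simp [mul_add, Finset.sum_add_distrib]
      map_smul' := fun c A => by
        ext ij
        simp [mul_left_comm, mul_add] }

theorem conjMat_apply (N : Matrix (Fin 2) (Fin 2) ℝ) (A : Mat) (i j : Fin 2) :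
    conjMat N A (i, j) = ∑ k, ∑ l, N i k * N j l * A (k, l) := rfl

/-- The squared Frobenius norm. -/
def frob (N : Matrix (Fin 2) (Fin 2) ℝ) : ℝ := ∑ i, ∑ j, N i j ^ 2

theorem frob_nonneg (N : Matrix (Fin 2) (Fin 2) ℝ) : 0 ≤ frob N :=
  Finset.sum_nonneg fun _ _ => Finset.sum_nonneg fun _ _ => sq_nonneg _

/-- Cauchy–Schwarz in each entry; the sum of all `(Nᵢₖ Nⱼₗ)²` factors into `frob N ^ 2`. -/
theorem norm_conjMat_le (N : Matrix (Fin 2) (Fin 2) ℝ) : ‖conjMat N‖ ≤ frob N := by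
  refine ContinuousLinearMap.opNorm_le_bound _ (frob_nonneg N) fun A => ?_
  refine abs_le_of_sq_le_sq' ?_ (mul_nonneg (frob_nonneg N) (norm_nonneg _)) |>.2
  have h1 : ∀ ij : Fin 2 × Fin 2, (conjMat N A ij) ^ 2
      ≤ (∑ kl : Fin 2 × Fin 2, (N ij.1 kl.1 * N ij.2 kl.2) ^ 2) * ‖A‖ ^ 2 := by
    rintro ⟨i, j⟩
    rw [EuclideanSpace.real_norm_sq_eq, conjMat_apply, ← Fintype.sum_prod_type']
    exact Finset.sum_mul_sq_le_sq_mul_sq _ _ _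
  calc ‖conjMat N A‖ ^ 2 = ∑ ij, (conjMat N A ij) ^ 2 := EuclideanSpace.real_norm_sq_eq _
    _ ≤ ∑ ij : Fin 2 × Fin 2, (∑ kl : Fin 2 × Fin 2, (N ij.1 kl.1 * N ij.2 kl.2) ^ 2) * ‖A‖ ^ 2 :=
      Finset.sum_le_sum fun ij _ => h1 ij
    _ = (frob N * ‖A‖) ^ 2 := by
      simp only [frob, Fintype.sum_prod_type, Fin.sum_univ_two]
      ring

theorem inner_conjMat (N : Matrix (Fin 2) (Fin 2) ℝ) (A B : Mat) :
    ⟪A, conjMat N B⟫ = ⟪conjMat N.transpose A, B⟫ := by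
  simp only [inner_mat, conjMat_apply, Matrix.transpose_apply, Fin.sum_univ_two]
  ring

theorem conjMat_conjMat {N N' : Matrix (Fin 2) (Fin 2) ℝ} (h : N * N' = 1) (A : Mat) :
    conjMat N (conjMat N' A) = A := by
  have h00 := congrFun (congrFun h 0) 0
  have h01 := congrFun (congrFun h 0) 1
  have h10 := congrFun (congrFun h 1) 0
  have h11 := congrFun (congrFun h 1) 1
  simp only [Matrix.mul_apply, Fin.sum_univ_two, Matrix.one_apply_eq] at h00 h11
  rw [Matrix.one_apply_ne (by decide)] at h01 h10
  simp only [Matrix.mul_apply, Fin.sum_univ_two] at h01 h10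
  have key : ∀ i j, conjMat N (conjMat N' A) (i, j)
      = ∑ k, ∑ l, (N i 0 * N' 0 k + N i 1 * N' 1 k) * (N j 0 * N' 0 l + N j 1 * N' 1 l)
        * A (k, l) := by
    intro i j
    simp only [conjMat_apply, Fin.sum_univ_two]
    ring
  ext ⟨i, j⟩
  rw [key]
  fin_cases i <;> fin_cases j <;> simp [Fin.sum_univ_two, h00, h01, h10, h11]

/-- The congruence acting on square-integrable matrix fields. -/
def conjL2 {G : Set Pt} (N : Matrix (Fin 2) (Fin 2) ℝ) : L2Mat G →L[ℝ] L2Mat G :=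
  (conjMat N).compLpL 2 (volume.restrict G)

theorem coeFn_conjL2 {G : Set Pt} (N : Matrix (Fin 2) (Fin 2) ℝ) (Q : L2Mat G) :
    conjL2 N Q =ᵐ[volume.restrict G] fun x => conjMat N (Q x) :=
  (conjMat N).coeFn_compLpL Q

theorem norm_conjL2_le {G : Set Pt} (N : Matrix (Fin 2) (Fin 2) ℝ) (Q : L2Mat G) :
    ‖conjL2 N Q‖ ≤ frob N * ‖Q‖ :=
  (ContinuousLinearMap.le_opNorm _ _).trans (mul_le_mul_of_nonneg_right
    ((ContinuousLinearMap.norm_compLpL_le _).trans (norm_conjMat_le N)) (norm_nonneg _))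

theorem inner_conjL2 {G : Set Pt} (N : Matrix (Fin 2) (Fin 2) ℝ) (Q R : L2Mat G) :
    ⟪Q, conjL2 N R⟫ = ⟪conjL2 N.transpose Q, R⟫ := by
  rw [inner_eq_of_ae (EventuallyEq.refl _ Q) (coeFn_conjL2 N R),
    inner_eq_of_ae (coeFn_conjL2 N.transpose Q) (EventuallyEq.refl _ R)]
  simp only [inner_conjMat]

theorem conjL2_ae_eq {G : Set Pt} (N : Matrix (Fin 2) (Fin 2) ℝ) {Q : L2Mat G} {q : Pt → Mat}
    (h : Q =ᵐ[volume.restrict G] q) :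
    conjL2 N Q =ᵐ[volume.restrict G] fun x => conjMat N (q x) := by
  filter_upwards [coeFn_conjL2 N Q, h] with x h1 h2
  rw [h1, h2]

namespace AffEquiv

variable {G G' : Set Pt} (a : AffEquiv G G')

theorem pd_comp {f : Pt → ℝ} (hf : ContDiff ℝ ∞ f) (i : Fin 2) (x : Pt) :
    pd i (fun y => f (a.map y)) x = ∑ j, a.S j i * pd j f (a.map x) :=
  pd_comp_aff hf a.S a.b i x

theorem pd_pd_comp {f : Pt → ℝ} (hf : ContDiff ℝ ∞ f) (i j : Fin 2) (x : Pt) :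
    pd i (pd j fun y => f (a.map y)) x
      = ∑ k, ∑ l, a.S k i * a.S l j * pd k (pd l f) (a.map x) := by
  have h : pd j (fun y => f (a.map y)) = fun y => ∑ l, a.S l j * pd l f (a.map y) :=
    funext fun y => a.pd_comp hf j y
  have hc : ∀ l, ContDiff ℝ ∞ fun y => pd l f (a.map y) := fun l =>
    (contDiff_pd hf l).comp a.contDiff_map
  rw [h, pd_sum _ fun l => contDiff_const.mul (hc l)]
  simp only [pd_const_mul, a.pd_comp (contDiff_pd hf _), Fin.sum_univ_two]
  ring

/-- The transported matrix field. -/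
def pullField (q : Pt → Mat) (x : Pt) : Mat := conjMat a.S' (q (a.map x))

theorem contDiff_pullField {q : Pt → Mat} (hq : ContDiff ℝ ∞ q) :
    ContDiff ℝ ∞ (a.pullField q) :=
  (conjMat a.S').contDiff.comp (hq.comp a.contDiff_map)

theorem pullField_symm {q : Pt → Mat} (sq : ∀ x i j, q x (i, j) = q x (j, i)) (x : Pt)
    (i j : Fin 2) : a.pullField q x (i, j) = a.pullField q x (j, i) := by
  simp only [pullField, conjMat_apply, Fin.sum_univ_two, sq _ 1 0]
  ring

/-- The chain rule produces one factor `S` for each derivative, and the two factors `S'` in the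
congruence cancel them. The congruence is chosen for this: no geometric factor is left in `div Div`.
-/
theorem divDiv_pullField {q : Pt → Mat} (hq : ContDiff ℝ ∞ q) (x : Pt) :
    divDiv (a.pullField q) x = divDiv q (a.map x) := by
  have hc : ∀ k l, ContDiff ℝ ∞ fun y => q (a.map y) (k, l) := fun k l =>
    (contDiff_entry hq (k, l)).comp a.contDiff_map
  have h1 : ∀ i j, pd i (pd j fun y => a.pullField q y (i, j)) x
      = ∑ k, ∑ l, a.S' i k * a.S' j l * ∑ m, ∑ n, a.S m i * a.S n j *
        pd m (pd n fun y => q y (k, l)) (a.map x) := by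
    intro i j
    have e1 : ∀ y, pd j (fun y => a.pullField q y (i, j)) y
        = ∑ k, ∑ l, a.S' i k * a.S' j l * pd j (fun y => q (a.map y) (k, l)) y := by
      intro y
      simp only [pullField, conjMat_apply]
      rw [pd_sum _ fun k => ContDiff.sum fun l _ => contDiff_const.mul (hc k l)]
      refine Finset.sum_congr rfl fun k _ => ?_
      rw [pd_sum _ fun l => contDiff_const.mul (hc k l)]
      exact Finset.sum_congr rfl fun l _ => pd_const_mul _ _ _
    rw [funext e1, pd_sum _ fun k => ContDiff.sum fun l _ =>
      contDiff_const.mul (contDiff_pd (hc k l) j)]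
    refine Finset.sum_congr rfl fun k _ => ?_
    rw [pd_sum _ fun l => contDiff_const.mul (contDiff_pd (hc k l) j)]
    refine Finset.sum_congr rfl fun l _ => ?_
    rw [pd_const_mul, a.pd_pd_comp (contDiff_entry hq (k, l))]
  have hI : ∀ m k, ∑ i, a.S m i * a.S' i k = if m = k then 1 else 0 := fun m k => by
    rw [← Matrix.mul_apply, a.mul_inv, Matrix.one_apply]
  have h2 : divDiv (a.pullField q) x = ∑ k, ∑ l, ∑ m, ∑ n,
      (∑ i, a.S m i * a.S' i k) * (∑ j, a.S n j * a.S' j l) *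
        pd m (pd n fun y => q y (k, l)) (a.map x) := by
    simp only [divDiv, h1, Fin.sum_univ_two]
    ring
  rw [h2]
  simp only [hI, divDiv]
  simp

/-- Transport of pairs `(Q, div Div Q)`. -/
def pullGraph : WithLp 2 (L2Mat G' × L2 G') →L[ℝ] WithLp 2 (L2Mat G × L2 G) :=
  ((WithLp.prodContinuousLinearEquiv 2 ℝ (L2Mat G) (L2 G)).symm :
    (L2Mat G × L2 G) →L[ℝ] WithLp 2 (L2Mat G × L2 G)).comp
    ((((conjL2 a.S').comp a.comp).comp (WithLp.fstL 2 ℝ (L2Mat G') (L2 G'))).prod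
      (a.comp.comp (WithLp.sndL 2 ℝ (L2Mat G') (L2 G'))))

theorem pullGraph_ae {z : WithLp 2 (L2Mat G' × L2 G')} {q : Pt → Mat} (hq : ContDiff ℝ ∞ q)
    (h1 : z.fst =ᵐ[volume.restrict G'] q) (h2 : z.snd =ᵐ[volume.restrict G'] divDiv q) :
    (a.pullGraph z).fst =ᵐ[volume.restrict G] a.pullField q ∧
      (a.pullGraph z).snd =ᵐ[volume.restrict G] divDiv (a.pullField q) := by
  constructor
  · exact conjL2_ae_eq _ (a.comp_ae_eq h1)
  · rw [funext (a.divDiv_pullField hq)]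
    exact a.comp_ae_eq h2

theorem pullGraph_mem {z : WithLp 2 (L2Mat G' × L2 G')} (hz : z ∈ HdDiv G') :
    a.pullGraph z ∈ HdDiv G := by
  refine map_mem_closure a.pullGraph.continuous hz ?_
  rintro z ⟨q, hq, sq, h1, h2⟩
  obtain ⟨k1, k2⟩ := a.pullGraph_ae hq h1 h2
  exact ⟨a.pullField q, a.contDiff_pullField hq, a.pullField_symm sq, k1, k2⟩

/-- Transport of `H(div Div)`. -/
def pull : HdDiv G' →L[ℝ] HdDiv G :=
  (a.pullGraph.comp (HdDiv G').subtypeL).codRestrict (HdDiv G) fun Q => a.pullGraph_mem Q.2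

theorem field_pull (Q : HdDiv G') : field (a.pull Q) = conjL2 a.S' (a.comp (field Q)) := rfl

theorem isRep_pull {Q : HdDiv G'} {q : Pt → Mat} (h : IsRep Q q) :
    IsRep (a.pull Q) (a.pullField q) := by
  obtain ⟨k1, k2⟩ := a.pullGraph_ae h.smooth h.field_eq h.dDiv_eq
  exact ⟨a.contDiff_pullField h.smooth, a.pullField_symm h.symm, k1, k2⟩

theorem pull_mem_PolyRep {r : ℕ} {Q : HdDiv G'} (h : Q ∈ PolyRep r G') :
    a.pull Q ∈ PolyRep r G := by
  obtain ⟨q, hq, hp⟩ := h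
  refine ⟨_, a.isRep_pull hq, fun ij => ?_⟩
  have h : IsPoly r fun x => ∑ k, ∑ l, a.S' ij.1 k * a.S' ij.2 l * q (a.map x) (k, l) :=
    IsPoly.sum _ fun k _ => IsPoly.sum _ fun l _ => ((hp (k, l)).comp_aff a.S a.b).const_mul _
  exact h

theorem comp_conjL2 (N : Matrix (Fin 2) (Fin 2) ℝ) (Q : L2Mat G') :
    a.comp (conjL2 N Q) = conjL2 N (a.comp Q) := by
  apply Lp.ext
  exact (a.comp_ae_eq (coeFn_conjL2 N Q)).trans (conjL2_ae_eq N (a.coeFn_comp Q)).symm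

theorem conjL2_conjL2 {N N' : Matrix (Fin 2) (Fin 2) ℝ} (h : N * N' = 1) (Q : L2Mat G) :
    conjL2 N (conjL2 N' Q) = Q := by
  apply Lp.ext
  filter_upwards [conjL2_ae_eq N (coeFn_conjL2 N' Q)] with x hx
  rw [hx, conjMat_conjMat h]

theorem symm_pull_pull (Q : HdDiv G') : a.symm.pull (a.pull Q) = Q := by
  apply Subtype.ext
  apply (WithLp.equiv 2 _).injective
  refine Prod.ext ?_ ?_
  · change conjL2 a.S (a.symm.comp (conjL2 a.S' (a.comp (field Q)))) = field Q
    rw [comp_conjL2, conjL2_conjL2 a.mul_inv, symm_comp_comp]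
  · exact a.symm_comp_comp _

theorem norm_field_pull_le (Q : HdDiv G') :
    ‖field (a.pull Q)‖ ≤ frob a.S' * (√a.jac * ‖field Q‖) := by
  rw [field_pull, ← norm_comp]
  exact norm_conjL2_le _ _

theorem norm_dDiv_pull (Q : HdDiv G') : ‖dDiv (a.pull Q)‖ = √a.jac * ‖dDiv Q‖ := a.norm_comp _

/-- Transport of jets. -/
def pullJet : Jet G' →L[ℝ] Jet G :=
  (a.comp.comp (ContinuousLinearMap.fst ℝ _ _)).prod
    ((ContinuousLinearMap.pi fun i => ∑ j, a.S j i • a.comp.comp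
      ((ContinuousLinearMap.proj j).comp ((ContinuousLinearMap.fst ℝ _ _).comp
        (ContinuousLinearMap.snd ℝ _ _)))).prod
    (((conjL2 a.S.transpose).comp a.comp).comp
      ((ContinuousLinearMap.snd ℝ _ _).comp (ContinuousLinearMap.snd ℝ _ _))))

theorem pullJet_grad (z : Jet G') (i : Fin 2) :
    (a.pullJet z).2.1 i = ∑ j, a.S j i • a.comp (z.2.1 j) := by
  simp [pullJet]

theorem pullJet_grad_ae {z : Jet G'} {φ : Pt → ℝ} (hφ : ContDiff ℝ ∞ φ)
    (h : ∀ i, z.2.1 i =ᵐ[volume.restrict G'] pd i φ) (i : Fin 2) :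
    (a.pullJet z).2.1 i =ᵐ[volume.restrict G] pd i fun y => φ (a.map y) := by
  rw [pullJet_grad, Fin.sum_univ_two, funext (a.pd_comp hφ i)]
  filter_upwards [Lp.coeFn_add (a.S 0 i • a.comp (z.2.1 0)) (a.S 1 i • a.comp (z.2.1 1)),
    Lp.coeFn_smul (a.S 0 i) (a.comp (z.2.1 0)), Lp.coeFn_smul (a.S 1 i) (a.comp (z.2.1 1)),
    a.comp_ae_eq (h 0), a.comp_ae_eq (h 1)] with x h1 h2 h3 h4 h5
  rw [h1, Pi.add_apply, h2, h3, Pi.smul_apply, Pi.smul_apply, h4, h5, Fin.sum_univ_two,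
    smul_eq_mul, smul_eq_mul]

theorem pullJet_hess_ae {z : Jet G'} {φ : Pt → ℝ} (hφ : ContDiff ℝ ∞ φ)
    (h : z.2.2 =ᵐ[volume.restrict G'] hess φ) :
    (a.pullJet z).2.2 =ᵐ[volume.restrict G] hess fun y => φ (a.map y) := by
  refine (conjL2_ae_eq a.S.transpose (a.comp_ae_eq h)).trans (ae_of_all _ fun x => ?_)
  ext ⟨i, j⟩
  simp only [conjMat_apply, hess, a.pd_pd_comp hφ, Matrix.transpose_apply, Fin.sum_univ_two]
  ring

/-- Transport of the trace functional. -/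
theorem jetTrace_symm_pull (z : Jet G') (Q : HdDiv G) :
    jetTrace G' z (a.symm.pull Q) = a.symm.jac * jetTrace G (a.pullJet z) Q := by
  change ⟪z.1, a.symm.comp (dDiv Q)⟫ - ⟪z.2.2, conjL2 a.S (a.symm.comp (field Q))⟫
    = a.symm.jac * (⟪a.comp z.1, dDiv Q⟫ - ⟪conjL2 a.S.transpose (a.comp z.2.2), field Q⟫)
  rw [inner_conjL2, inner_symm_comp, inner_symm_comp, comp_conjL2]
  ring

theorem inner_field_symm_pull (M : L2Mat G') (Q : HdDiv G) :
    ⟪M, field (a.symm.pull Q)⟫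
      = a.symm.jac * ⟪conjL2 a.S.transpose (a.comp M), field Q⟫ := by
  change ⟪M, conjL2 a.S (a.symm.comp (field Q))⟫ = _
  rw [inner_conjL2, inner_symm_comp, comp_conjL2]

theorem inner_dDiv_symm_pull (u : L2 G') (Q : HdDiv G) :
    ⟪u, dDiv (a.symm.pull Q)⟫ = a.symm.jac * ⟪a.comp u, dDiv Q⟫ :=
  a.inner_symm_comp u (dDiv Q)

end AffEquiv

/-! ### The affine map from the reference triangle -/

/-- The matrix of the affine map from the reference triangle to the triangle with vertices `P`. -/
def refMatrix (P : Fin 3 → Pt) : Matrix (Fin 2) (Fin 2) ℝ :=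
  Matrix.of fun i j => (P j.succ - P 0) i

theorem refMatrix_apply (P : Fin 3 → Pt) (i j : Fin 2) :
    refMatrix P i j = P j.succ i - P 0 i := rfl

theorem det_refMatrix_ne_zero {P : Fin 3 → Pt} (hP : AffineIndependent ℝ P) :
    (refMatrix P).det ≠ 0 := by
  intro h
  obtain ⟨v, hv, h0⟩ := Matrix.exists_mulVec_eq_zero_iff.2 h
  have h1 := affineIndependent_iff.1 hP Finset.univ ![-(v 0 + v 1), v 0, v 1]
    (by simp [Fin.sum_univ_three]) (by
      ext i
      have := congrFun h0 i
      simp only [Matrix.mulVec, dotProduct, refMatrix_apply, Fin.sum_univ_two, Fin.succ_zero_eq_one,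
        Fin.succ_one_eq_two, Pi.zero_apply] at this
      simp [Fin.sum_univ_three]
      linarith)
  refine hv (funext fun i => ?_)
  fin_cases i
  · simpa using h1 1 (Finset.mem_univ _)
  · simpa using h1 2 (Finset.mem_univ _)

theorem aff_refMatrix_refVert (P : Fin 3 → Pt) (i : Fin 3) :
    aff (refMatrix P) (P 0) (refVert i) = P i := by
  ext k
  rw [aff_apply, Fin.sum_univ_two]
  fin_cases i <;> simp [refVert, refMatrix_apply]

theorem aff_image_closedTri (P : Fin 3 → Pt) :
    aff (refMatrix P) (P 0) '' closedTri refVert = closedTri P := by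
  let f : Pt →ᵃ[ℝ] Pt := (refMatrix P).toEuclideanLin.toAffineMap + AffineMap.const ℝ Pt (P 0)
  have hf : ∀ x, f x = aff (refMatrix P) (P 0) x := fun x => by simp [f, aff, add_comm]
  have h := f.image_convexHull (Set.range refVert)
  rw [funext hf, ← Set.range_comp] at h
  have e : aff (refMatrix P) (P 0) ∘ refVert = P := funext fun i => aff_refMatrix_refVert P i
  rw [e] at h
  exact h

/-- The affine map of the plane that carries the reference vertices to `P`. -/
def refPlane {P : Fin 3 → Pt} (hP : AffineIndependent ℝ P) :
    AffEquiv (Set.univ : Set Pt) Set.univ where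
  S := refMatrix P
  S' := (refMatrix P)⁻¹
  b := P 0
  mul_inv := Matrix.mul_nonsing_inv _ (det_refMatrix_ne_zero hP).isUnit
  meas := MeasurableSet.univ
  meas' := MeasurableSet.univ
  mem_iff _ := by simp

/-- The affine map from the reference triangle to the triangle with vertices `P`. -/
def refMap {P : Fin 3 → Pt} (hP : AffineIndependent ℝ P) : AffEquiv refTri (tri P) where
  S := refMatrix P
  S' := (refMatrix P)⁻¹
  b := P 0
  mul_inv := (refPlane hP).mul_inv
  meas := measurableSet_tri _
  meas' := measurableSet_tri _
  mem_iff x := by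
    let h : Pt ≃ₜ Pt :=
      { toFun := (refPlane hP).map
        invFun := (refPlane hP).symm.map
        left_inv := (refPlane hP).symm_map
        right_inv := (refPlane hP).map_symm
        continuous_toFun := (refPlane hP).contDiff_map.continuous
        continuous_invFun := (refPlane hP).symm.contDiff_map.continuous }
    have h1 : h '' refTri = tri P := by
      change h '' interior (closedTri refVert) = interior (closedTri P)
      rw [h.image_interior]
      congr 1
      exact aff_image_closedTri P
    rw [← h1]
    exact h.injective.mem_set_image

theorem refMap_S {P : Fin 3 → Pt} (hP : AffineIndependent ℝ P) :
    (refMap hP).S = refMatrix P := rfl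

theorem refMap_refEdge {P : Fin 3 → Pt} (hP : AffineIndependent ℝ P) (e : Fin 3) (i : Fin 2) :
    ∑ j, (refMap hP).S i j * refEdge e j = (P (e + 1) - P e) i := by
  have h : ∀ k, P k i = P 0 i + ∑ j, refMatrix P i j * refVert k j := fun k => by
    rw [← aff_apply, aff_refMatrix_refVert]
  rw [refMap_S, PiLp.sub_apply, h (e + 1), h e]
  simp only [refEdge, Fin.sum_univ_two]
  ring

theorem refMap_edgePt {P : Fin 3 → Pt} (hP : AffineIndependent ℝ P) (e : Fin 3) (t : ℝ) :
    (refMap hP).map (edgePt refVert e t) = edgePt P e t := by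
  ext i
  have h1 := refMap_refEdge hP e i
  have h2 : P e i = P 0 i + ∑ j, refMatrix P i j * refVert e j := by
    rw [← aff_apply, aff_refMatrix_refVert]
  change aff (refMatrix P) (P 0) _ i = _
  rw [aff_apply]
  simp only [edgePt, PiLp.add_apply, PiLp.smul_apply, smul_eq_mul, ← h1, refMap_S]
  rw [h2]
  simp only [refEdge, PiLp.sub_apply, Fin.sum_univ_two]
  ring

/-! ### Transport of traces -/

/-- The direction on the reference triangle that corresponds to the normal to an edge. -/
def pullNormal {P : Fin 3 → Pt} (hP : AffineIndependent ℝ P) (e : Fin 3) (i : Fin 2) : ℝ :=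
  ∑ j, (refMap hP).S' i j * edgeNormal P e j

theorem normalDeriv_eq {P : Fin 3 → Pt} (hP : AffineIndependent ℝ P) {φ : Pt → ℝ}
    (hφ : ContDiff ℝ ∞ φ) (e : Fin 3) (t : ℝ) :
    normalDeriv P e φ t = ∑ i, pullNormal hP e i *
      pd i (fun y => φ ((refMap hP).map y)) (edgePt refVert e t) := by
  have hI : ∀ m k, ∑ i, (refMap hP).S m i * (refMap hP).S' i k = if m = k then 1 else 0 :=
    fun m k => by rw [← Matrix.mul_apply, (refMap hP).mul_inv, Matrix.one_apply]
  simp only [normalDeriv, pullNormal, (refMap hP).pd_comp hφ, refMap_edgePt]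
  have h : ∑ i, (∑ j, (refMap hP).S' i j * edgeNormal P e j) *
      ∑ k, (refMap hP).S k i * pd k φ (edgePt P e t)
      = ∑ j, ∑ k, (∑ i, (refMap hP).S k i * (refMap hP).S' i j) * (edgeNormal P e j *
        pd k φ (edgePt P e t)) := by
    simp only [Fin.sum_univ_two]
    ring
  rw [h]
  simp only [hI]
  simp

/-- The affine map sends the two vectors to the unit normal and the edge vector of `P`, which are
orthogonal and nonzero. Derivatives in these two directions therefore determine the whole gradient
on the reference edge. -/
theorem pullNormal_refEdge_ne_zero {P : Fin 3 → Pt} (hP : AffineIndependent ℝ P) (e : Fin 3) :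
    pullNormal hP e 0 * refEdge e 1 - pullNormal hP e 1 * refEdge e 0 ≠ 0 := by
  intro h
  have hI : ∀ m k, ∑ i, (refMap hP).S m i * (refMap hP).S' i k = if m = k then 1 else 0 :=
    fun m k => by rw [← Matrix.mul_apply, (refMap hP).mul_inv, Matrix.one_apply]
  have hn : ∀ m, ∑ i, (refMap hP).S m i * pullNormal hP e i = edgeNormal P e m := by
    intro m
    have h1 : ∑ i, (refMap hP).S m i * pullNormal hP e i
        = ∑ k, (∑ i, (refMap hP).S m i * (refMap hP).S' i k) * edgeNormal P e k := by
      simp only [pullNormal, Fin.sum_univ_two]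
      ring
    rw [h1]
    simp only [hI]
    simp
  have hd := refMap_refEdge hP e
  have hne : P (e + 1) - P e ≠ 0 := sub_ne_zero.2 fun h => by
    have hne' : ∀ e : Fin 3, e + 1 ≠ e := by decide
    exact hne' e (hP.injective h)
  have n0 := hn 0
  have n1 := hn 1
  have d0 := hd 0
  have d1 := hd 1
  have hdet : edgeNormal P e 0 * (P (e + 1) - P e) 1 - edgeNormal P e 1 * (P (e + 1) - P e) 0
      = 0 := by
    rw [← n0, ← n1, ← d0, ← d1]
    simp only [Fin.sum_univ_two]
    -- The determinant of the two image vectors is `det S` times that of the two original ones.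
    linear_combination ((refMap hP).S 0 0 * (refMap hP).S 1 1
      - (refMap hP).S 0 1 * (refMap hP).S 1 0) * h
  have hnorm := EuclideanSpace.real_norm_sq_eq (P (e + 1) - P e)
  rw [Fin.sum_univ_two] at hnorm
  have hpos : 0 < ‖P (e + 1) - P e‖ := norm_pos_iff.2 hne
  have hval : edgeNormal P e 0 * (P (e + 1) - P e) 1 - edgeNormal P e 1 * (P (e + 1) - P e) 0
      = ‖P (e + 1) - P e‖⁻¹ * ‖P (e + 1) - P e‖ ^ 2 := by
    rw [hnorm]
    simp only [edgeNormal, PiLp.smul_apply, smul_eq_mul]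
    simp
    ring
  rw [hval] at hdet
  have : 0 < ‖P (e + 1) - P e‖⁻¹ * ‖P (e + 1) - P e‖ ^ 2 := by positivity
  exact this.ne' hdet

/-- Under the affine map the normal derivative becomes an oblique derivative along `pullNormal`,
which is why the full gradient trace is recorded on the reference triangle. -/
theorem refGraph_of_smooth {P : Fin 3 → Pt} (hP : AffineIndependent ℝ P)
    {z : Jet (tri P) × (Fin 3 → L2I) × (Fin 3 → L2I)} (hz : z ∈ smoothTraceGraph P) :
    ∃ G : Fin 3 → Fin 2 → L2I, ((refMap hP).pullJet z.1, z.2.1, G) ∈ refGraph ∧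
      ∀ e, z.2.2 e = ∑ i, pullNormal hP e i • G e i := by
  obtain ⟨φ, hφ, h1, h2, h3, h4, h5⟩ := hz
  have hφa : ContDiff ℝ ∞ fun y => φ ((refMap hP).map y) := hφ.comp (refMap hP).contDiff_map
  have hc : ∀ e i, Continuous fun t =>
      pd i (fun y => φ ((refMap hP).map y)) (edgePt refVert e t) := fun e i =>
    (contDiff_pd hφa i).continuous.comp (contDiff_edgePt _ _).continuous
  refine ⟨fun e i => toL2I _ (hc e i), ⟨_, hφa, (refMap hP).comp_ae_eq h1,
    (refMap hP).pullJet_grad_ae hφ h2, (refMap hP).pullJet_hess_ae hφ h3, fun e => ?_,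
    fun e i => coeFn_toL2I (hc e i)⟩, fun e => ?_⟩
  · simp only [refMap_edgePt]
    exact h4 e
  · apply Lp.ext
    rw [Fin.sum_univ_two]
    filter_upwards [h5 e, Lp.coeFn_add (pullNormal hP e 0 • toL2I _ (hc e 0))
      (pullNormal hP e 1 • toL2I _ (hc e 1)), Lp.coeFn_smul (pullNormal hP e 0) (toL2I _ (hc e 0)),
      Lp.coeFn_smul (pullNormal hP e 1) (toL2I _ (hc e 1)), coeFn_toL2I (hc e 0),
      coeFn_toL2I (hc e 1)] with t k1 k2 k3 k4 k5 k6
    rw [k1, k2, Pi.add_apply, k3, k4, Pi.smul_apply, Pi.smul_apply, k5, k6, normalDeriv_eq hP hφ,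
      Fin.sum_univ_two, smul_eq_mul, smul_eq_mul]

/-- Membership in `traceGraph` provides convergence of jets, traces and normal derivatives only. The
full gradient traces on the reference triangle converge as well, since `norm_gradTrace_le` makes
them Cauchy sequences. -/
theorem exists_refTrace {P : Fin 3 → Pt} (hP : AffineIndependent ℝ P)
    {z : Jet (tri P) × (Fin 3 → L2I) × (Fin 3 → L2I)} (hz : z ∈ traceGraph P) :
    ∃ G : Fin 3 → Fin 2 → L2I,
      ((refMap hP).pullJet z.1, z.2.1, G) ∈ refGraph.topologicalClosure ∧
      ∀ e, z.2.2 e = ∑ i, pullNormal hP e i • G e i := by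
  obtain ⟨x, hx, hlim⟩ := mem_closure_iff_seq_limit.1 hz
  choose G hG hN using fun n => refGraph_of_smooth hP (hx n)
  obtain ⟨K, hK⟩ := norm_gradTrace_le
  have hJ : Tendsto (fun n => (refMap hP).pullJet (x n).1) atTop (𝓝 ((refMap hP).pullJet z.1)) :=
    ((refMap hP).pullJet.continuous.tendsto _).comp ((continuous_fst.tendsto z).comp hlim)
  have hdist : ∀ e i n m, dist (G n e i) (G m e i)
      ≤ K * dist ((refMap hP).pullJet (x n).1) ((refMap hP).pullJet (x m).1) := by
    intro e i n m
    rw [dist_eq_norm, dist_eq_norm]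
    exact hK _ (refGraph.sub_mem (hG n) (hG m)) e i
  have hC : ∀ e i, ∃ L, Tendsto (fun n => G n e i) atTop (𝓝 L) := by
    intro e i
    refine cauchySeq_tendsto_of_complete (Metric.cauchySeq_iff.2 fun ε hε => ?_)
    -- The sign of `K` is not known, so `|K| + 1` serves as a positive divisor.
    obtain ⟨N, hN⟩ := Metric.cauchySeq_iff.1 hJ.cauchySeq (ε / (|K| + 1)) (by positivity)
    refine ⟨N, fun m hm n hn => (hdist e i m n).trans_lt ?_⟩
    have h1 := hN m hm n hn
    rw [lt_div_iff₀ (by positivity)] at h1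
    have h2 := mul_le_mul_of_nonneg_right (le_abs_self K)
      (dist_nonneg (x := (refMap hP).pullJet (x m).1) (y := (refMap hP).pullJet (x n).1))
    nlinarith [dist_nonneg (x := (refMap hP).pullJet (x m).1)
      (y := (refMap hP).pullJet (x n).1)]
  choose L hL using hC
  have h21 : Tendsto (fun n => (x n).2.1) atTop (𝓝 z.2.1) :=
    ((continuous_fst.comp continuous_snd).tendsto z).comp hlim
  have h22 : Tendsto (fun n => (x n).2.2) atTop (𝓝 z.2.2) :=
    ((continuous_snd.comp continuous_snd).tendsto z).comp hlim
  refine ⟨L, ?_, fun e => ?_⟩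
  · refine mem_closure_of_tendsto (hJ.prodMk_nhds (h21.prodMk_nhds
      (tendsto_pi_nhds.2 fun e => tendsto_pi_nhds.2 fun i => hL e i))) ?_
    exact Eventually.of_forall fun n => hG n
  · refine tendsto_nhds_unique (tendsto_pi_nhds.1 h22 e) ?_
    simp only [hN]
    exact tendsto_finsetSum _ fun i _ => (hL e i).const_smul _

/-! ### The transported functionals -/

theorem IsPoly.exists_eq_const {f : Pt → ℝ} (hf : IsPoly 0 f) : ∃ c, ∀ x, f x = c := by
  obtain ⟨P, hP, h⟩ := hf
  rw [Nat.le_zero, MvPolynomial.totalDegree_eq_zero_iff_eq_C] at hP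
  exact ⟨P.coeff 0, fun x => by rw [h, hP]; simp⟩

theorem IsPoly.exists_edge {d : ℕ} {f : Pt → ℝ} (hf : IsPoly d f) (e : Fin 3) :
    ∃ p : Polynomial ℝ, p.natDegree ≤ d ∧ ∀ t, f (edgePt refVert e t) = p.eval t := by
  obtain ⟨s, c, hs, h⟩ := hf.exists_eq_sum
  let l : Fin 2 → Polynomial ℝ := fun i =>
    Polynomial.C (refEdge e i) * Polynomial.X + Polynomial.C (refVert e i)
  have hl : ∀ i n, (l i ^ n).natDegree ≤ n := fun i n =>
    (Polynomial.natDegree_pow_le_of_le n Polynomial.natDegree_linear_le).trans (mul_one n).le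
  refine ⟨∑ m ∈ s, Polynomial.C (c m) * (l 0 ^ m 0 * l 1 ^ m 1), ?_, fun t => ?_⟩
  · refine Polynomial.natDegree_sum_le_of_forall_le s _ fun m hm => ?_
    refine (Polynomial.natDegree_C_mul_le _ _).trans (Polynomial.natDegree_mul_le.trans ?_)
    exact (add_le_add (hl 0 _) (hl 1 _)).trans (hs m hm)
  · have he : ∀ i, edgePt refVert e t i = (l i).eval t := fun i => by
      simp [l, edgePt, refEdge]
      ring
    rw [h, Polynomial.eval_finsetSum]
    simp [he]

theorem jetTrace_mem_RefDual {z : RefTrace} (hz : z ∈ refGraph.topologicalClosure)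
    {a : Fin 3 → Polynomial ℝ} {c : Fin 3 → Fin 2 → Polynomial ℝ}
    (da : ∀ e, (a e).natDegree ≤ 3) (dc : ∀ e j, (c e j).natDegree ≤ 2)
    (ha : ∀ e, z.2.1 e =ᵐ[volume.restrict (Set.Icc (0 : ℝ) 1)] fun t => (a e).eval t)
    (hc : ∀ e j, z.2.2 e j =ᵐ[volume.restrict (Set.Icc (0 : ℝ) 1)] fun t => (c e j).eval t) :
    jetTrace refTri z.1 ∈ RefDual := by
  refine ⟨a, c, 0, da, dc, fun Q q h => ?_⟩
  change ⟪z.1.1, dDiv Q⟫ - ⟪z.1.2.2, field Q⟫ = _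
  rw [green_closure hz h.smooth h.symm h.field_eq h.dDiv_eq, boundaryForm]
  simp only [inner_zero_left, integral_zero, add_zero]
  refine Finset.sum_congr rfl fun e _ => ?_
  congr 1
  · refine integral_congr_ae ?_
    filter_upwards [ha e] with t ht
    rw [ht]
  · refine Finset.sum_congr rfl fun j _ => integral_congr_ae ?_
    filter_upwards [hc e j] with t ht
    rw [ht]

/-- Cramer's rule. The coefficients are constants, so the solution has the degree of the data. -/
theorem exists_polynomial_solve {τ w : Fin 2 → ℝ} (hD : w 0 * τ 1 - w 1 * τ 0 ≠ 0)
    {p r : Polynomial ℝ} {d : ℕ} (hp : p.natDegree ≤ d) (hr : r.natDegree ≤ d) :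
    ∃ c : Fin 2 → Polynomial ℝ, (∀ j, (c j).natDegree ≤ d) ∧ ∀ (x : Fin 2 → ℝ) (t : ℝ),
      ∑ i, τ i * x i = p.eval t → ∑ i, w i * x i = r.eval t → ∀ j, x j = (c j).eval t := by
  have d1 : ∀ (q q' : Polynomial ℝ) (y y' : ℝ), q.natDegree ≤ d → q'.natDegree ≤ d →
      (Polynomial.C y * q - Polynomial.C y' * q').natDegree ≤ d := fun q q' y y' h h' =>
    (Polynomial.natDegree_sub_le _ _).trans (max_le ((Polynomial.natDegree_C_mul_le _ _).trans h)
      ((Polynomial.natDegree_C_mul_le _ _).trans h'))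
  obtain ⟨E, hE⟩ : ∃ E, (w 0 * τ 1 - w 1 * τ 0) * E = 1 := ⟨_, mul_inv_cancel₀ hD⟩
  refine ⟨![Polynomial.C (E * τ 1) * r - Polynomial.C (E * w 1) * p,
    Polynomial.C (E * w 0) * p - Polynomial.C (E * τ 0) * r], fun j => ?_, fun x t h1 h2 j => ?_⟩
  · fin_cases j
    · exact d1 _ _ _ _ hr hp
    · exact d1 _ _ _ _ hp hr
  · rw [Fin.sum_univ_two] at h1 h2
    fin_cases j
    · change x 0 = Polynomial.eval t (_ * r - _ * p)
      rw [Polynomial.eval_sub, Polynomial.eval_mul, Polynomial.eval_mul, Polynomial.eval_C,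
        Polynomial.eval_C, ← h1, ← h2]
      linear_combination -x 0 * hE
    · change x 1 = Polynomial.eval t (_ * p - _ * r)
      rw [Polynomial.eval_sub, Polynomial.eval_mul, Polynomial.eval_mul, Polynomial.eval_C,
        Polynomial.eval_C, ← h1, ← h2]
      linear_combination -x 1 * hE

/-- The tangential derivative of a cubic trace is quadratic, and so is the oblique derivative along
`w`. As the two directions are independent, both components of the gradient are quadratic on every
edge, and Green's formula has the form required by `RefDual`. -/
theorem jetTrace_mem_RefDual_of_normal {w : Fin 3 → Fin 2 → ℝ}
    (hD : ∀ e, w e 0 * refEdge e 1 - w e 1 * refEdge e 0 ≠ 0) {z : RefTrace}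
    (hz : z ∈ refGraph.topologicalClosure) (h0 : ∀ e, z.2.1 e ∈ EdgePoly 3)
    (h1 : ∀ e, ∑ i, w e i • z.2.2 e i ∈ EdgePoly 2) : jetTrace refTri z.1 ∈ RefDual := by
  choose p dp hp0 using h0
  choose r dr hr using h1
  choose c dc hc using fun e => exists_polynomial_solve (hD e)
    ((Polynomial.natDegree_derivative_le _).trans (Nat.sub_le_sub_right (dp e) 1)) (dr e)
  refine jetTrace_mem_RefDual hz dp dc hp0 fun e j => ?_
  have h1 := tangential_eq_derivative hz e (hp0 e)
  have h3 := hr e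
  rw [Fin.sum_univ_two] at h3
  filter_upwards [h1, h3, Lp.coeFn_add (w e 0 • z.2.2 e 0) (w e 1 • z.2.2 e 1),
    Lp.coeFn_smul (w e 0) (z.2.2 e 0), Lp.coeFn_smul (w e 1) (z.2.2 e 1)]
    with t k1 k2 k3 k4 k5
  refine hc e (fun i => z.2.2 e i t) t k1 ?_ j
  rw [Fin.sum_univ_two, ← k2, k3, Pi.add_apply, k4, k5]
  rfl

theorem EdgePoly_mono {r s : ℕ} (h : r ≤ s) : EdgePoly r ≤ EdgePoly s :=
  fun _ ⟨p, hp, hg⟩ => ⟨p, hp.trans h, hg⟩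

theorem jetTrace_pullJet_mem_RefDual {P : Fin 3 → Pt} (hP : AffineIndependent ℝ P)
    {v : H2 (tri P)} (hv : v ∈ ULoc P) :
    jetTrace refTri ((refMap hP).pullJet v.1) ∈ RefDual := by
  obtain ⟨g₀, g₁, hg, hp⟩ := hv.2
  obtain ⟨G, hG, hn⟩ := exists_refTrace hP hg
  refine jetTrace_mem_RefDual_of_normal (pullNormal_refEdge_ne_zero hP)
    (z := ((refMap hP).pullJet v.1, g₀, G)) hG (fun e => (hp e).1) fun e => ?_
  have h := EdgePoly_mono one_le_two (hp e).2
  rw [show g₁ e = _ from hn e] at h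
  exact h

/-- Green's formula again, with polynomial `u` of degree two: its Hessian is constant, and the term
`(D²u, Q)` becomes the volume term of `boundaryForm`. -/
theorem innerSL_dDiv_mem_RefDual {u : L2 refTri} (hu : u ∈ Poly 2 refTri) :
    (innerSL ℝ u).comp dDiv ∈ RefDual := by
  obtain ⟨f, hf, hfu⟩ := exists_isPoly hu
  choose p dp hp using hf.exists_edge
  choose c dc hc using fun e j => ((hf.pd j).mono one_le_two).exists_edge e
  choose m hm using fun ij : Fin 2 × Fin 2 => ((hf.pd ij.1).pd ij.2).exists_eq_const
  have hM : hess f = fun _ => WithLp.toLp 2 m := by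
    funext x
    ext ij
    exact hm ij x
  refine ⟨p, c, WithLp.toLp 2 m, fun e => (dp e).trans (by norm_num), dc, fun Q q h => ?_⟩
  have hg := green_refTri hf.contDiff h.smooth h.symm
  change ⟪u, dDiv Q⟫ = _
  rw [inner_eq_of_ae hfu h.dDiv_eq, boundaryForm]
  simp only [inner_real]
  rw [hM] at hg
  simp only [hp, hc] at hg
  linarith

theorem innerSL_field_mem_RefDual {M : L2Mat refTri} (hM : ∀ ij, entry ij M ∈ Poly 0 refTri) :
    (innerSL ℝ M).comp field ∈ RefDual := by
  choose f hf hfM using fun ij => exists_isPoly (hM ij)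
  choose m hm using fun ij => (hf ij).exists_eq_const
  have h1 : M =ᵐ[volume.restrict refTri] fun _ => WithLp.toLp 2 m := by
    have h2 : ∀ ij, ∀ᵐ x ∂volume.restrict refTri, M x ij = m ij := fun ij => by
      filter_upwards [coeFn_entry ij M, hfM ij] with x k1 k2
      rw [← k1, k2, hm]
    filter_upwards [ae_all_iff.2 h2] with x hx
    exact PiLp.ext hx
  refine ⟨0, 0, WithLp.toLp 2 m, by simp, by simp, fun Q q h => ?_⟩
  change ⟪M, field Q⟫ = _
  rw [inner_eq_of_ae h1 h.field_eq]
  simp [boundaryForm]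

namespace AffEquiv

variable {G G' : Set Pt} (a : AffEquiv G G')

theorem comp_mem_Poly {r : ℕ} {u : L2 G'} (hu : u ∈ Poly r G') : a.comp u ∈ Poly r G := by
  obtain ⟨f, hf, h⟩ := exists_isPoly hu
  exact (hf.comp_aff a.S a.b).mem_Poly (a.comp_ae_eq h)

theorem entry_comp (ij : Fin 2 × Fin 2) (M : L2Mat G') :
    entry ij (a.comp M) = a.comp (entry ij M) := by
  apply Lp.ext
  filter_upwards [coeFn_entry ij (a.comp M), a.coeFn_comp M, a.comp_ae_eq (coeFn_entry ij M)]
    with x h1 h2 h3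
  rw [h1, h2, h3]

end AffEquiv

theorem entry_conjL2 {G : Set Pt} (N : Matrix (Fin 2) (Fin 2) ℝ) (M : L2Mat G) (i j : Fin 2) :
    entry (i, j) (conjL2 N M) = ∑ k, ∑ l, (N i k * N j l) • entry (k, l) M := by
  have hcomp : (EuclideanSpace.proj (i, j) : Mat →L[ℝ] ℝ).comp (conjMat N)
      = ∑ k, ∑ l, (N i k * N j l) • (EuclideanSpace.proj (k, l) : Mat →L[ℝ] ℝ) := by
    ext A
    simp [conjMat_apply]
  apply Lp.ext
  simp only [Fin.sum_univ_two]
  filter_upwards [coeFn_entry (i, j) (conjL2 N M), coeFn_conjL2 N M,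
    Lp.coeFn_add ((N i 0 * N j 0) • entry (0, 0) M + (N i 0 * N j 1) • entry (0, 1) M)
      ((N i 1 * N j 0) • entry (1, 0) M + (N i 1 * N j 1) • entry (1, 1) M),
    Lp.coeFn_add ((N i 0 * N j 0) • entry (0, 0) M) ((N i 0 * N j 1) • entry (0, 1) M),
    Lp.coeFn_add ((N i 1 * N j 0) • entry (1, 0) M) ((N i 1 * N j 1) • entry (1, 1) M),
    Lp.coeFn_smul (N i 0 * N j 0) (entry (0, 0) M), Lp.coeFn_smul (N i 0 * N j 1) (entry (0, 1) M),
    Lp.coeFn_smul (N i 1 * N j 0) (entry (1, 0) M), Lp.coeFn_smul (N i 1 * N j 1) (entry (1, 1) M),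
    coeFn_entry (0, 0) M, coeFn_entry (0, 1) M, coeFn_entry (1, 0) M, coeFn_entry (1, 1) M]
    with x h1 h2 h3 h4 h5 h6 h7 h8 h9 k1 k2 k3 k4
  rw [h1, h2, h3, Pi.add_apply, h4, h5, Pi.add_apply, Pi.add_apply, h6, h7, h8, h9]
  simp only [Pi.smul_apply, k1, k2, k3, k4, conjMat_apply, Fin.sum_univ_two, smul_eq_mul]

/-! ### The operator on one triangle -/

theorem norm_sq_HdDiv {G : Set Pt} (Q : HdDiv G) : ‖Q‖ ^ 2 = ‖field Q‖ ^ 2 + ‖dDiv Q‖ ^ 2 :=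
  WithLp.prod_norm_sq_eq_of_L2 (Q : WithLp 2 (L2Mat G × L2 G))

theorem norm_field_le {G : Set Pt} (Q : HdDiv G) : ‖field Q‖ ≤ ‖Q‖ :=
  le_of_sq_le_sq (by rw [norm_sq_HdDiv]; linarith [sq_nonneg ‖dDiv Q‖]) (norm_nonneg _)

theorem norm_dDiv_le {G : Set Pt} (Q : HdDiv G) : ‖dDiv Q‖ ≤ ‖Q‖ :=
  le_of_sq_le_sq (by rw [norm_sq_HdDiv]; linarith [sq_nonneg ‖field Q‖]) (norm_nonneg _)

theorem norm_HdDiv_le {G : Set Pt} (Q : HdDiv G) : ‖Q‖ ≤ ‖field Q‖ + ‖dDiv Q‖ :=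
  le_of_sq_le_sq (by
    rw [norm_sq_HdDiv]
    nlinarith [mul_nonneg (norm_nonneg (field Q)) (norm_nonneg (dDiv Q))]) (by positivity)

/-- The defining properties of the local operator `Π^{dDiv}` on a triangle. -/
structure IsLocalOperator (P : Fin 3 → Pt) (π : HdDiv (tri P) →L[ℝ] HdDiv (tri P)) : Prop where
  mem : ∀ Q, π Q ∈ PolyField 4 (tri P)
  trace : ∀ μ ∈ UHatLoc P, ∀ Q, μ (π Q) = μ Q
  dDiv : ∀ u ∈ Poly 2 (tri P), ∀ Q, ⟪u, dDiv (π Q)⟫ = ⟪u, dDiv Q⟫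
  moment : ∀ M : L2Mat (tri P), (∀ ij, entry ij M ∈ Poly 0 (tri P)) →
    ∀ Q, ⟪M, field (π Q)⟫ = ⟪M, field Q⟫
  norm_dDiv_le : ∀ Q, ‖DPG.dDiv (π Q)‖ ≤ ‖DPG.dDiv Q‖

/-- The two square roots of Jacobians cancel. The congruence costs `frob S'` on the way in and `frob
S` on the way out; `div Div` enters without congruence, so its contribution carries only `frob S`.
-/
theorem norm_field_transport_le {G G' : Set Pt} (a : AffEquiv G G') (π : HdDiv G →L[ℝ] HdDiv G)
    (Q : HdDiv G') : ‖field (a.symm.pull (π (a.pull Q)))‖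
      ≤ ‖π‖ * (frob a.S * frob a.S' * ‖field Q‖ + frob a.S * ‖dDiv Q‖) := by
  have hj : √a.symm.jac * √a.jac = 1 := by
    rw [← Real.sqrt_mul a.symm.jac_pos.le, mul_comm, a.jac_mul_jac_symm, Real.sqrt_one]
  have h1 : ‖field (π (a.pull Q))‖ ≤ ‖π‖ * (√a.jac * (frob a.S' * ‖field Q‖ + ‖dDiv Q‖)) := by
    refine (norm_field_le _).trans ((π.le_opNorm _).trans ?_)
    refine mul_le_mul_of_nonneg_left ((norm_HdDiv_le _).trans ?_) π.opNorm_nonneg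
    rw [a.norm_dDiv_pull]
    linarith [a.norm_field_pull_le Q]
  calc _ ≤ frob a.S * (√a.symm.jac * ‖field (π (a.pull Q))‖) := a.symm.norm_field_pull_le _
    _ ≤ frob a.S * (√a.symm.jac * (‖π‖ * (√a.jac * (frob a.S' * ‖field Q‖ + ‖dDiv Q‖)))) :=
      mul_le_mul_of_nonneg_left (mul_le_mul_of_nonneg_left h1 (Real.sqrt_nonneg _))
        (frob_nonneg _)
    _ = √a.symm.jac * √a.jac
          * (‖π‖ * (frob a.S * frob a.S' * ‖field Q‖ + frob a.S * ‖dDiv Q‖)) := by ring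
    _ = _ := by rw [hj, one_mul]

/-- The reference operator is conjugated with the transport. One reference operator serves all
triangles because the transported functionals always lie in the fixed space `RefDual`, so `K` does
not depend on `P`. -/
theorem exists_localOperator : ∃ K : ℝ, 0 ≤ K ∧ ∀ P : Fin 3 → Pt, ∀ hP : AffineIndependent ℝ P,
    ∃ π : HdDiv (tri P) →L[ℝ] HdDiv (tri P), IsLocalOperator P π ∧
      ∀ Q, ‖field (π Q)‖ ≤ K * (frob (refMap hP).S * frob (refMap hP).S' * ‖field Q‖
        + frob (refMap hP).S * ‖dDiv Q‖) := by
  obtain ⟨π₀, hmem, hπ⟩ := exists_refOperator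
  refine ⟨‖π₀‖, π₀.opNorm_nonneg, fun P hP => ?_⟩
  let a := refMap hP
  let π : HdDiv (tri P) →L[ℝ] HdDiv (tri P) := a.symm.pull.comp (π₀.comp a.pull)
  have hrep : ∀ Q, π Q ∈ PolyRep 4 (tri P) := fun Q => a.symm.pull_mem_PolyRep (hmem _)
  -- If `μ` pulls back to a multiple of a functional preserved by `π₀`, then `μ` is preserved by the
  -- conjugated operator, because every `Q` is `a.symm.pull (a.pull Q)`.
  have key : ∀ (μ : StrongDual ℝ (HdDiv (tri P))), ∀ ν ∈ RefDual, ∀ c : ℝ,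
      (∀ R, μ (a.symm.pull R) = c * ν R) → ∀ Q, μ (π Q) = μ Q := by
    intro μ ν hν c h Q
    have h1 := h (π₀ (a.pull Q))
    have h2 := h (a.pull Q)
    rw [a.symm_pull_pull] at h2
    rw [h2, ← hπ ν hν, ← h1]
    rfl
  have hd : ∀ u ∈ Poly 2 (tri P), ∀ Q, ⟪u, dDiv (π Q)⟫ = ⟪u, dDiv Q⟫ := fun u hu Q =>
    key ((innerSL ℝ u).comp dDiv) _ (innerSL_dDiv_mem_RefDual (a.comp_mem_Poly hu)) _
      (a.inner_dDiv_symm_pull u) Q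
  refine ⟨π, ⟨fun Q => PolyRep_le _ _ (hrep Q), ?_, hd, fun M hM Q => ?_, fun Q => ?_⟩,
    norm_field_transport_le a π₀⟩
  · rintro _ ⟨v, hv, rfl⟩ Q
    exact key _ _ (jetTrace_pullJet_mem_RefDual hP hv) _ (a.jetTrace_symm_pull v.1) Q
  · refine key ((innerSL ℝ M).comp field) _ (innerSL_field_mem_RefDual ?_) _
      (a.inner_field_symm_pull M) Q
    rintro ⟨i, j⟩
    rw [entry_conjL2]
    refine Submodule.sum_mem _ fun k _ => Submodule.sum_mem _ fun l _ =>
      Submodule.smul_mem _ _ ?_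
    rw [a.entry_comp]
    exact a.comp_mem_Poly (hM _)
  -- `dDiv (π Q)` is itself in `𝒫²` and may be used as test function: this gives `‖dDiv (π Q)‖² =
  -- ⟪dDiv (π Q), dDiv Q⟫`, and Cauchy–Schwarz concludes.
  · have h1 := hd _ (dDiv_mem_of_PolyRep (hrep Q)) Q
    rw [real_inner_self_eq_norm_sq] at h1
    have h2 := real_inner_le_norm (dDiv (π Q)) (dDiv Q)
    rw [← h1, sq] at h2
    rcases (norm_nonneg (dDiv (π Q))).eq_or_lt with h | h
    · rw [← h]
      exact norm_nonneg _
    · exact le_of_mul_le_mul_left h2 h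

/-! ### Shape regularity -/

theorem closure_tri {P : Fin 3 → Pt} (hP : AffineIndependent ℝ P) :
    closure (tri P) = closedTri P := by
  have hne : (interior (closedTri P)).Nonempty := by
    rw [closedTri, interior_convexHull_nonempty_iff_affineSpan_eq_top,
      hP.affineSpan_eq_top_iff_card_eq_finrank_add_one]
    simp
  have hc : Convex ℝ (closedTri P) := convex_convexHull ℝ _
  rw [tri, hc.closure_interior_eq_closure_of_nonempty_interior hne]
  exact (isCompact_closedTri P).isClosed.closure_eq

/-- The columns of the matrix are two edge vectors, each of length at most the diameter. The closure
enters because the vertices do not belong to the open triangle. -/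
theorem frob_refMatrix_le {P : Fin 3 → Pt} (hP : AffineIndependent ℝ P) :
    frob (refMatrix P) ≤ 2 * Metric.diam (tri P) ^ 2 := by
  have hd : ∀ i j, ‖P i - P j‖ ^ 2 ≤ Metric.diam (tri P) ^ 2 := fun i j => by
    refine pow_le_pow_left₀ (norm_nonneg _) ?_ 2
    rw [← Metric.diam_closure, closure_tri hP, ← dist_eq_norm]
    exact Metric.dist_le_diam_of_mem (isCompact_closedTri P).isBounded
      (subset_convexHull ℝ _ ⟨i, rfl⟩) (subset_convexHull ℝ _ ⟨j, rfl⟩)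
  have h1 := hd 1 0
  have h2 := hd 2 0
  rw [EuclideanSpace.real_norm_sq_eq, Fin.sum_univ_two] at h1 h2
  have h3 : frob (refMatrix P) = ((P 1 - P 0) 0 ^ 2 + (P 1 - P 0) 1 ^ 2)
      + ((P 2 - P 0) 0 ^ 2 + (P 2 - P 0) 1 ^ 2) := by
    simp only [frob, refMatrix, Matrix.of_apply, Fin.sum_univ_two, Fin.succ_zero_eq_one,
      Fin.succ_one_eq_two]
    ring
  linarith

/-- A `2 × 2` matrix and its adjugate have the same Frobenius norm, and the adjugate of `S'` is `det
S' • S`. -/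
theorem AffEquiv.frob_inv {G G' : Set Pt} (a : AffEquiv G G') :
    frob a.S' = a.jac ^ 2 * frob a.S := by
  have h : a.S'.adjugate = a.S'.det • a.S := by
    rw [← mul_one a.S'.adjugate, ← a.inv_mul, ← mul_assoc, Matrix.adjugate_mul, Matrix.smul_mul,
      one_mul]
  have h1 : frob a.S'.adjugate = frob a.S' := by
    rw [Matrix.adjugate_fin_two]
    simp [frob, Fin.sum_univ_two]
    ring
  rw [← h1, h, jac, sq_abs]
  simp only [frob, Matrix.smul_apply, smul_eq_mul, Fin.sum_univ_two]
  ring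

theorem AffEquiv.jac_mul_volume {G G' : Set Pt} (a : AffEquiv G G') :
    a.jac * volume.real G' = volume.real G := by
  have h := a.integral_comp fun _ => (1 : ℝ)
  simpa using h.symm

/-- By `AffEquiv.frob_inv` the product is the square of `jac * frob S`. Here `jac` is the ratio of
the areas of the reference triangle and of `tri P`, while `frob S ≤ 2 diam² ≤ 2κ |tri P|`; the area
of `tri P` cancels. -/
theorem frob_mul_frob_le {P : Fin 3 → Pt} (hP : AffineIndependent ℝ P) {κ : ℝ}
    (hκ : Metric.diam (tri P) ^ 2 ≤ κ * volume.real (tri P)) :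
    frob (refMap hP).S * frob (refMap hP).S' ≤ (2 * κ * volume.real refTri) ^ 2 := by
  have h1 : frob (refMap hP).S * (refMap hP).jac ≤ 2 * κ * volume.real refTri := by
    rw [← (refMap hP).jac_mul_volume]
    have := mul_le_mul_of_nonneg_right ((frob_refMatrix_le hP).trans
      (mul_le_mul_of_nonneg_left hκ zero_le_two)) (refMap hP).jac_pos.le
    rw [refMap_S]
    linarith
  have h2 := pow_le_pow_left₀ (mul_nonneg (frob_nonneg _) (refMap hP).jac_pos.le) h1 2
  rw [AffEquiv.frob_inv]
  linarith

theorem exists_localOperator_bound {Ω : Set Pt} (hΩ : Bornology.IsBounded Ω) (κ : ℝ) :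
    ∃ C : ℝ, 1 ≤ C ∧ ∀ P : Fin 3 → Pt, AffineIndependent ℝ P → tri P ⊆ Ω →
      Metric.diam (tri P) ^ 2 ≤ κ * volume.real (tri P) →
      ∃ π : HdDiv (tri P) →L[ℝ] HdDiv (tri P), IsLocalOperator P π ∧ ∀ Q, ‖π Q‖ ≤ C * ‖Q‖ := by
  obtain ⟨K, hK, h⟩ := exists_localOperator
  let α : ℝ := (2 * κ * volume.real refTri) ^ 2
  let β : ℝ := 2 * Metric.diam Ω ^ 2
  -- The summand `1` accounts for `div Div`. It also makes `C ≥ 1`, which is needed later for the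
  -- `L²` projection.
  refine ⟨K * (α + β) + 1, by
    have : 0 ≤ K * (α + β) := by positivity
    linarith, fun P hP hsub hκ => ?_⟩
  obtain ⟨π, hπ, hb⟩ := h P hP
  refine ⟨π, hπ, fun Q => ?_⟩
  have h1 : frob (refMap hP).S * frob (refMap hP).S' ≤ α := frob_mul_frob_le hP hκ
  have h2 : frob (refMap hP).S ≤ β := (frob_refMatrix_le hP).trans (mul_le_mul_of_nonneg_left
    (pow_le_pow_left₀ Metric.diam_nonneg (Metric.diam_mono hsub hΩ) 2) zero_le_two)
  have h3 : ‖field (π Q)‖ ≤ K * (α * ‖Q‖ + β * ‖Q‖) := (hb Q).trans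
    (mul_le_mul_of_nonneg_left (add_le_add
      (mul_le_mul h1 (norm_field_le Q) (norm_nonneg _) (by positivity))
      (mul_le_mul h2 (norm_dDiv_le Q) (norm_nonneg _) (by positivity))) hK)
  have h4 := (hπ.norm_dDiv_le Q).trans (norm_dDiv_le Q)
  linarith [norm_HdDiv_le (π Q)]

/-! ### The operator on the triangulation -/

section MeshOperator

variable {Ω : Set Pt} (𝒯 : Triangulation Ω)

/-- The operator on `H(div Div; 𝒯)` that acts triangle by triangle. -/
def meshOp (π : ∀ k, HdDiv (𝒯.cell k) →L[ℝ] HdDiv (𝒯.cell k)) : QSpace 𝒯 →ₗ[ℝ] QSpace 𝒯 where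
  toFun Q := WithLp.toLp 2 fun k => π k (Q k)
  map_add' Q R := by
    ext1 k
    exact map_add (π k) (Q k) (R k)
  map_smul' c Q := by
    ext1 k
    exact map_smul (π k) c (Q k)

theorem sum_extend (Q : QSpace 𝒯) : ∑ k, extend 𝒯 k (Q k) = Q := by
  let L := (PiLp.continuousLinearEquiv 2 ℝ (fun k : Fin 𝒯.n => HdDiv (𝒯.cell k))).symm
  have h : ∀ k, extend 𝒯 k (Q k) = L (Pi.single k (Q k)) := fun k => rfl
  simp only [h, ← map_sum]
  rw [Finset.univ_sum_single]
  rfl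

/-- A functional on the product is the sum of its restrictions to the factors, so the global trace
condition reduces to the local ones. -/
theorem apply_eq_sum (μ : StrongDual ℝ (QSpace 𝒯)) (Q : QSpace 𝒯) :
    μ Q = ∑ k, μ.comp (extend 𝒯 k) (Q k) := by
  have h := map_sum (μ : QSpace 𝒯 →ₗ[ℝ] ℝ) (fun k => extend 𝒯 k (Q k)) Finset.univ
  rw [sum_extend] at h
  exact h

theorem entry_restr {G : Set Pt} (h : G ⊆ Ω) (ij : Fin 2 × Fin 2) (M : L2Mat Ω) :
    entry ij (restr h M) = restr h (entry ij M) := by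
  apply Lp.ext
  filter_upwards [coeFn_entry ij (restr h M), coeFn_restr h M, coeFn_restr h (entry ij M),
    ae_mono (Measure.restrict_mono h le_rfl) (coeFn_entry ij M)] with x h1 h2 h3 h4
  rw [h1, h2, h3, h4]

theorem mem_PolyMeshSym {p : ℕ} {M : L2sym Ω} :
    M ∈ PolyMeshSym 𝒯 p ↔ ∀ ij, entry ij (M : L2Mat Ω) ∈ PolyMesh 𝒯 p := by
  simp only [PolyMeshSym, Submodule.mem_iInf, Submodule.mem_comap]
  rfl

theorem PolyMesh_mono {p r : ℕ} (h : p ≤ r) : PolyMesh 𝒯 p ≤ PolyMesh 𝒯 r := by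
  intro v hv
  rw [mem_PolyMesh] at hv ⊢
  intro k
  obtain ⟨f, hf, hk⟩ := exists_isPoly (hv k)
  exact (hf.mono h).mem_Poly hk

theorem isDDivOperator_meshOp {C : ℝ} (hC : 0 ≤ C)
    {π : ∀ k, HdDiv (𝒯.cell k) →L[ℝ] HdDiv (𝒯.cell k)}
    (hπ : ∀ k, IsLocalOperator (𝒯.vert k) (π k)) (hb : ∀ k Q, ‖π k Q‖ ≤ C * ‖Q‖) :
    IsDDivOperator 𝒯 C (meshOp 𝒯 π) where
  mem Q k ij := mem_PolyField.1 ((hπ k).mem (Q k)) ij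
  trace û hû Q := by
    rw [apply_eq_sum, apply_eq_sum 𝒯 _ Q]
    exact Finset.sum_congr rfl fun k _ => (hπ k).trace _ (hû k) (Q k)
  moment M hM Q := by
    refine Finset.sum_congr rfl fun k _ => (hπ k).moment _ (fun ij => ?_) (Q k)
    rw [entry_restr]
    exact (mem_PolyMesh 𝒯).1 ((mem_PolyMeshSym 𝒯).1 hM ij) k
  dDiv u hu Q := Finset.sum_congr rfl fun k _ =>
    (hπ k).dDiv _ ((mem_PolyMesh 𝒯).1 hu k) (Q k)
  bound Q := by
    refine le_of_sq_le_sq ?_ (mul_nonneg hC (norm_nonneg Q))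
    rw [mul_pow, PiLp.norm_sq_eq_of_L2, PiLp.norm_sq_eq_of_L2, Finset.mul_sum]
    refine Finset.sum_le_sum fun k _ => ?_
    rw [← mul_pow]
    exact pow_le_pow_left₀ (norm_nonneg _) (hb k (Q k)) 2

/-! ### The Fortin property -/

theorem finiteDimensional_QDisc : FiniteDimensional ℝ (QDisc 𝒯) := by
  have := fun k => finiteDimensional_PolyField 4 (G := 𝒯.cell k) isOpen_interior
  let f : QDisc 𝒯 →ₗ[ℝ] ∀ k : Fin 𝒯.n, PolyField 4 (𝒯.cell k) :=
    { toFun := fun Q k => ⟨(Q : QSpace 𝒯) k, mem_PolyField.2 (Q.2 k)⟩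
      map_add' := fun _ _ => rfl
      map_smul' := fun _ _ => rfl }
  have hfin : Module.Finite ℝ (∀ k : Fin 𝒯.n, PolyField 4 (𝒯.cell k)) := Module.Finite.pi
  -- A subspace of a finite-dimensional space is finite-dimensional; the injection `f` transfers
  -- this to `QDisc`.
  have : IsNoetherian ℝ (∀ k : Fin 𝒯.n, PolyField 4 (𝒯.cell k)) :=
    isNoetherian_of_isNoetherianRing_of_finite ℝ _
  refine Module.Finite.of_injective f fun Q R h => Subtype.ext (PiLp.ext fun k => ?_)
  exact congrArg Subtype.val (congrFun h k)

theorem finiteDimensional_VDisc (p : ℕ) : FiniteDimensional ℝ (VDisc 𝒯 p) := by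
  have h1 : (PolyMesh 𝒯 p).FG := Module.Finite.iff_fg.1 (finiteDimensional_PolyMesh 𝒯 p)
  have h2 : (QDisc 𝒯).FG := Module.Finite.iff_fg.1 (finiteDimensional_QDisc 𝒯)
  have h : VDisc 𝒯 p = ((PolyMesh 𝒯 p).prod (QDisc 𝒯)).map
      (WithLp.linearEquiv 2 ℝ (L2 Ω × QSpace 𝒯)).symm.toLinearMap :=
    Submodule.comap_equiv_eq_map_symm _ _
  rw [h]
  exact Module.Finite.iff_fg.2 ((h1.prod h2).map _)

/-! ### The coefficient term and the piecewise `L²` projection -/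

theorem ae_of_ae_cell {p : Pt → Prop} (h : ∀ k, ∀ᵐ x ∂volume.restrict (𝒯.cell k), p x) :
    ∀ᵐ x ∂volume.restrict Ω, p x := by
  have hall : ∀ᵐ x ∂volume.restrict (⋃ k, closedTri (𝒯.vert k)), p x := by
    refine (ae_restrict_iUnion_iff _ _).2 fun k => ?_
    rw [← restrict_tri]
    exact h k
  rw [𝒯.cover] at hall
  exact ae_mono (Measure.restrict_mono subset_closure le_rfl) hall

/-- Multiplication by a piecewise constant does not raise the degree. -/
theorem exists_mul_mem_PolyMesh {p : ℕ} {u v : L2 Ω} (hu : u ∈ PolyMesh 𝒯 0)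
    (hv : v ∈ PolyMesh 𝒯 p) :
    ∃ w ∈ PolyMesh 𝒯 p, w =ᵐ[volume.restrict Ω] fun x => u x * v x := by
  rw [mem_PolyMesh] at hu hv
  choose f hf hfu using fun k => exists_isPoly (hu k)
  choose g hg hgv using fun k => exists_isPoly (hv k)
  choose c hc using fun k => (hf k).exists_eq_const
  have hu' : ∀ k, ∀ᵐ x ∂volume.restrict (𝒯.cell k), u x = c k := fun k => by
    filter_upwards [coeFn_restr (𝒯.subset k) u, hfu k] with x h1 h2
    rw [← h1, h2, hc]
  -- A crude bound by the sum of the finitely many values of `|u|` suffices for square integrability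
  -- of the product.
  have hb : ∀ᵐ x ∂volume.restrict Ω, ‖u x * v x‖ ≤ (∑ k, |c k|) * ‖v x‖ := by
    refine ae_of_ae_cell 𝒯 fun k => ?_
    filter_upwards [hu' k] with x hx
    rw [norm_mul, hx]
    exact mul_le_mul_of_nonneg_right
      (Finset.single_le_sum (f := fun k => |c k|) (fun k _ => abs_nonneg _) (Finset.mem_univ k))
      (norm_nonneg _)
  have hw : MemLp (fun x => u x * v x) 2 (volume.restrict Ω) :=
    (Lp.memLp v).of_le_mul ((Lp.memLp u).1.mul (Lp.memLp v).1) hb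
  refine ⟨hw.toLp _, (mem_PolyMesh 𝒯).2 fun k => ((hg k).const_mul (c k)).mem_Poly ?_,
    hw.coeFn_toLp⟩
  filter_upwards [coeFn_restr (𝒯.subset k) (hw.toLp _), coeFn_restr (𝒯.subset k) v, hu' k, hgv k,
    ae_mono (Measure.restrict_mono (𝒯.subset k) le_rfl) hw.coeFn_toLp] with x h1 h2 h3 h4 h5
  rw [h1, h5, h3, ← h2, h4]

theorem integral_projPoly {p : ℕ} {w : L2 Ω} (hw : w ∈ PolyMesh 𝒯 p) {f : Pt → ℝ}
    (hf : w =ᵐ[volume.restrict Ω] f) (v : L2 Ω) :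
    ∫ x in Ω, f x * projPoly 𝒯 p v x = ∫ x in Ω, f x * v x := by
  have h : ∀ u : L2 Ω, ∫ x in Ω, f x * u x = ⟪w, u⟫ := fun u => by
    rw [inner_eq_of_ae hf (EventuallyEq.refl _ u)]
    simp only [inner_real]
  rw [h, h]
  change ⟪w, (PolyMesh 𝒯 p).starProjection v⟫ = _
  rw [← Submodule.inner_starProjection_left_eq_right, Submodule.starProjection_eq_self_iff.2 hw]

/-- The contraction `M : A` is represented by an element of `𝒫^p(𝒯)`, so it pairs equally with `v`
and with its projection. -/
theorem integral_contract_projPoly {p : ℕ} {M A : L2sym Ω} (hM : M ∈ PolyMeshSym 𝒯 0)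
    (hA : A ∈ PolyMeshSym 𝒯 p) (v : L2 Ω) :
    ∫ x in Ω, (∑ i, ∑ j, (M : L2Mat Ω) x (i, j) * (A : L2Mat Ω) x (i, j)) * projPoly 𝒯 p v x
      = ∫ x in Ω, (∑ i, ∑ j, (M : L2Mat Ω) x (i, j) * (A : L2Mat Ω) x (i, j)) * v x := by
  choose w hw hwf using fun ij => exists_mul_mem_PolyMesh 𝒯 ((mem_PolyMeshSym 𝒯).1 hM ij)
    ((mem_PolyMeshSym 𝒯).1 hA ij)
  refine integral_projPoly 𝒯 (w := (w (0, 0) + w (0, 1)) + (w (1, 0) + w (1, 1)))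
    (add_mem (add_mem (hw _) (hw _)) (add_mem (hw _) (hw _))) ?_ v
  have he : ∀ ij, w ij =ᵐ[volume.restrict Ω]
      fun x => (M : L2Mat Ω) x ij * (A : L2Mat Ω) x ij := fun ij => by
    filter_upwards [hwf ij, coeFn_entry ij (M : L2Mat Ω), coeFn_entry ij (A : L2Mat Ω)]
      with x h1 h2 h3
    rw [h1, h2, h3]
  filter_upwards [Lp.coeFn_add (w (0, 0) + w (0, 1)) (w (1, 0) + w (1, 1)),
    Lp.coeFn_add (w (0, 0)) (w (0, 1)), Lp.coeFn_add (w (1, 0)) (w (1, 1)), he (0, 0), he (0, 1),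
    he (1, 0), he (1, 1)] with x h1 h2 h3 h4 h5 h6 h7
  rw [h1, Pi.add_apply, h2, h3, Pi.add_apply, Pi.add_apply, h4, h5, h6, h7]
  simp only [Fin.sum_univ_two]

theorem pairOp_fst (p : ℕ) (πd : QSpace 𝒯 →ₗ[ℝ] QSpace 𝒯) (v : VSpace 𝒯) :
    (pairOp 𝒯 p πd v).fst = projPoly 𝒯 p v.fst := rfl

theorem pairOp_snd (p : ℕ) (πd : QSpace 𝒯 →ₗ[ℝ] QSpace 𝒯) (v : VSpace 𝒯) :
    (pairOp 𝒯 p πd v).snd = πd v.snd := rfl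

/-- The orthogonal projection has norm at most one, hence `C ≥ 1` covers the first component, and
the squared norms add up. -/
theorem norm_pairOp_le {C : ℝ} (hC : 1 ≤ C) {πd : QSpace 𝒯 →ₗ[ℝ] QSpace 𝒯}
    (h : ∀ Q, ‖πd Q‖ ≤ C * ‖Q‖) (p : ℕ) (v : VSpace 𝒯) :
    ‖pairOp 𝒯 p πd v‖ ≤ C * ‖v‖ := by
  have h1 : ‖projPoly 𝒯 p v.fst‖ ≤ C * ‖v.fst‖ :=
    ((PolyMesh 𝒯 p).norm_starProjection_apply_le v.fst).trans
      (le_mul_of_one_le_left (norm_nonneg _) hC)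
  have h2 := pow_le_pow_left₀ (norm_nonneg _) h1 2
  have h3 := pow_le_pow_left₀ (norm_nonneg _) (h v.snd) 2
  refine le_of_sq_le_sq ?_ (mul_nonneg (zero_le_one.trans hC) (norm_nonneg v))
  rw [mul_pow, WithLp.prod_norm_sq_eq_of_L2, WithLp.prod_norm_sq_eq_of_L2, mul_add, ← mul_pow,
    ← mul_pow, pairOp_fst, pairOp_snd]
  exact add_le_add h2 h3

theorem bForm_congr (A : L2sym Ω) (u : USpace 𝒯) {v w : VSpace 𝒯}
    (h1 : pairDDiv 𝒯 u.1 w.snd = pairDDiv 𝒯 u.1 v.snd)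
    (h2 : ∫ x in Ω, (∑ i, ∑ j, (u.2.1 : L2Mat Ω) x (i, j) * (A : L2Mat Ω) x (i, j)) * w.fst x
      = ∫ x in Ω, (∑ i, ∑ j, (u.2.1 : L2Mat Ω) x (i, j) * (A : L2Mat Ω) x (i, j)) * v.fst x)
    (h3 : pairField 𝒯 u.2.1 w.snd = pairField 𝒯 u.2.1 v.snd)
    (h4 : (u.2.2 : StrongDual ℝ (QSpace 𝒯)) w.snd = (u.2.2 : StrongDual ℝ (QSpace 𝒯)) v.snd) :
    bForm 𝒯 A u w = bForm 𝒯 A u v := by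
  unfold bForm
  exact congrArg₂ (· + ·) (congrArg₂ (· + ·) (congrArg Neg.neg h1) (congrArg₂ (· + ·) h2 h3)) h4

/-- Each of the four terms of `bForm` is preserved separately. For the first one, `𝒫⁰ ⊆ 𝒫²` is used.
-/
theorem bForm_pairOp {C : ℝ} {πd : QSpace 𝒯 →ₗ[ℝ] QSpace 𝒯} (h : IsDDivOperator 𝒯 C πd) {p : ℕ}
    {A : L2sym Ω} (hA : A ∈ PolyMeshSym 𝒯 p) {u : USpace 𝒯} (hu : u ∈ UDisc 𝒯) (v : VSpace 𝒯) :
    bForm 𝒯 A u (pairOp 𝒯 p πd v) = bForm 𝒯 A u v := by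
  have h1 := Submodule.mem_prod.1 hu
  have h2 := Submodule.mem_prod.1 h1.2
  have e1 := h.dDiv u.1 (PolyMesh_mono 𝒯 zero_le_two h1.1) v.snd
  have e2 := integral_contract_projPoly 𝒯 h2.1 hA v.fst
  have e3 := h.moment u.2.1 h2.1 v.snd
  have e4 := h.trace u.2.2 h2.2 v.snd
  exact bForm_congr 𝒯 A u e1 e2 e3 e4

theorem isFortin_pairOp {C : ℝ} (hC : 1 ≤ C) {πd : QSpace 𝒯 →ₗ[ℝ] QSpace 𝒯}
    (h : IsDDivOperator 𝒯 C πd) (p : ℕ) {A : L2sym Ω} (hA : A ∈ PolyMeshSym 𝒯 p) :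
    IsFortin 𝒯 A (UDisc 𝒯) (VDisc 𝒯 p) C (pairOp 𝒯 p πd) where
  finite := finiteDimensional_VDisc 𝒯 p
  mem _ := ⟨Submodule.starProjection_apply_mem _ _, h.mem _⟩
  bound := norm_pairOp_le 𝒯 hC h.bound p
  fortin _ hu := bForm_pairOp 𝒯 h hA hu

end MeshOperator

theorem IsConvexPolygon.isBounded {Ω : Set Pt} (hΩ : IsConvexPolygon Ω) :
    Bornology.IsBounded Ω := by
  obtain ⟨-, S, rfl⟩ := hΩ
  exact (S.finite_toSet.isCompact_convexHull (𝕜 := ℝ)).isBounded.subset interior_subset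

end DPG

end

theorem mainTheorem9 (Ω : Set DPG.Pt) (hΩ : DPG.IsConvexPolygon Ω) (κ : ℝ) :
    ∃ C : ℝ, 0 < C ∧ ∀ 𝒯 : DPG.Triangulation Ω, 𝒯.ShapeRegular κ →
      ∃ πd : DPG.QSpace 𝒯 →ₗ[ℝ] DPG.QSpace 𝒯, DPG.IsDDivOperator 𝒯 C πd ∧
        ∀ (p : ℕ) (A : DPG.L2sym Ω), A ∈ DPG.PolyMeshSym 𝒯 p →
          DPG.IsFortin 𝒯 A (DPG.UDisc 𝒯) (DPG.VDisc 𝒯 p) C (DPG.pairOp 𝒯 p πd) := by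
  obtain ⟨C, hC, h⟩ := DPG.exists_localOperator_bound hΩ.isBounded κ
  refine ⟨C, zero_lt_one.trans_le hC, fun 𝒯 h𝒯 => ?_⟩
  choose π hπ hb using fun k => h (𝒯.vert k) (𝒯.nondeg k) (𝒯.subset k) (h𝒯 k)
  have hd := DPG.isDDivOperator_meshOp 𝒯 (zero_le_one.trans hC) hπ hb
  exact ⟨DPG.meshOp 𝒯 π, hd, fun p A hA => DPG.isFortin_pairOp 𝒯 hC hd p hA⟩
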